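/- Let $\mathcal{A}=\mathbb{C}[x_0,\dots,x_4]$ with its standard grading, let $n\ge 0$ be an integer, and let $A=(\alpha\;\beta)$ be an $(n+1)\times(2n+2)$ matrix over $\mathcal{A}$, where $\alpha,\beta$ are square of size $n+1$, whose first row consists of cubic forms and whose other rows consist of linear forms (zero entries allowed), such that $\alpha\beta^{t}=\beta\alpha^{t}$. Let $A'$ be $A$ with its first row erased. For a matrix $B$ with $m$ rows, let $I_m(B)$ be the ideal of its $m\times m$ minors. Put $$\mathcal{R}:=\operatorname{coker}\bigl(A:\mathcal{A}(-3)^{2n+2}\to\mathcal{A}\oplus\mathcal{A}(-2)^n\bigr).$$ Let $\widehat{M}$ be the set of complex $n\times(2n+2)$ matrices $(\mathbf{a}\;\mathbf{b})$, with $\mathbf a,\mathbf b$ of size $n\times(n+1)$, such that $\mathbf{a}\mathbf{b}^t=\mathbf{b}\mathbf{a}^t$, and let $\widehat{\Delta}\subset\widehat{M}$ be the subset of matrices of rank at most $n-1$ (the affine cones over $M^s(n,2n+2)$ and its degeneracy locus $\Delta$, which has codimension $4$). Assume: 1. The $\mathbb{P}^4$ parametrized by $A'$ is transverse to $\Delta$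 in $M^s(n,2n+2)$: for every $q\in\mathbb{C}^5\setminus\{0\}$ with $A'(q)\in\widehat\Delta$, the vectors $v\in\mathbb{C}^5$ with $A'(v)\in T_{A'(q)}\widehat\Delta$ are exactly the multiples of $q$, and $A'(\mathbb{C}^5)+T_{A'(q)}\widehat\Delta=T_{A'(q)}\widehat M$, where $T$ denotes the Zariski tangent space. 2. The $(n+1)\times(n+1)$ minors of $A$ have no common factor (every common divisor of them is a unit). 3. $\operatorname{Ann}_{\mathcal{A}}\mathcal{R}$ is a prime ideal. Let $Y\subset\mathbb{P}^4$ be the closed subscheme with homogeneous ideal $\operatorname{Ann}_{\mathcal A}\mathcal R$, let $\tilde{\mathcal R}$ be the sheaf on $\mathbb{P}^4$ associated with the graded module $\mathcal R$, and let $\tilde{\mathcal{C}}:=\mathcal{H}om_{\mathcal{O}_Y}(\tilde{\mathcal{R}},\mathcal{O}_Y)$ be the conductor sheaf. Then: (a) $\mathcal{R}=\Gamma_*(\tilde{\mathcal R})$; that is, the natural map $\mathcal{R}\to\bigoplus_{j\in\mathbb{Z}}H^0(\mathbb{P}^4,\tilde{\mathcal{R}}(j))$ is an isomorphism of graded $\mathcal{A}$-modules.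 (b) If, moreover, every point of $\mathbb{P}^4$ at which $I_n(A')$ vanishes is an improper double point of $Y$ (that is, the tangent cone of $Y$ at the point is, as a scheme, the union of two planes spanning $\mathbb{P}^4$), then $\tilde{\mathcal R}$ is reflexive, in the sense that the natural evaluation map $$\tilde{\mathcal{R}}\longrightarrow\mathcal{H}om_{\mathcal{O}_Y}(\tilde{\mathcal{C}},\mathcal{O}_Y)$$ is an isomorphism. -/

import Mathlib

open AlgebraicGeometry CategoryTheory TopologicalSpace Opposite

noncomputable section

universe u

/-! ## The sheaf of homomorphisms between two sheaves of modules -/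

namespace AlgebraicGeometry.Scheme.Modules

variable {X : Scheme.{u}}

/-- Restriction of sections of a sheaf of modules to a smaller open set. -/
def res (F : X.Modules) {V W : X.Opens} (h : W ≤ V) (s : Γ(F, V)) : Γ(F, W) :=
  F.presheaf.map (homOfLE h).op s

lemma res_add (F : X.Modules) {V W : X.Opens} (h : W ≤ V) (s t : Γ(F, V)) :
    F.res h (s + t) = F.res h s + F.res h t := map_add _ _ _

lemma res_zero (F : X.Modules) {V W : X.Opens} (h : W ≤ V) :
    F.res h (0 : Γ(F, V)) = 0 := map_zero _

lemma res_neg (F : X.Modules) {V W : X.Opens} (h : W ≤ V) (s : Γ(F, V)) :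
    F.res h (-s) = -F.res h s := map_neg _ _

lemma res_smul (F : X.Modules) {V W : X.Opens} (h : W ≤ V) (r : Γ(X, V)) (s : Γ(F, V)) :
    F.res h (r • s) = X.presheaf.map (homOfLE h).op r • F.res h s := F.map_smul _ _ _

lemma res_res (F : X.Modules) {V W T : X.Opens} (h : W ≤ V) (h' : T ≤ W) (s : Γ(F, V)) :
    F.res h' (F.res h s) = F.res (h'.trans h) s := by
  unfold res
  rw [← ConcreteCategory.comp_apply, ← F.presheaf.map_comp]
  rfl

lemma ringRes_res {V W T : X.Opens} (h : W ≤ V) (h' : T ≤ W) (s : Γ(X, V)) :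
    X.presheaf.map (homOfLE h').op (X.presheaf.map (homOfLE h).op s) =
      X.presheaf.map (homOfLE (h'.trans h)).op s := by
  rw [← ConcreteCategory.comp_apply, ← X.presheaf.map_comp]
  rfl

lemma res_self (F : X.Modules) {V : X.Opens} (h : V ≤ V) (s : Γ(F, V)) :
    F.res h s = s := by
  have : (homOfLE h).op = 𝟙 (op V) := rfl
  unfold res
  rw [this, F.presheaf.map_id]
  rfl

/-- For `𝒪_X`-modules `F` and `G`, the `𝒪_X|_U`-linear homomorphisms `F|_U ⟶ G|_U`: families of
`Γ(X, V)`-linear maps `Γ(F, V) → Γ(G, V)`, for all open `V ≤ U`, compatible with restriction. -/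
def homOn (F G : X.Modules) (U : X.Opens) :
    AddSubgroup (∀ V : {V : X.Opens // V ≤ U}, Γ(F, V.1) →ₗ[Γ(X, V.1)] Γ(G, V.1)) where
  carrier := {φ | ∀ (V W : {V : X.Opens // V ≤ U}) (h : W.1 ≤ V.1) (s : Γ(F, V.1)),
    G.res h (φ V s) = φ W (F.res h s)}
  add_mem' {φ ψ} hφ hψ V W h s := by
    have h1 := hφ V W h s
    have h2 := hψ V W h s
    simp only [Pi.add_apply, LinearMap.add_apply, res_add, h1, h2]
  zero_mem' V W h s := by simp [res_zero]
  neg_mem' {φ} hφ V W h s := by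
    have h1 := hφ V W h s
    simp only [Pi.neg_apply, LinearMap.neg_apply, res_neg, h1]

instance (F G : X.Modules) (U : X.Opens) : Module Γ(X, U) (homOn F G U) where
  smul r φ := ⟨fun V => X.presheaf.map (homOfLE V.2).op r • φ.1 V, fun V W h s => by
    have h1 := φ.2 V W h s
    simp only [LinearMap.smul_apply, res_smul, h1]
    congr 1
    exact ringRes_res V.2 h r⟩
  one_smul φ := by
    refine Subtype.ext (funext fun V => LinearMap.ext fun s => ?_)
    change X.presheaf.map (homOfLE V.2).op 1 • φ.1 V s = φ.1 V s
    rw [map_one, one_smul]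
  mul_smul a b φ := by
    refine Subtype.ext (funext fun V => LinearMap.ext fun s => ?_)
    change X.presheaf.map (homOfLE V.2).op (a * b) • φ.1 V s =
      X.presheaf.map (homOfLE V.2).op a • X.presheaf.map (homOfLE V.2).op b • φ.1 V s
    rw [map_mul, mul_smul]
  smul_zero a := by
    refine Subtype.ext (funext fun V => LinearMap.ext fun s => ?_)
    exact smul_zero _
  smul_add a φ ψ := by
    refine Subtype.ext (funext fun V => LinearMap.ext fun s => ?_)
    exact smul_add _ _ _
  add_smul a b φ := by
    refine Subtype.ext (funext fun V => LinearMap.ext fun s => ?_)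
    change X.presheaf.map (homOfLE V.2).op (a + b) • φ.1 V s =
      X.presheaf.map (homOfLE V.2).op a • φ.1 V s + X.presheaf.map (homOfLE V.2).op b • φ.1 V s
    rw [map_add, add_smul]
  zero_smul φ := by
    refine Subtype.ext (funext fun V => LinearMap.ext fun s => ?_)
    change X.presheaf.map (homOfLE V.2).op 0 • φ.1 V s = 0
    rw [map_zero, zero_smul]

/-- Restriction of a homomorphism `F|_U ⟶ G|_U` to a smaller open set. -/
def homOnRes (F G : X.Modules) {U U' : X.Opens} (h : U' ≤ U) : homOn F G U →+ homOn F G U' where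
  toFun φ := ⟨fun V => φ.1 ⟨V.1, V.2.trans h⟩,
    fun V W hVW s => φ.2 ⟨V.1, V.2.trans h⟩ ⟨W.1, W.2.trans h⟩ hVW s⟩
  map_zero' := rfl
  map_add' _ _ := rfl

/-- The abelian presheaf `U ↦ Hom(F|_U, G|_U)`. -/
def homPresheaf (F G : X.Modules) : TopCat.Presheaf Ab.{u} X where
  obj U := AddCommGrpCat.of (homOn F G U.unop)
  map i := AddCommGrpCat.ofHom (homOnRes F G i.unop.le)
  map_id _ := rfl
  map_comp _ _ := rfl

/-- Two sections that agree locally are equal. -/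
lemma eq_of_res_eq (G : X.Modules) {V : X.Opens} {ι : Type u} (U : ι → X.Opens)
    (hU : ∀ i, U i ≤ V) (hV : V ≤ iSup U) (s t : Γ(G, V))
    (h : ∀ i, G.res (hU i) s = G.res (hU i) t) : s = t :=
  TopCat.Sheaf.eq_of_locally_eq' (⟨G.presheaf, G.isSheaf⟩ : TopCat.Sheaf Ab.{u} X) U V
    (fun i => homOfLE (hU i)) hV s t h

/-- Compatible local sections glue. -/
lemma exists_glue (G : X.Modules) {V : X.Opens} {ι : Type u} (U : ι → X.Opens)
    (hU : ∀ i, U i ≤ V) (hV : V ≤ iSup U) (t : ∀ i, Γ(G, U i))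
    (h : ∀ i j, G.res (inf_le_left : U i ⊓ U j ≤ U i) (t i) =
      G.res (inf_le_right : U i ⊓ U j ≤ U j) (t j)) :
    ∃ s : Γ(G, V), ∀ i, G.res (hU i) s = t i :=
  (TopCat.Sheaf.existsUnique_gluing' (⟨G.presheaf, G.isSheaf⟩ : TopCat.Sheaf Ab.{u} X) U V
    (fun i => homOfLE (hU i)) hV t h).exists

lemma homPresheaf_isSheaf (F G : X.Modules) : (homPresheaf F G).IsSheaf := by
  rw [TopCat.Presheaf.isSheaf_iff_isSheafUniqueGluing]
  intro ι U φ hφ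
  have hφ' : ∀ (i j : ι) (V : X.Opens) (hi : V ≤ U i) (hj : V ≤ U j) (s : Γ(F, V)),
      (show homOn F G (U i) from φ i).1 ⟨V, hi⟩ s =
        (show homOn F G (U j) from φ j).1 ⟨V, hj⟩ s := fun i j V hi hj s =>
    LinearMap.congr_fun (congrFun (congrArg Subtype.val (hφ i j)) ⟨V, le_inf hi hj⟩) s
  have hcov : ∀ V : {V : X.Opens // V ≤ iSup U}, V.1 ≤ ⨆ i, V.1 ⊓ U i := fun V => by
    rw [← inf_iSup_eq]
    exact le_inf le_rfl V.2
  have key : ∀ (V : {V : X.Opens // V ≤ iSup U}) (s : Γ(F, V.1)), ∃ t : Γ(G, V.1),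
      ∀ i, G.res (inf_le_left : V.1 ⊓ U i ≤ V.1) t =
        (show homOn F G (U i) from φ i).1 ⟨V.1 ⊓ U i, inf_le_right⟩ (F.res inf_le_left s) := by
    intro V s
    apply G.exists_glue (fun i => V.1 ⊓ U i) (fun i => inf_le_left) (hcov V)
    intro i j
    have h1 := (show homOn F G (U i) from φ i).2 ⟨V.1 ⊓ U i, inf_le_right⟩
      ⟨(V.1 ⊓ U i) ⊓ (V.1 ⊓ U j), inf_le_left.trans inf_le_right⟩ inf_le_left
      (F.res inf_le_left s)
    have h2 := (show homOn F G (U j) from φ j).2 ⟨V.1 ⊓ U j, inf_le_right⟩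
      ⟨(V.1 ⊓ U i) ⊓ (V.1 ⊓ U j), inf_le_right.trans inf_le_right⟩ inf_le_right
      (F.res inf_le_left s)
    rw [res_res] at h1 h2
    exact h1.trans ((hφ' i j _ _ _ _).trans h2.symm)
  choose g hg using key
  have huniq : ∀ (V : {V : X.Opens // V ≤ iSup U}) (t t' : Γ(G, V.1)),
      (∀ i, G.res (inf_le_left : V.1 ⊓ U i ≤ V.1) t = G.res inf_le_left t') → t = t' :=
    fun V t t' h => G.eq_of_res_eq (fun i => V.1 ⊓ U i) (fun i => inf_le_left) (hcov V) t t' h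
  let Φ : homOn F G (iSup U) := ⟨fun V =>
    { toFun := g V
      map_add' := fun s t => huniq V _ _ fun i => by
        rw [hg, res_add, res_add, map_add, hg, hg]
      map_smul' := fun r s => huniq V _ _ fun i => by
        rw [hg, RingHom.id_apply, res_smul, res_smul, hg]
        exact LinearMap.map_smul _ _ _ }, by
    intro V W h s
    apply huniq W
    intro i
    change G.res _ (G.res h (g V s)) = G.res _ (g W (F.res h s))
    have hle : W.1 ⊓ U i ≤ V.1 ⊓ U i := inf_le_inf_right _ h
    rw [hg, res_res, res_res, ← res_res G (inf_le_left : V.1 ⊓ U i ≤ V.1) hle, hg]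
    have h1 := (show homOn F G (U i) from φ i).2 ⟨V.1 ⊓ U i, inf_le_right⟩
      ⟨W.1 ⊓ U i, inf_le_right⟩ hle (F.res inf_le_left s)
    rw [res_res] at h1
    exact h1⟩
  refine ⟨Φ, ?_, ?_⟩
  · intro i
    refine Subtype.ext (funext fun V => LinearMap.ext fun s => ?_)
    change g ⟨V.1, V.2.trans (le_iSup U i)⟩ s = (show homOn F G (U i) from φ i).1 V s
    apply huniq ⟨V.1, V.2.trans (le_iSup U i)⟩
    intro j
    rw [hg]
    have h1 := (show homOn F G (U i) from φ i).2 V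
      ⟨V.1 ⊓ U j, inf_le_left.trans V.2⟩ inf_le_left s
    exact (hφ' j i _ _ _ _).trans h1.symm
  · intro Ψ hΨ
    refine Subtype.ext (funext fun V => LinearMap.ext fun s => ?_)
    change (show homOn F G (iSup U) from Ψ).1 V s = g V s
    apply huniq V
    intro i
    rw [hg]
    have h1 := (show homOn F G (iSup U) from Ψ).2 V
      ⟨V.1 ⊓ U i, inf_le_left.trans V.2⟩ inf_le_left s
    refine h1.trans ?_
    exact LinearMap.congr_fun (congrFun (congrArg Subtype.val (hΨ i)) ⟨V.1 ⊓ U i, inf_le_right⟩) _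

/-- The sheaf of homomorphisms `ℋom(F, G)`. -/
def sheafHom (F G : X.Modules) : X.Modules where
  val :=
    letI (U : (X.Opens)ᵒᵖ) : Module (X.ringCatSheaf.obj.obj U) ((homPresheaf F G).obj U) :=
      inferInstanceAs (Module Γ(X, U.unop) (homOn F G U.unop))
    .ofPresheaf (homPresheaf F G) fun U V i r φ => by
      refine Subtype.ext (funext fun W => LinearMap.ext fun s => ?_)
      change X.presheaf.map (homOfLE (W.2.trans i.unop.le)).op r •
          (show homOn F G U.unop from φ).1 ⟨W.1, W.2.trans i.unop.le⟩ s =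
        X.presheaf.map (homOfLE W.2).op (X.presheaf.map i r) •
          (show homOn F G U.unop from φ).1 ⟨W.1, W.2.trans i.unop.le⟩ s
      congr 1
      exact (ringRes_res i.unop.le W.2 r).symm
  isSheaf := homPresheaf_isSheaf F G

/-- The sections of `ℋom(F, G)` over `U` are the homomorphisms `F|_U ⟶ G|_U`. -/
def homSections (F G : X.Modules) (U : X.Opens) :
    Γ(sheafHom F G, U) ≃ₗ[Γ(X, U)] homOn F G U where
  toFun φ := φ
  invFun φ := φ
  map_add' _ _ := rfl
  map_smul' _ _ := rfl
  left_inv _ := rfl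
  right_inv _ := rfl

/-- Evaluation of sections of `ℋom(F, G)` over `V` at a section of `F` over `V`. -/
def evalSection (F G : X.Modules) {V : X.Opens} (s : Γ(F, V)) :
    Γ(sheafHom F G, V) →ₗ[Γ(X, V)] Γ(G, V) where
  toFun φ := (homSections F G V φ).1 ⟨V, le_rfl⟩ s
  map_add' _ _ := rfl
  map_smul' r φ := by
    change X.presheaf.map (homOfLE (le_refl V)).op r •
      (homSections F G V φ).1 ⟨V, le_rfl⟩ s = r • (homSections F G V φ).1 ⟨V, le_rfl⟩ s
    congr 1
    have : (homOfLE (le_refl V)).op = 𝟙 (op V) := rfl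
    rw [this, X.presheaf.map_id]
    rfl

/-- The canonical map `Γ(F, U) → Hom(ℋom(F, G)|_U, G|_U)` sending `s` to evaluation at `s`. -/
def evalHom (F G : X.Modules) (U : X.Opens) :
    Γ(F, U) →ₗ[Γ(X, U)] homOn (sheafHom F G) G U where
  toFun s := ⟨fun V => evalSection F G (F.res V.2 s), fun V W h φ => by
    have h1 := (homSections F G V.1 φ).2 ⟨V.1, le_rfl⟩ ⟨W.1, h⟩ h (F.res V.2 s)
    rw [res_res] at h1
    exact h1⟩
  map_add' s t := by
    refine Subtype.ext (funext fun V => LinearMap.ext fun φ => ?_)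
    change (homSections F G V.1 φ).1 ⟨V.1, le_rfl⟩ (F.res V.2 (s + t)) =
      (homSections F G V.1 φ).1 ⟨V.1, le_rfl⟩ (F.res V.2 s) +
      (homSections F G V.1 φ).1 ⟨V.1, le_rfl⟩ (F.res V.2 t)
    rw [res_add, map_add]
  map_smul' r s := by
    refine Subtype.ext (funext fun V => LinearMap.ext fun φ => ?_)
    change (homSections F G V.1 φ).1 ⟨V.1, le_rfl⟩ (F.res V.2 (r • s)) =
      X.presheaf.map (homOfLE V.2).op r •
        (homSections F G V.1 φ).1 ⟨V.1, le_rfl⟩ (F.res V.2 s)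
    rw [res_smul, LinearMap.map_smul]

/-- The canonical evaluation morphism `F ⟶ ℋom(ℋom(F, G), G)`, `s ↦ (φ ↦ φ(s))`. -/
def toDoubleHom (F G : X.Modules) : F ⟶ sheafHom (sheafHom F G) G :=
  SheafOfModules.Hom.mk <| PresheafOfModules.homMk
    { app U := AddCommGrpCat.ofHom (evalHom F G U.unop).toAddMonoidHom
      naturality U U' i := by
        ext s
        refine Subtype.ext (funext fun V => LinearMap.ext fun φ => ?_)
        exact congrArg (fun t => (homSections F G V.1 φ).1 ⟨V.1, le_rfl⟩ t)
          (F.res_res i.unop.le V.2 s) }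
    fun U r s => (evalHom F G U.unop).map_smul r s

end AlgebraicGeometry.Scheme.Modules

/-! ## The sheaf on `Proj` associated with a graded module -/

namespace GradedTilde

variable {A : Type u} {σ : Type*} [CommRing A] [SetLike σ A] [AddSubgroupClass σ A]
  (𝒜 : ℕ → σ) [GradedRing 𝒜] {M : Type u} [AddCommGroup M] [Module A M]

/-- `𝒜 i • ℳ k ⊆ ℳ (i + k)`, for a `ℤ`-indexed family `ℳ` of subgroups of `M`. -/
class IsGradedModule (ℳ : ℤ → AddSubgroup M) : Prop where
  smul_mem : ∀ {i : ℕ} {k : ℤ} {a : A} {m : M}, a ∈ 𝒜 i → m ∈ ℳ k → a • m ∈ ℳ (i + k)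

/-- The shifted graded module `M(j)`, with `M(j)_k = M_{j + k}`. -/
def shift (ℳ : ℤ → AddSubgroup M) (j : ℤ) : ℤ → AddSubgroup M := fun k => ℳ (j + k)

instance (ℳ : ℤ → AddSubgroup M) [IsGradedModule 𝒜 ℳ] (j : ℤ) :
    IsGradedModule 𝒜 (shift ℳ j) where
  smul_mem {i k a m} ha hm := by
    have := IsGradedModule.smul_mem (𝒜 := 𝒜) (ℳ := ℳ) ha hm
    rwa [add_left_comm] at this

instance (x : ProjectiveSpectrum.top 𝒜) : x.asHomogeneousIdeal.toIdeal.IsPrime := x.isPrime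

variable (M) in
/-- The localization of `M` at the homogeneous prime `x`. The submodule of fractions `m / f` with
`m`, `f` homogeneous of the same degree is the degree-zero localization `M_(x)`. -/
abbrev Fiber (x : ProjectiveSpectrum.top 𝒜) : Type u :=
  LocalizedModule x.asHomogeneousIdeal.toIdeal.primeCompl M

variable {𝒜} in
/-- `f` is a single fraction `m / s` with `m`, `s` homogeneous of the same degree. -/
def IsFraction (ℳ : ℤ → AddSubgroup M) {U : Opens (ProjectiveSpectrum.top 𝒜)}
    (f : ∀ x : U, Fiber 𝒜 M x.1) : Prop :=
  ∃ (i : ℕ) (m : M) (s : A), m ∈ ℳ i ∧ s ∈ 𝒜 i ∧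
    ∀ x : U, ∃ hs : s ∉ x.1.asHomogeneousIdeal.toIdeal, f x = LocalizedModule.mk m ⟨s, hs⟩

/-- Being such a fraction is inherited by smaller open sets. -/
def isFractionPrelocal (ℳ : ℤ → AddSubgroup M) : TopCat.PrelocalPredicate (Fiber 𝒜 M) where
  pred {_} f := IsFraction ℳ f
  res := by rintro V U i f ⟨d, m, s, hm, hs, w⟩; exact ⟨d, m, s, hm, hs, fun x => w (i x)⟩

/-- Being locally such a fraction. -/
def isLocallyFraction (ℳ : ℤ → AddSubgroup M) : TopCat.LocalPredicate (Fiber 𝒜 M) :=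
  (isFractionPrelocal 𝒜 ℳ).sheafify

variable (ℳ : ℤ → AddSubgroup M) [IsGradedModule 𝒜 ℳ]

/-- The sections over `U` of the sheaf associated with `M`. -/
def sections (U : Opens (ProjectiveSpectrum.top 𝒜)) :
    AddSubgroup (∀ x : U, Fiber 𝒜 M x.1) where
  carrier := {f | (isLocallyFraction 𝒜 ℳ).pred f}
  add_mem' {a b} ha hb x := by
    obtain ⟨Va, ma, ia, da, ra, sa, hra, hsa, wa⟩ := ha x
    obtain ⟨Vb, mb, ib, db, rb, sb, hrb, hsb, wb⟩ := hb x
    refine ⟨Va ⊓ Vb, ⟨ma, mb⟩, Opens.infLELeft _ _ ≫ ia, da + db, sb • ra + sa • rb, sa * sb,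
      add_mem ?_ ?_, SetLike.mul_mem_graded hsa hsb, fun x => ?_⟩
    · have := IsGradedModule.smul_mem (𝒜 := 𝒜) (ℳ := ℳ) hsb hra
      rwa [add_comm, ← Nat.cast_add] at this
    · have := IsGradedModule.smul_mem (𝒜 := 𝒜) (ℳ := ℳ) hsa hrb
      rwa [← Nat.cast_add] at this
    · obtain ⟨hsax, hsa⟩ := wa ⟨x.1, x.2.1⟩
      obtain ⟨hsbx, hsb⟩ := wb ⟨x.1, x.2.2⟩
      exact ⟨x.1.asHomogeneousIdeal.toIdeal.primeCompl.mul_mem hsax hsbx,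
        congr($hsa + $hsb).trans (LocalizedModule.mk_add_mk ..)⟩
  zero_mem' x := ⟨U, x.2, 𝟙 _, 0, 0, 1, zero_mem _, SetLike.one_mem_graded 𝒜, fun y =>
    ⟨y.1.asHomogeneousIdeal.toIdeal.primeCompl.one_mem, (LocalizedModule.zero_mk _).symm⟩⟩
  neg_mem' {a} ha x := by
    obtain ⟨V, mV, iV, d, r, s, hr, hs, w⟩ := ha x
    refine ⟨V, mV, iV, d, -r, s, neg_mem hr, hs, fun x => ?_⟩
    obtain ⟨hsx, hx⟩ := w x
    exact ⟨hsx, congr(-$hx).trans LocalizedModule.mk_neg.symm⟩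

/-- The degree-zero localization of `A` at `x` acts on the localization of `M` at `x`. -/
instance fiberModule (x : ProjectiveSpectrum.top 𝒜) :
    Module (HomogeneousLocalization.AtPrime 𝒜 x.asHomogeneousIdeal.toIdeal) (Fiber 𝒜 M x) :=
  Module.compHom _ (algebraMap (HomogeneousLocalization.AtPrime 𝒜 x.asHomogeneousIdeal.toIdeal)
    (Localization x.asHomogeneousIdeal.toIdeal.primeCompl))

lemma smul_mem_sections {U : Opens (ProjectiveSpectrum.top 𝒜)}
    (r : (ProjectiveSpectrum.Proj.structureSheaf 𝒜).1.obj (op U)) (f : sections 𝒜 ℳ U) :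
    (fun x : U => r.1 x • f.1 x) ∈ sections 𝒜 ℳ U := by
  intro x
  obtain ⟨V, hxV, iV, d, ⟨p, hp⟩, ⟨q, hq⟩, hqn, w⟩ := r.2 x
  obtain ⟨W, hxW, iW, e, m, s, hm, hs, w'⟩ := f.2 x
  refine ⟨V ⊓ W, ⟨hxV, hxW⟩, Opens.infLELeft _ _ ≫ iV, d + e, p • m, q * s, ?_,
    SetLike.mul_mem_graded hq hs, fun y => ?_⟩
  · have := IsGradedModule.smul_mem (𝒜 := 𝒜) (ℳ := ℳ) hp hm
    rwa [← Nat.cast_add] at this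
  · obtain ⟨hsy, hy⟩ := w' ⟨y.1, y.2.2⟩
    have hz := w ⟨y.1, y.2.1⟩
    refine ⟨y.1.asHomogeneousIdeal.toIdeal.primeCompl.mul_mem (hqn ⟨y.1, y.2.1⟩) hsy, ?_⟩
    refine (congr($hz • $hy)).trans ?_
    exact LocalizedModule.mk_smul_mk (S := y.1.asHomogeneousIdeal.toIdeal.primeCompl) p m
      ⟨q, hqn ⟨y.1, y.2.1⟩⟩ ⟨s, hsy⟩

instance sectionsModule (U : Opens (ProjectiveSpectrum.top 𝒜)) :
    Module ((ProjectiveSpectrum.Proj.structureSheaf 𝒜).1.obj (op U)) (sections 𝒜 ℳ U) where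
  smul r f := ⟨fun x => r.1 x • f.1 x, smul_mem_sections 𝒜 ℳ r f⟩
  one_smul _ := Subtype.ext (funext fun _ => one_smul _ _)
  mul_smul _ _ _ := Subtype.ext (funext fun _ => mul_smul _ _ _)
  smul_zero _ := Subtype.ext (funext fun _ => smul_zero _)
  smul_add _ _ _ := Subtype.ext (funext fun _ => smul_add _ _ _)
  add_smul _ _ _ := Subtype.ext (funext fun _ => add_smul _ _ _)
  zero_smul _ := Subtype.ext (funext fun _ => zero_smul _ _)

/-- The underlying presheaf of abelian groups of the sheaf associated with `M`. -/
def presheaf : TopCat.Presheaf Ab.{u} (ProjectiveSpectrum.top 𝒜) where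
  obj U := AddCommGrpCat.of (sections 𝒜 ℳ U.unop)
  map i := AddCommGrpCat.ofHom
    { toFun f := ⟨fun x => f.1 (i.unop x), (isLocallyFraction 𝒜 ℳ).res i.unop f.1 f.2⟩
      map_zero' := rfl
      map_add' _ _ := rfl }
  map_id _ := rfl
  map_comp _ _ := rfl

/-- The sheaf of modules `M~` on `Proj 𝒜` associated with the graded module `M`. -/
def gradedTilde : (Proj 𝒜).Modules where
  val :=
    letI (U : ((Proj 𝒜).Opens)ᵒᵖ) :
        Module ((Proj 𝒜).ringCatSheaf.obj.obj U) ((presheaf 𝒜 ℳ).obj U) :=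
      sectionsModule 𝒜 ℳ U.unop
    .ofPresheaf (presheaf 𝒜 ℳ) fun _ _ _ _ _ => rfl
  isSheaf := (TopCat.Presheaf.isSheaf_iff_isSheaf_comp (forget AddCommGrpCat) _).2
    (TopCat.subsheafToTypes (isLocallyFraction 𝒜 ℳ)).2

/-- The natural map `M_j → H⁰(Proj 𝒜, M(j)~)`, sending `m` to the section `x ↦ m / 1`. -/
def toGlobalSections (j : ℤ) : ℳ j →+ Γ(gradedTilde 𝒜 (shift ℳ j), ⊤) :=
  show ℳ j →+ sections 𝒜 (shift ℳ j) ⊤ from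
  { toFun m := ⟨fun _ => LocalizedModule.mk m.1 1, fun x => ⟨⊤, x.2, 𝟙 _, 0, m.1, 1,
      by simp [shift], SetLike.one_mem_graded 𝒜, fun y =>
        ⟨y.1.asHomogeneousIdeal.toIdeal.primeCompl.one_mem, rfl⟩⟩⟩
    map_zero' := Subtype.ext (funext fun x => LocalizedModule.zero_mk _)
    map_add' m n := Subtype.ext (funext fun x => by
      change LocalizedModule.mk (m.1 + n.1) 1 =
        LocalizedModule.mk m.1 1 + LocalizedModule.mk n.1 1
      simp) }

/-- `ℕ` acts on `ℤ` by translation. -/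
@[reducible] def natTranslation : AddAction ℕ ℤ where
  vadd i k := i + k
  zero_vadd k := by change ((0 : ℕ) : ℤ) + k = k; simp
  add_vadd i j k := by change ((i + j : ℕ) : ℤ) + k = i + (j + k); push_cast; ring

attribute [local instance] natTranslation

/-- `𝒜 i • Γ(M(j)~) ⊆ Γ(M(i + j)~)`, all these sections being functions with values in the
localizations of `M`. -/
instance gradedSMul_sections : SetLike.GradedSMul 𝒜 (fun j : ℤ => sections 𝒜 (shift ℳ j) ⊤) where
  smul_mem {i j a f} ha hf x := by
    obtain ⟨V, mV, iV, d, r, s, hr, hs, w⟩ := hf x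
    refine ⟨V, mV, iV, d, a • r, s, ?_, hs, fun x => ?_⟩
    · have := IsGradedModule.smul_mem (𝒜 := 𝒜) (ℳ := ℳ) ha hr
      change a • r ∈ ℳ ((i + j) + d)
      rwa [add_assoc]
    · obtain ⟨hsx, hx⟩ := w x
      exact ⟨hsx, congr(a • $hx).trans (LocalizedModule.smul'_mk _ _ _)⟩

/-- The full module of sections `Γ_*(M~) = ⨁_{j ∈ ℤ} H⁰(Proj 𝒜, M(j)~)`. When `A` is generated in
degree one, `M(j)~` is the twist `M~(j)`. -/
def GammaStar : Type u := DirectSum ℤ fun j => Γ(gradedTilde 𝒜 (shift ℳ j), ⊤)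

instance : AddCommGroup (GammaStar 𝒜 ℳ) :=
  inferInstanceAs (AddCommGroup (DirectSum ℤ fun j => Γ(gradedTilde 𝒜 (shift ℳ j), ⊤)))

/-- The graded `A`-module structure of `Γ_*(M~)`, induced by multiplication
`𝒜 i × H⁰(M(j)~) → H⁰(M(i + j)~)`. -/
instance : Module A (GammaStar 𝒜 ℳ) :=
  GradedModule.isModule 𝒜 (fun j : ℤ => sections 𝒜 (shift ℳ j) ⊤)

/-- The inclusion of the summand of degree `j` into `Γ_*(M~)`. -/
def GammaStar.of (j : ℤ) : Γ(gradedTilde 𝒜 (shift ℳ j), ⊤) →+ GammaStar 𝒜 ℳ :=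
  DirectSum.of (fun j => Γ(gradedTilde 𝒜 (shift ℳ j), ⊤)) j

end GradedTilde

/-! ## Canonical surfaces in `ℙ⁴`: the algebraic data -/

namespace CanonicalSurface

open MvPolynomial

/-- The homogeneous coordinate ring `ℂ[x₀, …, x₄]` of `ℙ⁴`. -/
abbrev Coord : Type := MvPolynomial (Fin 5) ℂ

/-- The grading of `ℂ[x₀, …, x₄]` by degree. -/
abbrev grading : ℕ → Submodule ℂ Coord := homogeneousSubmodule (Fin 5) ℂ

instance : GradedRing grading := MvPolynomial.gradedAlgebra

/-- Projective 4-space over `ℂ`. -/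
abbrev P4 : Scheme.{0} := Proj grading

/-- Forms of degree `d ∈ ℤ`; only `0` if `d < 0`. -/
def formDeg (d : ℤ) : AddSubgroup Coord where
  carrier := {p | ∀ m, p.coeff m ≠ 0 → (m.degree : ℤ) = d}
  zero_mem' m hm := absurd (coeff_zero m) hm
  add_mem' {p q} hp hq m hm := by
    by_cases h : p.coeff m = 0
    · exact hq m (by simpa [coeff_add, h] using hm)
    · exact hp m h
  neg_mem' {p} hp m hm := hp m (by simpa using hm)

instance : GradedTilde.IsGradedModule grading formDeg where
  smul_mem {i k a p} ha hp m hm := by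
    classical
    rw [smul_eq_mul, coeff_mul] at hm
    obtain ⟨⟨u, v⟩, huv, h⟩ := Finset.exists_ne_zero_of_sum_ne_zero hm
    have h1 : u.degree = i := by
      rw [Finsupp.degree_eq_weight_one]
      exact (mem_homogeneousSubmodule _ _).1 ha (left_ne_zero_of_mul h)
    have h2 := hp v (right_ne_zero_of_mul h)
    rw [← Finset.HasAntidiagonal.mem_antidiagonal.1 huv, map_add, Nat.cast_add, h1, h2]

/-- The graded free module `⨁ᵢ A(-wᵢ)`: in degree `k`, the `i`-th entry is a form of degree
`k - wᵢ`. -/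
def freeDeg {ι : Type} (w : ι → ℤ) (k : ℤ) : AddSubgroup (ι → Coord) where
  carrier := {v | ∀ i, v i ∈ formDeg (k - w i)}
  zero_mem' _ := zero_mem _
  add_mem' hu hv i := add_mem (hu i) (hv i)
  neg_mem' hv i := neg_mem (hv i)

instance {ι : Type} (w : ι → ℤ) : GradedTilde.IsGradedModule grading (freeDeg w) where
  smul_mem {i k a v} ha hv l := by
    have := GradedTilde.IsGradedModule.smul_mem (𝒜 := grading) (ℳ := formDeg) ha (hv l)
    rwa [← add_sub_assoc] at this

/-- The grading induced on a quotient module. -/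
def quotDeg {M : Type} [AddCommGroup M] [Module Coord M] (ℳ : ℤ → AddSubgroup M)
    (N : Submodule Coord M) (k : ℤ) : AddSubgroup (M ⧸ N) :=
  (ℳ k).map N.mkQ.toAddMonoidHom

instance {M : Type} [AddCommGroup M] [Module Coord M] (ℳ : ℤ → AddSubgroup M)
    [GradedTilde.IsGradedModule grading ℳ] (N : Submodule Coord M) :
    GradedTilde.IsGradedModule grading (quotDeg ℳ N) where
  smul_mem {i k a v} ha hv := by
    obtain ⟨m, hm, rfl⟩ := hv
    exact ⟨a • m, GradedTilde.IsGradedModule.smul_mem (𝒜 := grading) (ℳ := ℳ) ha hm,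
      map_smul N.mkQ a m⟩

/-- The `(n+1) × (2n+2)` matrix `A = (α β)`. -/
abbrev bigMatrix {n : ℕ} (α β : Matrix (Fin (n + 1)) (Fin (n + 1)) Coord) :
    Matrix (Fin (n + 1)) (Fin (n + 1) ⊕ Fin (n + 1)) Coord :=
  Matrix.fromCols α β

/-- The matrix `A'`: the matrix `A = (α β)` with its first row erased. -/
abbrev lowerMatrix {n : ℕ} (α β : Matrix (Fin (n + 1)) (Fin (n + 1)) Coord) :
    Matrix (Fin n) (Fin (n + 1) ⊕ Fin (n + 1)) Coord :=
  (bigMatrix α β).submatrix Fin.succ id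

/-- The ideal generated by the maximal minors (of size the number of rows) of a matrix. -/
def minorsIdeal {m : ℕ} {κ : Type} (B : Matrix (Fin m) κ Coord) : Ideal Coord :=
  Ideal.span (Set.range fun c : Fin m → κ => (B.submatrix id c).det)

/-- The module `R = coker (A : 𝒜(-3)^(2n+2) → 𝒜 ⊕ 𝒜(-2)^n)`. -/
abbrev R {n : ℕ} (α β : Matrix (Fin (n + 1)) (Fin (n + 1)) Coord) : Type :=
  (Fin (n + 1) → Coord) ⧸ LinearMap.range (bigMatrix α β).mulVecLin

/-- The grading of `R`, as a quotient of `𝒜 ⊕ 𝒜(-2)^n`. -/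
abbrev RDeg {n : ℕ} (α β : Matrix (Fin (n + 1)) (Fin (n + 1)) Coord) :
    ℤ → AddSubgroup (R α β) :=
  quotDeg (freeDeg (Fin.cons 0 fun _ => 2)) (LinearMap.range (bigMatrix α β).mulVecLin)

/-- The homogeneous ideal `Ann R` of the surface `Y = Supp R`. -/
abbrev idealY {n : ℕ} (α β : Matrix (Fin (n + 1)) (Fin (n + 1)) Coord) : Ideal Coord :=
  Module.annihilator Coord (R α β)

/-- The sheaf `R~` on `ℙ⁴`. -/
def RSheaf {n : ℕ} (α β : Matrix (Fin (n + 1)) (Fin (n + 1)) Coord) : P4.Modules :=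
  GradedTilde.gradedTilde grading (RDeg α β)

/-- The structure sheaf `𝒪_Y` of `Y ⊆ ℙ⁴`, as a sheaf on `ℙ⁴`: the sheaf associated with the
homogeneous coordinate ring `𝒜 / Ann R`. As `𝒪_{ℙ⁴} → 𝒪_Y` is a surjection of sheaves, `𝒪_Y`-linear
and `𝒪_{ℙ⁴}`-linear homomorphisms between sheaves of `𝒪_Y`-modules are the same. -/
def OY {n : ℕ} (α β : Matrix (Fin (n + 1)) (Fin (n + 1)) Coord) : P4.Modules :=
  GradedTilde.gradedTilde grading (quotDeg formDeg (idealY α β))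

/-- The sheaf of conductors `C~ = ℋom_{𝒪_Y}(R~, 𝒪_Y)`. -/
abbrev conductorSheaf {n : ℕ} (α β : Matrix (Fin (n + 1)) (Fin (n + 1)) Coord) : P4.Modules :=
  (RSheaf α β).sheafHom (OY α β)

/-! ### Transversality to the degeneracy locus -/

/-- The affine cone over `M^s(n, 2n+2)`: matrices `(a b)` with `a bᵗ` symmetric. -/
def symCone (n : ℕ) : Set (Matrix (Fin n) (Fin (n + 1) ⊕ Fin (n + 1)) ℂ) :=
  {M | M.toCols₁ * M.toCols₂.transpose = M.toCols₂ * M.toCols₁.transpose}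

/-- The affine cone over the degeneracy locus `Δ ⊆ M^s(n, 2n+2)` of matrices of rank at most
`n - 1`. -/
def degCone (n : ℕ) : Set (Matrix (Fin n) (Fin (n + 1) ⊕ Fin (n + 1)) ℂ) :=
  {M | M ∈ symCone n ∧ M.rank < n}

/-- The Zariski tangent space at `z` of a closed algebraic set `Z` of matrices: the vectors
annihilated by the differentials at `z` of all polynomials vanishing on `Z`. -/
def tangentSpace {m k : Type} [Fintype m] [Fintype k] (Z : Set (Matrix m k ℂ))
    (z : Matrix m k ℂ) : Submodule ℂ (Matrix m k ℂ) where
  carrier := {v | ∀ f : MvPolynomial (m × k) ℂ,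
    (∀ M ∈ Z, eval (fun p => M p.1 p.2) f = 0) →
      ∑ p : m × k, eval (fun p => z p.1 p.2) (pderiv p f) * v p.1 p.2 = 0}
  zero_mem' f _ := by simp
  add_mem' {u v} hu hv f hf := by
    simp only [Matrix.add_apply, mul_add, Finset.sum_add_distrib, hu f hf, hv f hf, add_zero]
  smul_mem' c v hv f hf := by
    simp only [Matrix.smul_apply, smul_eq_mul, mul_left_comm _ c, ← Finset.mul_sum, hv f hf,
      mul_zero]

/-- The value of a matrix of polynomials at a point of `ℂ⁵`. -/
def evalAt {m k : Type} (B : Matrix m k Coord) (q : Fin 5 → ℂ) : Matrix m k ℂ :=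
  B.map (eval q)

/-- The `ℙ⁴` parametrized by a matrix `B` of linear forms is transverse to `Δ` inside
`M^s(n, 2n+2)`. As `Δ` has codimension `4`, this means: at each point of `ℙ⁴` that is mapped
to `Δ`, the tangent spaces of `ℙ⁴` and of `Δ` are complementary in that of `M^s(n, 2n+2)`. In terms
of affine cones, where `ℂ⁵` maps linearly by `v ↦ B(v)`: the vectors of `ℂ⁵` tangent to the cone over
`Δ` at `B(q)` are the multiples of `q`, and `ℂ⁵` together with the tangent space to the cone
over `Δ` spans the tangent space to the cone over `M^s(n, 2n+2)`. -/
def IsTransverse {n : ℕ} (B : Matrix (Fin n) (Fin (n + 1) ⊕ Fin (n + 1)) Coord) : Prop :=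
  ∀ q : Fin 5 → ℂ, q ≠ 0 → evalAt B q ∈ degCone n →
    (∀ v, evalAt B v ∈ tangentSpace (degCone n) (evalAt B q) → v ∈ Submodule.span ℂ {q}) ∧
    (∀ w ∈ tangentSpace (symCone n) (evalAt B q),
      ∃ v, ∃ t ∈ tangentSpace (degCone n) (evalAt B q), w = evalAt B v + t)

/-! ### Improper double points -/

/-- The ideal of the tangent cone at `q ∈ ℂ⁵` of the affine cone `V(I) ⊆ ℂ⁵`, generated by the
lowest-degree homogeneous parts of the polynomials `f(q + x)`, `f ∈ I`. For `q ≠ 0`, this is the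
affine cone over the (embedded, projective) tangent cone of `V(I) ⊆ ℙ⁴` at the point `[q]`. -/
def tangentConeIdeal (I : Ideal Coord) (q : Fin 5 → ℂ) : Ideal Coord :=
  Ideal.span {h | ∃ f ∈ I, ∃ d : ℕ,
    (∀ e < d, homogeneousComponent e (aeval (fun i => C (q i) + X i) f : Coord) = 0) ∧
    h = homogeneousComponent d (aeval (fun i => C (q i) + X i) f : Coord)}

/-- `[q] ∈ ℙ⁴` is an improper double point of the subscheme defined by `I`: its tangent cone there
is the union of two planes (the projectivizations of `V₁` and `V₂`) through `[q]` spanning `ℙ⁴`. -/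
def IsImproperDoublePoint (I : Ideal Coord) (q : Fin 5 → ℂ) : Prop :=
  ∃ V₁ V₂ : Submodule ℂ (Fin 5 → ℂ), Module.finrank ℂ V₁ = 3 ∧ Module.finrank ℂ V₂ = 3 ∧
    q ∈ V₁ ∧ q ∈ V₂ ∧ V₁ ⊔ V₂ = ⊤ ∧
    tangentConeIdeal I q = vanishingIdeal ℂ ((V₁ : Set (Fin 5 → ℂ)) ∪ V₂)

end CanonicalSurface

end

/-! The symmetry of `αβᵗ` makes the rows of `A` isotropic for the standard symplectic form `J`, so
`J Aᵗ` and `A` form a complex `0 → F₂ → F₁ → F₀ → R → 0` with free `Fᵢ`. It is exact: over the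
fraction field by counting dimensions, and over the polynomial ring because, by Cramer's rule, the
reduced denominators of a rational preimage divide every maximal minor of `A`
(`Matrix.symplecticDual_exact`). So `R` has a free resolution of length two.

Let `B` be the local ring at a point and `I` a proper ideal whose radical contains a regular
sequence of length four. Then `Extⁱ(B/I, F) = 0` for `F` free and `i < 4`, and two dimension shifts
leave `Extⁱ(B/I, R) = 0` for `i < 2`: locally, `R` has depth at least two along `I`
(`exists_isRegular_pair_of_resolution`). Concretely, `I` kills no nonzero element of `R`, and every
homomorphism `I → R` is given by an element of `R`. Four polynomials vanishing at a point with
independent gradients there are such a sequence. Taking coordinate functions at the origin gives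
depth at least two at the irrelevant ideal, so compatible local fractions glue to elements of `R`;
this is (a), carried by `exists_linearEquiv_gammaStar`.

For (b) the ideal is `I_n(A')`. By the Nullstellensatz, equations of the degeneracy locus pull back
into its radical. A vector `v` killed by all gradients at a zero `q` has `A'(v)` tangent to the
degeneracy cone, so transversality puts `v` on the line through `q`, and the gradients span at least
four dimensions. Hence `R` has depth at least two along `I_n(A')` at every point of `ℙ⁴`. Expanding
`det (v A_c)` along its first row shows that each minor `g_c` of `A'` multiplies `R` into the
submodule generated in degree zero, which is a copy of `𝒜 / Ann R`. So the `g_c / t` are local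
sections of the conductor. A homomorphism `Ψ` from the conductor to `𝒪_Y` has values `T_c` on them
with `g_b T_c = g_c T_b`, and depth two gives a section `s` of `R~` with `(g_c / t) s = T_c`. Since
every `φ` satisfies `(g_c / t) φ = φ(1) (g_c / t)`, `Ψ` is evaluation at `s`
(`ConductorData.isIso_toDoubleHom`). -/

/-! ### Exchange of elements in regular sequences of a Noetherian local ring. -/

section RegularSequences

open RingTheory.Sequence IsLocalRing

lemma Ideal.ofList_perm {B : Type*} [CommRing B] {l l' : List B} (h : l.Perm l') :
    Ideal.ofList l = Ideal.ofList l' :=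
  congrArg Ideal.span (Set.ext fun _ => h.mem_iff)

variable {B : Type*} [CommRing B] [IsLocalRing B]

/-- A nonunit coefficient times an entry lies in the squared maximal ideal, so an element outside
that square must involve some entry with a unit coefficient. This selects the entry to be exchanged.
-/
lemma IsLocalRing.exists_unit_coeff {ys : List B} (hys : ∀ y ∈ ys, y ∈ maximalIdeal B) {b : B}
    (hb : b ∈ Ideal.ofList ys) (hb' : b ∉ maximalIdeal B ^ 2) :
    ∃ (y : B) (ys' : List B) (c : B), ys.Perm (y :: ys') ∧ IsUnit c ∧
      b - c * y ∈ Ideal.ofList ys' := by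
  induction ys generalizing b with
  | nil =>
    rw [Ideal.ofList_nil, Ideal.mem_bot] at hb
    exact absurd (hb ▸ zero_mem _) hb'
  | cons y ys ih =>
    rw [Ideal.ofList_cons, Submodule.mem_sup] at hb
    obtain ⟨a, ha, b', hb'', rfl⟩ := hb
    obtain ⟨c, rfl⟩ := Ideal.mem_span_singleton'.1 ha
    by_cases hc : IsUnit c
    · exact ⟨y, ys, c, .refl _, hc, by simpa using hb''⟩
    · have hcy : c * y ∈ maximalIdeal B ^ 2 := by
        rw [pow_two]
        exact Ideal.mul_mem_mul ((mem_maximalIdeal _).2 hc) (hys y (by simp))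
      obtain ⟨y', ys', c', hp, hc', h⟩ := ih (fun z hz => hys z (by simp [hz])) hb''
        (fun h => hb' (add_mem hcy h))
      refine ⟨y', y :: ys', c', (hp.cons y).trans (.swap _ _ _), hc', ?_⟩
      rw [Ideal.ofList_cons, add_sub_assoc]
      exact add_mem (Ideal.mem_sup_left (Ideal.mul_mem_left _ _ (Ideal.mem_span_singleton_self y)))
        (Ideal.mem_sup_right h)

/-- In a regular sequence generating the maximal ideal of a Noetherian local ring, an element of
the sequence may be exchanged for any given element whose class modulo the squared maximal ideal is
independent of the entries that are kept. -/
lemma IsLocalRing.exchange_isWeaklyRegular [IsNoetherianRing B] {zs ys : List B} {z : B}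
    (hreg : IsWeaklyRegular B (zs ++ ys)) (hspan : Ideal.ofList (zs ++ ys) = maximalIdeal B)
    (hz : z ∈ maximalIdeal B) (hz' : z ∉ Ideal.ofList zs ⊔ maximalIdeal B ^ 2) :
    ∃ ys' : List B, IsWeaklyRegular B ((zs ++ [z]) ++ ys') ∧
      Ideal.ofList ((zs ++ [z]) ++ ys') = maximalIdeal B := by
  have hmem : ∀ y ∈ zs ++ ys, y ∈ maximalIdeal B := fun y hy => hspan ▸ Ideal.subset_span hy
  rw [← hspan, Ideal.ofList_append, Submodule.mem_sup] at hz
  obtain ⟨a, ha, b, hb, rfl⟩ := hz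
  -- Modulo the kept entries the new element is `b`, which is not in the squared maximal ideal; `y`
  -- is the entry that leaves.
  obtain ⟨y, ys', c, hp, hc, h⟩ := exists_unit_coeff (fun y hy => hmem y (by simp [hy])) hb
    (fun h => hz' (add_mem (Ideal.mem_sup_left ha) (Ideal.mem_sup_right h)))
  have hp' : (zs ++ ys).Perm ((zs ++ ys') ++ [y]) := by
    rw [List.append_assoc]
    exact (hp.trans (List.perm_append_singleton y ys').symm).append_left zs
  have hQ : a + b - c * y ∈ Ideal.ofList (zs ++ ys') := by
    rw [Ideal.ofList_append, add_sub_assoc]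
    exact add_mem (Ideal.mem_sup_left ha) (Ideal.mem_sup_right h)
  have hp'' : ((zs ++ ys') ++ [a + b]).Perm ((zs ++ [a + b]) ++ ys') := by
    rw [List.append_assoc, List.append_assoc]
    exact (List.perm_append_comm).append_left zs
  have hideal : Ideal.ofList ((zs ++ ys') ++ [a + b]) = maximalIdeal B := by
    rw [← hspan, Ideal.ofList_perm hp', Ideal.ofList_append _ [y], Ideal.ofList_append _ [a + b],
      Ideal.ofList_singleton, Ideal.ofList_singleton]
    apply le_antisymm
    · refine sup_le le_sup_left ((Ideal.span_singleton_le_iff_mem _).2 ?_)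
      rw [← sub_add_cancel (a + b) (c * y)]
      exact add_mem (Ideal.mem_sup_left hQ) (Ideal.mem_sup_right
        (Ideal.mul_mem_left _ _ (Ideal.mem_span_singleton_self y)))
    · refine sup_le le_sup_left ((Ideal.span_singleton_le_iff_mem _).2 ?_)
      obtain ⟨d, hd⟩ := hc.exists_left_inv
      have : y = d * (a + b) - d * (a + b - c * y) := by linear_combination (-y) * hd
      rw [this]
      exact sub_mem (Ideal.mem_sup_right (Ideal.mul_mem_left _ _ (Ideal.mem_span_singleton_self _)))
        (Ideal.mem_sup_left (Ideal.mul_mem_left _ _ hQ))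
  -- Regularity survives permutation here, so `y` may be tested last. On the quotient by all other
  -- entries the new element acts as `c • y` with `c` a unit.
  have h1 := isWeaklyRegular_of_perm_of_subset_maximalIdeal hreg hp' hmem
  rw [isWeaklyRegular_append_iff, isWeaklyRegular_singleton_iff] at h1
  have h2 : IsWeaklyRegular B ((zs ++ ys') ++ [a + b]) := by
    rw [isWeaklyRegular_append_iff, isWeaklyRegular_singleton_iff]
    refine ⟨h1.1, ?_⟩
    have heq : ∀ x : B ⧸ (Ideal.ofList (zs ++ ys') • ⊤ : Submodule B B),
        (a + b) • x = c • y • x := by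
      intro x
      obtain ⟨x, rfl⟩ := Submodule.mkQ_surjective _ x
      rw [smul_smul, ← map_smul, ← map_smul, ← sub_eq_zero, ← map_sub, ← sub_smul]
      exact (Submodule.Quotient.mk_eq_zero _).2 (Submodule.smul_mem_smul hQ trivial)
    intro x x' hx
    have hx : (a + b) • x = (a + b) • x' := hx
    rw [heq, heq] at hx
    exact h1.2 (hc.smul_left_cancel.1 hx)
  refine ⟨ys', isWeaklyRegular_of_perm_of_subset_maximalIdeal h2 hp'' ?_, ?_⟩
  · exact fun r hr => hideal ▸ Ideal.subset_span hr
  · rw [← Ideal.ofList_perm hp'', hideal]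

/-- The entries of `zs` are exchanged in one at a time; `zs₀` collects those already placed, and
`ys` is what remains of the original generators. -/
lemma IsLocalRing.isWeaklyRegular_of_notMem [IsNoetherianRing B] {zs zs₀ ys : List B}
    (hreg : IsWeaklyRegular B (zs₀ ++ ys)) (hspan : Ideal.ofList (zs₀ ++ ys) = maximalIdeal B)
    (hz : ∀ z ∈ zs, z ∈ maximalIdeal B)
    (hz' : ∀ zs₁ z zs₂, zs = zs₁ ++ z :: zs₂ → z ∉ Ideal.ofList (zs₀ ++ zs₁) ⊔ maximalIdeal B ^ 2) :
    IsWeaklyRegular B (zs₀ ++ zs) := by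
  induction zs generalizing zs₀ ys with
  | nil =>
    rw [List.append_nil]
    exact ((isWeaklyRegular_append_iff _ _ _).1 hreg).1
  | cons z zs ih =>
    obtain ⟨ys', h1, h2⟩ := exchange_isWeaklyRegular hreg hspan (hz z (by simp))
      (by simpa using hz' [] z zs rfl)
    have := ih h1 h2 (fun w hw => hz w (by simp [hw])) fun zs₁ w zs₂ h => by
      have := hz' (z :: zs₁) w zs₂ (by simp [h])
      rwa [List.append_assoc, List.singleton_append]
    rwa [List.append_assoc, List.singleton_append] at this

end RegularSequences

/-! ### Depth two from a resolution of length two, through vanishing of Ext. -/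

section Ext

open Abelian RingTheory.Sequence

universe v

lemma CategoryTheory.ShortComplex.ShortExact.subsingleton_ext_X₃ {C : Type*} [Category C]
    [Abelian C] [HasExt.{v} C] {S : ShortComplex C} (hS : S.ShortExact) (N : C) (i : ℕ)
    (h₂ : Subsingleton (Ext N S.X₂ i)) (h₁ : Subsingleton (Ext N S.X₁ (i + 1))) :
    Subsingleton (Ext N S.X₃ i) := by
  refine subsingleton_of_forall_eq 0 fun x => ?_
  obtain ⟨y, rfl⟩ := Ext.covariant_sequence_exact₃ N hS x rfl (Subsingleton.elim _ _)
  rw [Subsingleton.elim y 0, Ext.zero_comp]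

variable {B : Type v} [CommRing B]

lemma ModuleCat.subsingleton_ext_of_exact {F G H : Type v} [AddCommGroup F] [AddCommGroup G]
    [AddCommGroup H] [Module B F] [Module B G] [Module B H] {f : F →ₗ[B] G} {g : G →ₗ[B] H}
    (hf : Function.Injective f) (hfg : Function.Exact f g) (hg : Function.Surjective g)
    (N : ModuleCat.{v} B) (i : ℕ) (h₂ : Subsingleton (Ext N (ModuleCat.of B G) i))
    (h₁ : Subsingleton (Ext N (ModuleCat.of B F) (i + 1))) :
    Subsingleton (Ext N (ModuleCat.of B H) i) := by
  let S := ModuleCat.shortComplexOfCompEqZero f g hfg.linearMap_comp_eq_zero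
  have hS : S.ShortExact :=
    { exact := ModuleCat.shortComplex_exact _ hfg
      mono_f := (ModuleCat.mono_iff_injective _).2 hf
      epi_g := (ModuleCat.epi_iff_surjective _).2 hg }
  exact hS.subsingleton_ext_X₃ N i h₂ h₁

open IsLocalRing in
/-- A finite module over a Noetherian local ring with a finite flat resolution of length two has a
regular sequence of length two in any proper ideal whose radical contains a regular sequence of
length four. -/
lemma exists_isRegular_pair_of_resolution [IsLocalRing B] [IsNoetherianRing B]
    {F₂ F₁ F₀ M : Type v} [AddCommGroup F₂] [AddCommGroup F₁] [AddCommGroup F₀] [AddCommGroup M]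
    [Module B F₂] [Module B F₁] [Module B F₀] [Module B M] [Module.Finite B F₂]
    [Module.Finite B F₁] [Module.Finite B F₀] [Module.Finite B M] [Module.Flat B F₂]
    [Module.Flat B F₁] [Module.Flat B F₀] [Nontrivial F₂] [Nontrivial F₁] [Nontrivial F₀]
    [Nontrivial M] {d₂ : F₂ →ₗ[B] F₁} {d₁ : F₁ →ₗ[B] F₀} {d₀ : F₀ →ₗ[B] M}
    (h₂ : Function.Injective d₂) (h₁ : Function.Exact d₂ d₁) (h₀ : Function.Exact d₁ d₀)
    (h : Function.Surjective d₀) {J : Ideal B} (hJ : J ≤ maximalIdeal B) {rs : List B}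
    (hlen : rs.length = 4) (hrs : IsWeaklyRegular B rs) (hmem : ∀ r ∈ rs, r ∈ J.radical) :
    ∃ a ∈ J, ∃ b ∈ J, IsSMulRegular M a ∧ IsSMulRegular (QuotSMulTop a M) b := by
  have hJ' : J.radical ≤ maximalIdeal B := by
    rw [← (inferInstance : (maximalIdeal B).IsPrime).radical]
    exact Ideal.radical_mono hJ
  have lt {F : Type v} [AddCommGroup F] [Module B F] [Module.Finite B F] [Nontrivial F]
      {I : Ideal B} (hI : I ≤ maximalIdeal B) : I • (⊤ : Submodule B F) < ⊤ :=
    lt_top_iff_ne_top.2 (Submodule.top_ne_ideal_smul_of_le_jacobson_annihilator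
      (hI.trans (maximalIdeal_le_jacobson _))).symm
  let N := ModuleCat.of B (B ⧸ J)
  have hN : Module.support B N = PrimeSpectrum.zeroLocus J := by
    rw [Module.support_eq_zeroLocus, Ideal.annihilator_quotient]
  -- A flat module inherits weak regularity of `rs`. Passing to `J.radical` is harmless because only
  -- the support of `B ⧸ J` matters.
  have key (F : Type v) [AddCommGroup F] [Module B F] [Module.Finite B F] [Nontrivial F]
      [Module.Flat B F] (i : ℕ) (hi : i < 4) : Subsingleton (Ext N (ModuleCat.of B F) i) := by
    have hreg : IsWeaklyRegular F rs :=
      ((TensorProduct.lid B F).isWeaklyRegular_congr rs).1 (hrs.isWeaklyRegular_rTensor (M₂ := F))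
    refine ModuleCat.subsingleton_ext_of_exists_isRegular J.radical N ?_ (ModuleCat.of B F)
      (lt hJ') rs hmem (.of_isWeaklyRegular_of_mem_maximalIdeal _ (fun r hr => hJ' (hmem r hr)) hreg)
      i (hlen ▸ hi)
    rw [hN, PrimeSpectrum.zeroLocus_radical]
  -- Each short exact sequence cut out of the resolution costs one degree of vanishing: four for the
  -- `Fᵢ`, three for the image of `d₁`, two for `M`.
  have hK (i : ℕ) (hi : i < 3) :
      Subsingleton (Ext N (ModuleCat.of B (LinearMap.range d₁)) i) := by
    refine ModuleCat.subsingleton_ext_of_exact (g := d₁.rangeRestrict) h₂ (fun x => ?_)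
      d₁.surjective_rangeRestrict N i (key F₁ i (by omega)) (key F₂ (i + 1) (by omega))
    rw [← h₁ x, ← Subtype.coe_inj]
    rfl
  have hM (i : ℕ) (hi : i < 2) : Subsingleton (Ext N (ModuleCat.of B M) i) := by
    refine ModuleCat.subsingleton_ext_of_exact (f := (LinearMap.range d₁).subtype) (g := d₀)
      (Submodule.injective_subtype _) (fun x => ?_) h N i (key F₀ i (by omega))
      (hK (i + 1) (by omega))
    rw [h₀ x]
    simp
  -- The converse implication produces the regular pair inside `J` itself, not only in its radical.
  obtain ⟨l, hl, hlJ, hlreg⟩ := ModuleCat.exists_isRegular_of_exists_subsingleton_ext J 2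
    (ModuleCat.of B M) (lt hJ) N hN hM
  match l, hl with
  | [a, b], _ =>
    have := hlreg.toIsWeaklyRegular
    rw [isWeaklyRegular_cons_iff, isWeaklyRegular_singleton_iff] at this
    exact ⟨a, hlJ a (by simp), b, hlJ b (by simp), this⟩

-- Let `x = ∑ uₖ mₖ` and `y = ∑ vₖ mₖ` be the would-be images of `a = ∑ uₖ gₖ` and `b = ∑ vₖ gₖ`.
-- The compatibility of the `mₖ` gives `b x = a y`, so regularity of `b` modulo `a` yields `x = a
-- s`. Then `a gₖ s = gₖ x = a mₖ`, and `a` cancels.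
open scoped Pointwise in
lemma exists_smul_eq_of_isSMulRegular {B M ι : Type*} [CommRing B] [AddCommGroup M] [Module B M]
    {g : ι → B} {a b : B} (ha : a ∈ Ideal.span (Set.range g)) (hb : b ∈ Ideal.span (Set.range g))
    (hareg : IsSMulRegular M a) (hbreg : IsSMulRegular (QuotSMulTop a M) b) {m : ι → M}
    (hm : ∀ k l, g l • m k = g k • m l) : ∃ s : M, ∀ k, g k • s = m k := by
  obtain ⟨u, rfl⟩ := (Finsupp.mem_ideal_span_range_iff_exists_finsupp).1 ha
  obtain ⟨v, rfl⟩ := (Finsupp.mem_ideal_span_range_iff_exists_finsupp).1 hb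
  have key (w : ι →₀ B) (l : ι) :
      g l • (w.sum fun k c => c • m k) = (w.sum fun k c => c * g k) • m l := by
    rw [Finsupp.smul_sum, Finsupp.sum, Finsupp.sum, Finset.sum_smul]
    refine Finset.sum_congr rfl fun k _ => ?_
    rw [smul_comm, hm, smul_smul]
  have key' : (v.sum fun k c => c * g k) • (u.sum fun k c => c • m k) =
      (u.sum fun k c => c * g k) • (v.sum fun k c => c • m k) := by
    conv_lhs => rw [Finsupp.sum, Finset.sum_smul]
    conv_rhs => rw [Finsupp.sum, Finsupp.sum, Finset.smul_sum]
    refine Finset.sum_congr rfl fun k _ => ?_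
    rw [mul_smul, key, smul_comm]
    rfl
  set a := u.sum fun k c => c * g k
  set b := v.sum fun k c => c * g k
  have h1 : b • (Submodule.mkQ (a • ⊤ : Submodule B M) (u.sum fun k c => c • m k)) = b • 0 := by
    rw [smul_zero, ← map_smul, key']
    exact (Submodule.Quotient.mk_eq_zero _).2 (Submodule.smul_mem_pointwise_smul _ _ _ trivial)
  have h2 := (Submodule.Quotient.mk_eq_zero _).1 (hbreg h1)
  obtain ⟨s, -, hs⟩ := (Submodule.mem_smul_pointwise_iff_exists _ _ _).1 h2
  refine ⟨s, fun k => hareg ?_⟩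
  change a • g k • s = a • m k
  rw [smul_comm, hs, key]

end Ext

/-! ### Points of affine space: gradients and regular sequences in local rings. -/

namespace MvPolynomial

open RingTheory.Sequence

variable {K : Type*} [Field K] {N : ℕ}

/-- The preceding variables generate a monomial ideal, and multiplying by `X i` changes no exponent
of an earlier variable, so it cannot bring a new monomial into that ideal. -/
lemma isWeaklyRegular_X (K : Type*) [Field K] (N : ℕ) :
    IsWeaklyRegular (MvPolynomial (Fin N) K) (List.ofFn (X : Fin N → MvPolynomial (Fin N) K)) := by
  rw [isWeaklyRegular_iff]
  intro i hi
  have hi' : i < N := by simpa using hi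
  have hI : Ideal.ofList (List.take i (List.ofFn (X : Fin N → MvPolynomial (Fin N) K))) =
      Ideal.span (X '' {j : Fin N | j.1 < i}) := by
    refine congrArg Ideal.span (Set.ext fun p => ?_)
    simp only [Set.mem_ofPred_eq, List.mem_take_iff_getElem, List.length_ofFn, List.getElem_ofFn,
      Set.mem_image]
    constructor
    · rintro ⟨j, hj, rfl⟩
      exact ⟨⟨j, by omega⟩, by simp; omega, rfl⟩
    · rintro ⟨j, hj, rfl⟩
      exact ⟨j.1, by simp; omega, rfl⟩
  rw [hI, List.getElem_ofFn, smul_eq_mul, Ideal.mul_top,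
    isSMulRegular_quotient_iff_mem_of_smul_mem]
  intro p hp
  rw [mem_ideal_span_X_image] at hp ⊢
  intro m hm
  obtain ⟨j, hj, hj'⟩ := hp (m + Finsupp.single ⟨i, hi'⟩ 1) (by
    rw [smul_eq_mul, mul_comm, mem_support_iff, coeff_mul_X]
    exact mem_support_iff.1 hm)
  refine ⟨j, hj, ?_⟩
  rw [Finsupp.add_apply, Finsupp.single_apply, if_neg, add_zero] at hj'
  · exact hj'
  · rintro rfl
    exact lt_irrefl i hj

/-- The translation `X i ↦ X i - C (q i)`. -/
noncomputable def translation (q : Fin N → K) :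
    MvPolynomial (Fin N) K ≃ₐ[K] MvPolynomial (Fin N) K :=
  .ofAlgHom (aeval fun i => X i - C (q i)) (aeval fun i => X i + C (q i))
    (by ext i; simp) (by ext i; simp)

lemma translation_X (q : Fin N → K) (i : Fin N) : translation q (X i) = X i - C (q i) := by
  simp [translation]

lemma eval_translation (q : Fin N → K) (p : MvPolynomial (Fin N) K) :
    eval q (translation q p) = constantCoeff p := by
  change ((eval q : _ →+* K).comp (translation q : _ →+* MvPolynomial (Fin N) K)) p = _
  congr 1
  ext i <;> simp [translation]

lemma isWeaklyRegular_X_sub_C (q : Fin N → K) :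
    IsWeaklyRegular (MvPolynomial (Fin N) K) (List.ofFn fun i => X i - C (q i)) := by
  have h := isWeaklyRegular_X K N
  have e : List.ofFn (fun i => (X i - C (q i) : MvPolynomial (Fin N) K)) =
      (List.ofFn X).map (translation q).toRingEquiv.toRingHom := by
    rw [List.map_ofFn]
    congr 1
    ext1 i
    exact (translation_X q i).symm
  rw [e]
  refine (AddEquiv.isWeaklyRegular_congr (e := (translation q).toAddEquiv) ?_).1 h
  rw [List.forall₂_map_right_iff, List.forall₂_same]
  exact fun r _ x => map_mul (translation q) r x

/-- The ideal of the point `q`. -/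
noncomputable abbrev pointIdeal (q : Fin N → K) : Ideal (MvPolynomial (Fin N) K) :=
  RingHom.ker (eval q)

instance (q : Fin N → K) : (pointIdeal q).IsPrime := RingHom.ker_isPrime _

lemma notMem_pointIdeal {q : Fin N → K} {p : MvPolynomial (Fin N) K} :
    p ∉ pointIdeal q ↔ eval q p ≠ 0 := Iff.rfl

lemma pointIdeal_eq (q : Fin N → K) :
    pointIdeal q = Ideal.ofList (List.ofFn fun i => X i - C (q i)) := by
  apply le_antisymm
  · intro p hp
    obtain ⟨p, rfl⟩ := (translation q).surjective p
    have hp : eval q (translation q p) = 0 := hp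
    rw [eval_translation] at hp
    have h : p ∈ Ideal.span (X '' (Set.univ : Set (Fin N)) : Set (MvPolynomial (Fin N) K)) := by
      rw [mem_ideal_span_X_image]
      intro m hm
      by_contra! h
      obtain rfl : m = 0 := Finsupp.ext fun i => h i trivial
      exact mem_support_iff.1 hm hp
    have h' := Ideal.mem_map_of_mem (translation q : _ →+* MvPolynomial (Fin N) K) h
    rw [Ideal.map_span] at h'
    refine Ideal.span_mono ?_ h'
    rintro _ ⟨_, ⟨i, -, rfl⟩, rfl⟩
    exact (List.mem_ofFn ..).2 ⟨i, (translation_X q i).symm⟩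
  · refine Ideal.span_le.2 fun p hp => ?_
    obtain ⟨i, rfl⟩ := (List.mem_ofFn ..).1 hp
    simp

/-- The gradient at `q`. -/
noncomputable def gradient (q : Fin N → K) : MvPolynomial (Fin N) K →ₗ[K] (Fin N → K) where
  toFun p i := eval q (pderiv i p)
  map_add' p p' := by ext i; simp
  map_smul' c p := by ext i; simp [smul_eval]

lemma gradient_apply (q : Fin N → K) (p : MvPolynomial (Fin N) K) (i : Fin N) :
    gradient q p i = eval q (pderiv i p) := rfl

lemma gradient_mul (q : Fin N → K) (p p' : MvPolynomial (Fin N) K) :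
    gradient q (p * p') = eval q p • gradient q p' + eval q p' • gradient q p := by
  ext i
  simp only [gradient_apply, Derivation.leibniz, smul_eq_mul, map_add, map_mul, Pi.add_apply,
    Pi.smul_apply]

/-- The polynomials vanishing at `q` with gradient at `q` in `W`. -/
noncomputable def gradientIdeal (q : Fin N → K) (W : Submodule K (Fin N → K)) :
    Ideal (MvPolynomial (Fin N) K) where
  carrier := {p | eval q p = 0 ∧ gradient q p ∈ W}
  add_mem' hp hp' := ⟨by rw [map_add, hp.1, hp'.1, add_zero], by
    rw [map_add]; exact add_mem hp.2 hp'.2⟩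
  zero_mem' := ⟨map_zero _, by rw [map_zero]; exact zero_mem _⟩
  smul_mem' a p hp := ⟨by rw [smul_eq_mul, map_mul, hp.1, mul_zero], by
    rw [smul_eq_mul, gradient_mul, hp.1, zero_smul, add_zero]; exact W.smul_mem _ hp.2⟩

section

variable {r : ℕ} {q : Fin N → K} {f : Fin r → MvPolynomial (Fin N) K}

/-- Polynomials vanishing at `q` with independent gradients form a regular sequence in the local
ring of `q`. -/
lemma isWeaklyRegular_of_linearIndependent_gradient (hf : ∀ k, eval q (f k) = 0)
    (hlin : LinearIndependent K fun k => gradient q (f k)) :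
    IsWeaklyRegular (Localization.AtPrime (pointIdeal q))
      (List.ofFn fun k => algebraMap _ (Localization.AtPrime (pointIdeal q)) (f k)) := by
  set B := Localization.AtPrime (pointIdeal q)
  have hmax : (pointIdeal q).map (algebraMap _ B) = IsLocalRing.maximalIdeal B :=
    Localization.AtPrime.map_eq_maximalIdeal
  have hreg : IsWeaklyRegular B ([] ++ (List.ofFn fun i =>
      (X i - C (q i) : MvPolynomial (Fin N) K)).map (algebraMap _ B)) :=
    (isWeaklyRegular_X_sub_C q).of_isLocalization B (pointIdeal q).primeCompl
  refine IsLocalRing.isWeaklyRegular_of_notMem (zs₀ := [])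
    (zs := List.ofFn fun k => algebraMap _ B (f k)) hreg ?_ ?_ ?_
  · rw [List.nil_append, ← Ideal.map_ofList, ← pointIdeal_eq, hmax]
  · intro z hz
    obtain ⟨k, rfl⟩ := (List.mem_ofFn ..).1 hz
    rw [← hmax]
    exact Ideal.mem_map_of_mem _ (hf k)
  · intro zs₁ z zs₂ h hz
    have hlen : zs₁.length < r := by
      have := congrArg List.length h
      simp only [List.length_ofFn, List.length_append, List.length_cons] at this
      omega
    have hget (i : ℕ) (hi : i < r) : (zs₁ ++ z :: zs₂)[i]? = some (algebraMap _ B (f ⟨i, hi⟩)) := by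
      rw [← h]
      simp [hi]
    have hz1 : z = algebraMap _ B (f ⟨zs₁.length, hlen⟩) := by
      simpa using hget zs₁.length hlen
    -- `gradientIdeal q W` contains the earlier entries and all products of two functions vanishing
    -- at `q`; it serves to detect independence modulo the squared maximal ideal.
    set W := Submodule.span K ((fun k => gradient q (f k)) '' {k : Fin r | k.1 < zs₁.length})
    have hle : Ideal.ofList ([] ++ zs₁) ⊔ IsLocalRing.maximalIdeal B ^ 2 ≤
        (gradientIdeal q W).map (algebraMap _ B) := by
      refine sup_le (Ideal.span_le.2 fun w hw => ?_) ?_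
      · rw [List.nil_append] at hw
        obtain ⟨i, hi, rfl⟩ := List.mem_iff_getElem.1 (show w ∈ zs₁ from hw)
        have h1 := hget i (hi.trans hlen)
        rw [List.getElem?_append_left hi, List.getElem?_eq_getElem hi, Option.some.injEq] at h1
        rw [h1]
        exact Ideal.mem_map_of_mem _ ⟨hf _, Submodule.subset_span ⟨_, hi, rfl⟩⟩
      · rw [← hmax, ← Ideal.map_pow]
        refine Ideal.map_mono ?_
        rw [pow_two, Ideal.mul_le]
        intro a ha b hb
        have ha : eval q a = 0 := ha
        have hb : eval q b = 0 := hb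
        refine ⟨by rw [map_mul, ha, zero_mul], ?_⟩
        rw [gradient_mul, ha, hb, zero_smul, zero_smul, add_zero]
        exact zero_mem _
    obtain ⟨⟨⟨a, ha⟩, s⟩, hs⟩ :=
      (IsLocalization.mem_map_algebraMap_iff (pointIdeal q).primeCompl B).1 (hle hz)
    rw [hz1, ← map_mul] at hs
    have hs' : f ⟨zs₁.length, hlen⟩ * s.1 = a :=
      IsLocalization.injective B (pointIdeal q).primeCompl_le_nonZeroDivisors hs
    -- As `f` vanishes at `q`, the gradient of `f * s` there is `s(q)` times that of `f`. Since
    -- `s(q) ≠ 0`, the gradient of `f` would lie in the span of the earlier ones.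
    have h1 := ha.2
    rw [← hs', gradient_mul, hf, zero_smul, zero_add] at h1
    exact hlin.notMem_span_image (s := {k : Fin r | k.1 < zs₁.length}) (by simp)
      ((W.smul_mem_iff (notMem_pointIdeal.1 s.2)).1 h1)

end

/-! ### Depth of a module with a short free resolution, at a point. -/

section LocalDepth

universe v

variable {K : Type v} [Field K] {N : ℕ} {q : Fin N → K}
  {F₂ F₁ F₀ M : Type v} [AddCommGroup F₂] [AddCommGroup F₁] [AddCommGroup F₀] [AddCommGroup M]
  [Module (MvPolynomial (Fin N) K) F₂] [Module (MvPolynomial (Fin N) K) F₁]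
  [Module (MvPolynomial (Fin N) K) F₀] [Module (MvPolynomial (Fin N) K) M]

lemma nontrivial_localizedModule {F : Type*} [AddCommGroup F] [Module (MvPolynomial (Fin N) K) F]
    [Nontrivial F] [Module.IsTorsionFree (MvPolynomial (Fin N) K) F] :
    Nontrivial (LocalizedModule (pointIdeal q).primeCompl F) := by
  obtain ⟨x, hx⟩ := exists_ne (0 : F)
  refine ⟨LocalizedModule.mk x 1, 0, fun h => ?_⟩
  rw [← LocalizedModule.zero_mk 1, LocalizedModule.mk_eq] at h
  obtain ⟨u, hu⟩ := h
  simp only [smul_zero, one_smul] at hu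
  have hu : u.1 • x = 0 := hu
  have := (smul_eq_zero.1 hu).resolve_right hx
  exact u.2 (this ▸ zero_mem _)

/-- Localization keeps the resolution exact, and the polynomials with independent gradients supply
the regular sequence of length four needed by `exists_isRegular_pair_of_resolution`. -/
lemma exists_pair_at_point
    [Module.Finite (MvPolynomial (Fin N) K) F₂] [Module.Finite (MvPolynomial (Fin N) K) F₁]
    [Module.Finite (MvPolynomial (Fin N) K) F₀] [Module.Free (MvPolynomial (Fin N) K) F₂]
    [Module.Free (MvPolynomial (Fin N) K) F₁] [Module.Free (MvPolynomial (Fin N) K) F₀]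
    [Nontrivial F₂] [Nontrivial F₁] [Nontrivial F₀]
    {d₂ : F₂ →ₗ[MvPolynomial (Fin N) K] F₁} {d₁ : F₁ →ₗ[MvPolynomial (Fin N) K] F₀}
    {d₀ : F₀ →ₗ[MvPolynomial (Fin N) K] M} (h₂ : Function.Injective d₂)
    (h₁ : Function.Exact d₂ d₁) (h₀ : Function.Exact d₁ d₀) (h : Function.Surjective d₀)
    {J : Ideal (MvPolynomial (Fin N) K)} (hJ : J ≤ pointIdeal q)
    {f : Fin 4 → MvPolynomial (Fin N) K} (hf : ∀ k, f k ∈ J.radical)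
    (hlin : LinearIndependent K fun k => gradient q (f k))
    [Nontrivial (LocalizedModule (pointIdeal q).primeCompl M)] :
    ∃ a ∈ J.map (algebraMap _ (Localization.AtPrime (pointIdeal q))),
      ∃ b ∈ J.map (algebraMap _ (Localization.AtPrime (pointIdeal q))),
      IsSMulRegular (LocalizedModule (pointIdeal q).primeCompl M) a ∧
      IsSMulRegular (QuotSMulTop a (LocalizedModule (pointIdeal q).primeCompl M)) b := by
  set S := (pointIdeal q).primeCompl
  have hf0 (k : Fin 4) : eval q (f k) = 0 := by
    have := Ideal.radical_mono hJ (hf k)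
    rwa [(inferInstance : (pointIdeal q).IsPrime).radical] at this
  have : Nontrivial (LocalizedModule S F₂) := nontrivial_localizedModule
  have : Nontrivial (LocalizedModule S F₁) := nontrivial_localizedModule
  have : Nontrivial (LocalizedModule S F₀) := nontrivial_localizedModule
  have : Module.Finite (MvPolynomial (Fin N) K) M := .of_surjective d₀ h
  have : Module.FinitePresentation (MvPolynomial (Fin N) K) M :=
    Module.finitePresentation_of_finite _ _
  have : Module.FinitePresentation (MvPolynomial (Fin N) K) F₀ :=
    Module.finitePresentation_of_finite _ _
  have : Module.FinitePresentation (MvPolynomial (Fin N) K) F₁ :=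
    Module.finitePresentation_of_finite _ _
  have : Module.FinitePresentation (MvPolynomial (Fin N) K) F₂ :=
    Module.finitePresentation_of_finite _ _
  refine exists_isRegular_pair_of_resolution (B := Localization.AtPrime (pointIdeal q))
    (d₂ := LocalizedModule.map S d₂) (d₁ := LocalizedModule.map S d₁)
    (d₀ := LocalizedModule.map S d₀) ?_ ?_ ?_ ?_ ?_ (rs := List.ofFn fun k => algebraMap _ _ (f k))
    ?_ (isWeaklyRegular_of_linearIndependent_gradient hf0 hlin) ?_
  · exact IsLocalizedModule.map_injective S (LocalizedModule.mkLinearMap S F₂)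
      (LocalizedModule.mkLinearMap S F₁) d₂ h₂
  · exact LocalizedModule.map_exact S d₂ d₁ h₁
  · exact LocalizedModule.map_exact S d₁ d₀ h₀
  · exact IsLocalizedModule.map_surjective S (LocalizedModule.mkLinearMap S F₀)
      (LocalizedModule.mkLinearMap S M) d₀ h
  · rw [← Localization.AtPrime.map_eq_maximalIdeal]
    exact Ideal.map_mono hJ
  · simp
  · intro r hr
    obtain ⟨k, rfl⟩ := (List.mem_ofFn ..).1 hr
    obtain ⟨e, he⟩ := hf k
    exact ⟨e, by rw [← map_pow]; exact Ideal.mem_map_of_mem _ he⟩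

/-- If the radical of `J` contains four polynomials with independent gradients at `q`, then, locally
at `q`, no nonzero element of `M` is annihilated by `J`. -/
lemma exists_smul_eq_zero_at_point
    [Module.Finite (MvPolynomial (Fin N) K) F₂] [Module.Finite (MvPolynomial (Fin N) K) F₁]
    [Module.Finite (MvPolynomial (Fin N) K) F₀] [Module.Free (MvPolynomial (Fin N) K) F₂]
    [Module.Free (MvPolynomial (Fin N) K) F₁] [Module.Free (MvPolynomial (Fin N) K) F₀]
    [Nontrivial F₂] [Nontrivial F₁] [Nontrivial F₀]
    {d₂ : F₂ →ₗ[MvPolynomial (Fin N) K] F₁} {d₁ : F₁ →ₗ[MvPolynomial (Fin N) K] F₀}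
    {d₀ : F₀ →ₗ[MvPolynomial (Fin N) K] M} (h₂ : Function.Injective d₂)
    (h₁ : Function.Exact d₂ d₁) (h₀ : Function.Exact d₁ d₀) (h : Function.Surjective d₀)
    {ι : Type*} {g : ι → MvPolynomial (Fin N) K}
    (hg : (∃ k, eval q (g k) ≠ 0) ∨ ∃ f : Fin 4 → MvPolynomial (Fin N) K,
      (∀ k, f k ∈ (Ideal.span (Set.range g)).radical) ∧
        LinearIndependent K fun k => gradient q (f k))
    {r : M} (hr : ∀ k, g k • r = 0) : ∃ a, eval q a ≠ 0 ∧ a • r = 0 := by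
  by_cases hJ : ∃ k, eval q (g k) ≠ 0
  · obtain ⟨k, hk⟩ := hJ
    exact ⟨g k, hk, hr k⟩
  obtain ⟨f, hf, hlin⟩ := hg.resolve_left hJ
  push Not at hJ
  set S := (pointIdeal q).primeCompl
  suffices LocalizedModule.mk r (1 : S) = 0 by
    rw [← LocalizedModule.zero_mk 1, LocalizedModule.mk_eq] at this
    obtain ⟨u, hu⟩ := this
    simp only [smul_zero, one_smul] at hu
    exact ⟨u, u.2, hu⟩
  rcases subsingleton_or_nontrivial (LocalizedModule S M) with hS | hS
  · exact Subsingleton.elim _ _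
  obtain ⟨a, ha, -, -, hreg, -⟩ := exists_pair_at_point h₂ h₁ h₀ h
    (Ideal.span_le.2 (by rintro _ ⟨k, rfl⟩; exact hJ k)) hf hlin
  refine hreg ?_
  change a • _ = a • (0 : LocalizedModule S M)
  rw [smul_zero]
  -- The annihilator of the germ of `r` is an ideal, so it is enough that it contains the generators
  -- of `J`; it then contains the regular element `a`.
  suffices (Ideal.span (Set.range g)).map (algebraMap _ (Localization.AtPrime (pointIdeal q))) ≤
      LinearMap.ker (LinearMap.toSpanSingleton (Localization.AtPrime (pointIdeal q)) _
        (LocalizedModule.mk r (1 : S))) from this ha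
  rw [Ideal.map_span, Ideal.span_le]
  rintro _ ⟨_, ⟨k, rfl⟩, rfl⟩
  change algebraMap _ (Localization.AtPrime (pointIdeal q)) (g k) • LocalizedModule.mk r (1 : S) = 0
  rw [algebraMap_smul, LocalizedModule.smul'_mk, hr, LocalizedModule.zero_mk]

/-- If the radical of `J = (g k)` contains four polynomials with independent gradients at `q`, then,
locally at `q`, every homomorphism `J → M` is given by an element of `M`. -/
lemma exists_smul_eq_at_point
    [Module.Finite (MvPolynomial (Fin N) K) F₂] [Module.Finite (MvPolynomial (Fin N) K) F₁]
    [Module.Finite (MvPolynomial (Fin N) K) F₀] [Module.Free (MvPolynomial (Fin N) K) F₂]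
    [Module.Free (MvPolynomial (Fin N) K) F₁] [Module.Free (MvPolynomial (Fin N) K) F₀]
    [Nontrivial F₂] [Nontrivial F₁] [Nontrivial F₀]
    {d₂ : F₂ →ₗ[MvPolynomial (Fin N) K] F₁} {d₁ : F₁ →ₗ[MvPolynomial (Fin N) K] F₀}
    {d₀ : F₀ →ₗ[MvPolynomial (Fin N) K] M} (h₂ : Function.Injective d₂)
    (h₁ : Function.Exact d₂ d₁) (h₀ : Function.Exact d₁ d₀) (h : Function.Surjective d₀)
    {ι : Type*} [Finite ι] {g : ι → MvPolynomial (Fin N) K}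
    (hg : (∃ k, eval q (g k) ≠ 0) ∨ ∃ f : Fin 4 → MvPolynomial (Fin N) K,
      (∀ k, f k ∈ (Ideal.span (Set.range g)).radical) ∧
        LinearIndependent K fun k => gradient q (f k))
    {m : ι → M} (hm : ∀ k l, g l • m k = g k • m l) :
    ∃ (a : MvPolynomial (Fin N) K) (r : M), eval q a ≠ 0 ∧ ∀ k, g k • r = a • m k := by
  by_cases hJ : ∃ k, eval q (g k) ≠ 0
  · obtain ⟨k, hk⟩ := hJ
    exact ⟨g k, m k, hk, fun l => hm k l⟩
  obtain ⟨f, hf, hlin⟩ := hg.resolve_left hJ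
  push Not at hJ
  set S := (pointIdeal q).primeCompl
  obtain ⟨s, hs⟩ : ∃ s : LocalizedModule S M, ∀ k,
      algebraMap _ (Localization.AtPrime (pointIdeal q)) (g k) • s =
        LocalizedModule.mk (m k) (1 : S) := by
    rcases subsingleton_or_nontrivial (LocalizedModule S M) with hS | hS
    · exact ⟨0, fun k => Subsingleton.elim _ _⟩
    obtain ⟨a, ha, b, hb, hareg, hbreg⟩ := exists_pair_at_point h₂ h₁ h₀ h
      (Ideal.span_le.2 (by rintro _ ⟨k, rfl⟩; exact hJ k)) hf hlin
    rw [Ideal.map_span, ← Set.range_comp] at ha hb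
    refine exists_smul_eq_of_isSMulRegular ha hb hareg hbreg fun k l => ?_
    simp only [Function.comp_apply, algebraMap_smul, LocalizedModule.smul'_mk, hm k l]
  induction s using LocalizedModule.induction_on with | _ r t
  have hu (k : ι) : ∃ u : S, u • g k • r = u • t • m k := by
    have := hs k
    rw [algebraMap_smul, LocalizedModule.smul'_mk, LocalizedModule.mk_eq] at this
    simpa using this
  choose u hu using hu
  have := Fintype.ofFinite ι
  classical
  -- The product of the `u k` clears the denominators of the finitely many local identities at once.
  refine ⟨(∏ k, (u k).1) * t.1, (∏ k, (u k).1) • r, ?_, fun k => ?_⟩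
  · rw [map_mul, map_prod]
    exact mul_ne_zero (Finset.prod_ne_zero_iff.2 fun k _ => (u k).2) t.2
  · have := hu k
    rw [← Finset.prod_erase_mul _ _ (Finset.mem_univ k), mul_assoc, mul_smul, mul_smul,
      smul_comm (g k), smul_comm (g k), mul_smul]
    exact congrArg _ this

end LocalDepth

end MvPolynomial

/-! ### The symplectic resolution of the cokernel of `(α β)`. -/

namespace Matrix

lemma exists_det_submatrix_ne_zero {K κ : Type*} [Field K] [Fintype κ] {m : ℕ}
    (M : Matrix (Fin m) κ K) (hM : m ≤ M.rank) :
    ∃ c : Fin m → κ, (M.submatrix id c).det ≠ 0 := by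
  obtain ⟨κ', a, -, hspan, hlin⟩ := exists_linearIndependent' K M.col
  have : Finite κ' := hlin.finite
  have := Fintype.ofFinite κ'
  have hcard : Fintype.card κ' = M.rank := by
    rw [rank_eq_finrank_span_cols, ← hspan, finrank_span_eq_card hlin]
  have hm : Fintype.card κ' = m := by
    refine le_antisymm ?_ (hcard ▸ hM)
    rw [hcard]
    exact (M.rank_le_card_height).trans_eq (Fintype.card_fin m)
  let e := (Fintype.equivFinOfCardEq hm).symm
  refine ⟨a ∘ e, fun h => ?_⟩
  have h1 : LinearIndependent K (M.submatrix id (a ∘ e)).col := hlin.comp e e.injective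
  rw [linearIndependent_cols_iff_isUnit, isUnit_iff_isUnit_det, h] at h1
  exact not_isUnit_zero h1

section Exact

variable {A : Type*} [CommRing A] {m : ℕ} (α β : Matrix (Fin m) (Fin m) A)

/-- The matrix `J Aᵗ`, for `A = (α β)` and the standard symplectic form `J`. -/
def symplecticDual : Matrix (Fin m ⊕ Fin m) (Fin m) A := fromRows βᵀ (-αᵀ)

lemma fromCols_mul_symplecticDual (h : α * βᵀ = β * αᵀ) :
    fromCols α β * symplecticDual α β = 0 := by
  rw [symplecticDual, fromCols_mul_fromRows, h, mul_neg, add_neg_cancel]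

/-- Up to signs and order, `J Aᵗ w` has the entries of `Aᵗ w`. -/
lemma transpose_mulVec_eq (w : Fin m → A) :
    (fromCols α β)ᵀ *ᵥ w = Sum.elim (-(symplecticDual α β *ᵥ w) ∘ Sum.inr)
      ((symplecticDual α β *ᵥ w) ∘ Sum.inl) := by
  ext (i | i) <;>
    simp [symplecticDual, mulVec, dotProduct]

/-- Cramer's rule: the entries of `Aᵗ w` in the columns `c` recover the minor times `w`. It gives
injectivity of the dual map and, over the fraction field, integrality of minor multiples of a
preimage. -/
lemma det_submatrix_smul_eq (c : Fin m → Fin m ⊕ Fin m) (w : Fin m → A) :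
    ((fromCols α β).submatrix id c).det • w =
      ((fromCols α β).submatrix id c)ᵀ.adjugate *ᵥ (((fromCols α β)ᵀ *ᵥ w) ∘ c) := by
  have : ((fromCols α β)ᵀ *ᵥ w) ∘ c = ((fromCols α β).submatrix id c)ᵀ *ᵥ w := rfl
  rw [this, mulVec_mulVec, adjugate_mul, det_transpose, smul_mulVec, one_mulVec]

lemma symplecticDual_injective [IsDomain A] {c : Fin m → Fin m ⊕ Fin m}
    (hc : ((fromCols α β).submatrix id c).det ≠ 0) :
    Function.Injective (symplecticDual α β).mulVecLin := by
  rw [← LinearMap.ker_eq_bot, LinearMap.ker_eq_bot']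
  intro w hw
  have hw : symplecticDual α β *ᵥ w = 0 := hw
  have h := det_submatrix_smul_eq α β c w
  have h0 : (fromCols α β)ᵀ *ᵥ w = 0 := by
    rw [transpose_mulVec_eq, hw]
    ext (i | i) <;> simp
  rw [h0] at h
  have h1 : ((0 : Fin m ⊕ Fin m → A) ∘ c) = 0 := rfl
  rw [h1, mulVec_zero] at h
  exact (smul_eq_zero.1 h).resolve_left hc

/-- The image lies in the kernel by symmetry, and both have dimension `m`: the dual map is
injective, and `(α β)` has rank `m` on a space of dimension `2m`. -/
lemma symplecticDual_exact_of_field {K : Type*} [Field K] {α β : Matrix (Fin m) (Fin m) K}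
    (h : α * βᵀ = β * αᵀ) {c : Fin m → Fin m ⊕ Fin m}
    (hc : ((fromCols α β).submatrix id c).det ≠ 0) :
    LinearMap.ker (fromCols α β).mulVecLin = LinearMap.range (symplecticDual α β).mulVecLin := by
  symm
  refine Submodule.eq_of_le_of_finrank_eq ?_ ?_
  · rintro _ ⟨w, rfl⟩
    simp only [LinearMap.mem_ker, mulVecLin_apply, mulVec_mulVec]
    rw [fromCols_mul_symplecticDual α β h, zero_mulVec]
  · have h1 := LinearMap.finrank_range_add_finrank_ker (fromCols α β).mulVecLin
    have h2 : Module.finrank K (LinearMap.range (fromCols α β).mulVecLin) = m := by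
      apply le_antisymm
      · exact ((fromCols α β).rank_le_card_height).trans_eq (Fintype.card_fin m)
      · have := rank_submatrix_le (fromCols α β) id c
        rw [rank_of_det_ne_zero hc, Fintype.card_fin] at this
        exact this
    rw [LinearMap.finrank_range_of_inj (symplecticDual_injective α β hc)]
    simp only [h2, Module.finrank_fintype_fun_eq_card, Fintype.card_sum, Fintype.card_fin] at h1 ⊢
    omega

lemma symplecticDual_exact [IsDomain A] [UniqueFactorizationMonoid A] (h : α * βᵀ = β * αᵀ)
    {c₀ : Fin m → Fin m ⊕ Fin m} (hc₀ : ((fromCols α β).submatrix id c₀).det ≠ 0)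
    (hminors : ∀ d : A, (∀ c, d ∣ ((fromCols α β).submatrix id c).det) → IsUnit d) :
    Function.Exact (symplecticDual α β).mulVecLin (fromCols α β).mulVecLin := by
  let K := FractionRing A
  let φ : A →+* K := algebraMap A K
  have hinj : Function.Injective φ := IsFractionRing.injective A K
  have hmap : (fromCols α β).map φ = fromCols (α.map φ) (β.map φ) := by
    ext i (j | j) <;> rfl
  have hdual : (symplecticDual α β).map φ = symplecticDual (α.map φ) (β.map φ) := by
    ext (j | j) i <;> simp [symplecticDual]
  have hdet (c : Fin m → Fin m ⊕ Fin m) :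
      ((fromCols (α.map φ) (β.map φ)).submatrix id c).det =
        φ ((fromCols α β).submatrix id c).det := by
    rw [← hmap, RingHom.map_det]
    rfl
  have hK : α.map φ * (β.map φ)ᵀ = β.map φ * (α.map φ)ᵀ := by
    rw [← transpose_map, ← transpose_map, ← Matrix.map_mul, ← Matrix.map_mul, h]
  have hex := symplecticDual_exact_of_field hK (c := c₀)
    (by rw [hdet]; exact fun h => hc₀ (hinj (h.trans (map_zero φ).symm)))
  intro u
  constructor
  · intro hu
    have hu : fromCols α β *ᵥ u = 0 := hu
    have hu' : φ ∘ u ∈ LinearMap.ker (fromCols (α.map φ) (β.map φ)).mulVecLin := by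
      rw [LinearMap.mem_ker, mulVecLin_apply, ← hmap]
      ext i
      have := congrArg φ (congrFun hu i)
      rw [RingHom.map_mulVec] at this
      simpa using this
    rw [hex] at hu'
    obtain ⟨w, hw⟩ := hu'
    have hw : symplecticDual (α.map φ) (β.map φ) *ᵥ w = φ ∘ u := hw
    -- `J Aᵗ w = u` is integral, hence so is `Aᵗ w`, and Cramer's rule makes every maximal minor a
    -- multiplier of `w` into the ring.
    have hint (c : Fin m → Fin m ⊕ Fin m) (i : Fin m) :
        ∃ a, φ ((fromCols α β).submatrix id c).det * w i = φ a := by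
      have h1 := congrFun (det_submatrix_smul_eq (α.map φ) (β.map φ) c w) i
      rw [transpose_mulVec_eq, hw, hdet] at h1
      refine ⟨(((fromCols α β).submatrix id c)ᵀ.adjugate *ᵥ
        ((Sum.elim (-(u ∘ Sum.inr)) (u ∘ Sum.inl)) ∘ c)) i, ?_⟩
      rw [RingHom.map_mulVec]
      refine h1.trans ?_
      congr 2
      · rw [← hmap, submatrix_map, ← transpose_map]
        exact (RingHom.map_adjugate φ _).symm
      · ext k
        rcases hk : c k with j | j <;> simp [hk]
    have hw' (i : Fin m) : ∃ a, φ a = w i := by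
      have hden : IsUnit (IsFractionRing.den A (w i) : A) := by
        refine hminors _ fun c => ?_
        -- In a reduced fraction the denominator is coprime to the numerator, so it divides every
        -- multiplier that makes the fraction integral, in particular each minor.
        obtain ⟨a, ha⟩ := hint c i
        refine (IsFractionRing.num_den_reduced A (w i)).symm.dvd_of_dvd_mul_right ⟨a, hinj ?_⟩
        rw [map_mul, map_mul, ← ha]
        have := IsLocalization.mk'_spec' K (IsFractionRing.num A (w i)) (IsFractionRing.den A (w i))
        rw [IsFractionRing.mk'_num_den] at this
        change _ = φ _ * _
        rw [← this]
        change _ * (φ _ * _) = φ _ * _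
        ring
      exact IsFractionRing.isInteger_of_isUnit_den hden
    choose a ha using hw'
    refine ⟨a, funext fun j => hinj ?_⟩
    have h2 := congrFun hw j
    rw [← hdual] at h2
    rw [mulVecLin_apply, RingHom.map_mulVec]
    refine Eq.trans ?_ h2
    congr 1
    ext k
    exact ha k
  · rintro ⟨w, rfl⟩
    simp only [mulVecLin_apply, mulVec_mulVec]
    rw [fromCols_mul_symplecticDual α β h, zero_mulVec]

end Exact

end Matrix

/-! ### Homogeneous components in free modules and their quotients. -/

namespace GradedTilde

variable {A : Type*} {σ : Type*} [CommRing A] [SetLike σ A] [AddSubgroupClass σ A]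
  (𝒜 : ℕ → σ) {M : Type*} [AddCommGroup M] [Module A M]

/-- Projections onto the graded pieces of a graded module. -/
structure GradedProj (ℳ : ℤ → AddSubgroup M) where
  /-- The projection to degree `k`. -/
  proj : ℤ → M →+ M
  proj_mem : ∀ k m, proj k m ∈ ℳ k
  proj_same : ∀ {k m}, m ∈ ℳ k → proj k m = m
  proj_ne : ∀ {j k m}, m ∈ ℳ k → j ≠ k → proj j m = 0
  proj_smul : ∀ {i : ℕ} {k : ℤ} {a : A} {m : M}, a ∈ 𝒜 i → proj (i + k) (a • m) = a • proj k m
  exists_sum : ∀ m, ∃ s : Finset ℤ, (∀ k ∉ s, proj k m = 0) ∧ ∑ k ∈ s, proj k m = m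

end GradedTilde

namespace CanonicalSurface

open MvPolynomial GradedTilde

/-- The component of degree `k ∈ ℤ` of a polynomial. -/
noncomputable def formComp (k : ℤ) : Coord →+ Coord :=
  if 0 ≤ k then (homogeneousComponent k.toNat).toAddMonoidHom else 0

lemma coeff_formComp (k : ℤ) (p : Coord) (m : Fin 5 →₀ ℕ) :
    (formComp k p).coeff m = if (m.degree : ℤ) = k then p.coeff m else 0 := by
  unfold formComp
  split_ifs with h1 h2 h2
  · change (homogeneousComponent k.toNat p).coeff m = _
    rw [coeff_homogeneousComponent, if_pos (by omega)]
  · change (homogeneousComponent k.toNat p).coeff m = _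
    rw [coeff_homogeneousComponent, if_neg (by omega)]
  · omega
  · rfl

lemma coeff_eq_zero_of_mem_formDeg {k : ℤ} {p : Coord} (hp : p ∈ formDeg k) {m : Fin 5 →₀ ℕ}
    (hm : (m.degree : ℤ) ≠ k) : p.coeff m = 0 :=
  not_not.1 fun h => hm (hp m h)

lemma formComp_mul {i k : ℤ} {a : Coord} (ha : a ∈ formDeg i) (p : Coord) :
    formComp (i + k) (a * p) = a * formComp k p := by
  classical
  ext m
  have h : (if (m.degree : ℤ) = i + k then
      ∑ x ∈ Finset.HasAntidiagonal.antidiagonal m, a.coeff x.1 * p.coeff x.2 else 0) =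
      ∑ x ∈ Finset.HasAntidiagonal.antidiagonal m, if (m.degree : ℤ) = i + k then a.coeff x.1 * p.coeff x.2
        else 0 := by
    split_ifs <;> simp
  rw [coeff_formComp, coeff_mul, coeff_mul, h]
  refine Finset.sum_congr rfl fun x hx => ?_
  rw [coeff_formComp, mul_ite, mul_zero]
  by_cases hax : a.coeff x.1 = 0
  · simp [hax]
  · have h1 := ha _ hax
    have h2 : m.degree = x.1.degree + x.2.degree := by
      rw [← Finset.HasAntidiagonal.mem_antidiagonal.1 hx, map_add]
    congr 1
    rw [h2, Nat.cast_add, h1, add_right_inj]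

lemma mem_formDeg_iff {i : ℕ} {a : Coord} : a ∈ formDeg i ↔ a ∈ grading i := by
  constructor
  · intro h
    refine (mem_homogeneousSubmodule _ _).2 fun m hm => ?_
    have h1 : m.degree = i := by exact_mod_cast h m hm
    rw [Finsupp.degree_eq_weight_one] at h1
    exact h1
  · intro h m hm
    have h1 : m.degree = i := by
      rw [Finsupp.degree_eq_weight_one]
      exact (mem_homogeneousSubmodule _ _).1 h hm
    exact_mod_cast h1

lemma formComp_mem (k : ℤ) (p : Coord) : formComp k p ∈ formDeg k := fun m hm => by
  rw [coeff_formComp] at hm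
  exact (ite_ne_right_iff.1 hm).1

lemma formComp_same {k : ℤ} {p : Coord} (hp : p ∈ formDeg k) : formComp k p = p := by
  ext m
  rw [coeff_formComp]
  split_ifs with h
  · rfl
  · exact (coeff_eq_zero_of_mem_formDeg hp h).symm

lemma formComp_ne {j k : ℤ} {p : Coord} (hp : p ∈ formDeg k) (hj : j ≠ k) : formComp j p = 0 := by
  ext m
  rw [coeff_formComp, coeff_zero]
  split_ifs with h
  · exact coeff_eq_zero_of_mem_formDeg hp (h ▸ hj)
  · rfl

section Free

variable {ι : Type} (w : ι → ℤ)

/-- The component of degree `k` in a graded free module. -/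
noncomputable def freeComp (k : ℤ) : (ι → Coord) →+ (ι → Coord) where
  toFun v i := formComp (k - w i) (v i)
  map_zero' := funext fun _ => map_zero _
  map_add' _ _ := funext fun _ => map_add _ _ _

lemma freeComp_apply (k : ℤ) (v : ι → Coord) (i : ι) :
    freeComp w k v i = formComp (k - w i) (v i) := rfl

/-- The projections onto the graded pieces of a graded free module. -/
noncomputable def freeProj [Fintype ι] : GradedProj grading (freeDeg w) where
  proj := freeComp w
  proj_mem k v i := formComp_mem _ _
  proj_same {k v} hv := funext fun i => formComp_same (hv i)
  proj_ne {j k v} hv hjk := funext fun i => formComp_ne (hv i) (by omega)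
  proj_smul {i k a v} ha := funext fun l => by
    rw [freeComp_apply, Pi.smul_apply, smul_eq_mul, Pi.smul_apply, smul_eq_mul, freeComp_apply,
      add_sub_assoc, formComp_mul (mem_formDeg_iff.2 ha)]
  exists_sum v := by
    classical
    refine ⟨Finset.univ.biUnion fun i => (v i).support.image fun m => (m.degree : ℤ) + w i,
      fun k hk => ?_, ?_⟩
    · ext i m
      rw [freeComp_apply, coeff_formComp, Pi.zero_apply, coeff_zero]
      split_ifs with h
      · by_contra hm
        refine hk (Finset.mem_biUnion.2 ⟨i, Finset.mem_univ _, Finset.mem_image.2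
          ⟨m, mem_support_iff.2 hm, by omega⟩⟩)
      · rfl
    · ext i m
      rw [Finset.sum_apply, coeff_sum]
      simp only [freeComp_apply, coeff_formComp]
      by_cases hm : (v i).coeff m = 0
      · simp [hm]
      · rw [Finset.sum_eq_single ((m.degree : ℤ) + w i)]
        · simp
        · intro k _ hk
          rw [if_neg (by omega)]
        · intro h
          exact absurd (Finset.mem_biUnion.2 ⟨i, Finset.mem_univ _, Finset.mem_image.2
            ⟨m, mem_support_iff.2 hm, rfl⟩⟩) h

end Free

/-- The projections onto the graded pieces of the quotient by a homogeneous submodule. -/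
noncomputable def quotProj {M : Type} [AddCommGroup M] [Module Coord M] {ℳ : ℤ → AddSubgroup M}
    (P : GradedProj grading ℳ) (N : Submodule Coord M)
    (hN : ∀ k, ∀ v ∈ N, P.proj k v ∈ N) : GradedProj grading (quotDeg ℳ N) where
  proj k := QuotientAddGroup.map N.toAddSubgroup N.toAddSubgroup (P.proj k) (hN k)
  proj_mem k m := by
    obtain ⟨v, rfl⟩ := N.mkQ_surjective m
    exact ⟨P.proj k v, P.proj_mem k v, rfl⟩
  proj_same {k m} hm := by
    obtain ⟨v, hv, rfl⟩ := hm
    exact congrArg N.mkQ (P.proj_same hv)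
  proj_ne {j k m} hm hjk := by
    obtain ⟨v, hv, rfl⟩ := hm
    exact (congrArg N.mkQ (P.proj_ne hv hjk)).trans (map_zero _)
  proj_smul {i k a m} ha := by
    obtain ⟨v, rfl⟩ := N.mkQ_surjective m
    exact (congrArg N.mkQ (P.proj_smul ha)).trans (map_smul N.mkQ _ _)
  exists_sum m := by
    obtain ⟨v, rfl⟩ := N.mkQ_surjective m
    obtain ⟨s, hs, hsum⟩ := P.exists_sum v
    refine ⟨s, fun k hk => (congrArg N.mkQ (hs k hk)).trans (map_zero _), ?_⟩
    exact (map_sum N.mkQ _ _).symm.trans (congrArg N.mkQ hsum)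

/-- The range of a matrix with homogeneous entries is a homogeneous submodule. -/
lemma freeComp_mem_range {ι κ : Type} [Fintype κ] (w : ι → ℤ) (d : ℤ) {B : Matrix ι κ Coord}
    (hB : ∀ i j, B i j ∈ formDeg (d - w i)) (k : ℤ) :
    ∀ v ∈ LinearMap.range B.mulVecLin, freeComp w k v ∈ LinearMap.range B.mulVecLin := by
  rintro _ ⟨u, rfl⟩
  refine ⟨freeComp (fun _ => d) k u, funext fun i => ?_⟩
  rw [freeComp_apply, Matrix.mulVecLin_apply, Matrix.mulVecLin_apply, Matrix.mulVec, dotProduct,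
    Matrix.mulVec, dotProduct, map_sum]
  refine Finset.sum_congr rfl fun j _ => ?_
  rw [freeComp_apply, ← formComp_mul (hB i j)]
  congr 2
  ring

end CanonicalSurface

/-! ### Gradients of substituted polynomials and of linear forms. -/

namespace MvPolynomial

variable {K : Type*} [Field K] {N : ℕ}

/-- The chain rule; it relates gradients of pulled-back equations of the degeneracy locus to their
differentials on matrix space. -/
lemma gradient_aeval {τ : Type*} [Fintype τ] (q : Fin N → K) (b : τ → MvPolynomial (Fin N) K)
    (f : MvPolynomial τ K) :
    gradient q (aeval b f) =
      ∑ p, eval (fun p => eval q (b p)) (pderiv p f) • gradient q (b p) := by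
  classical
  have hev (f : MvPolynomial τ K) : eval q (aeval b f) = eval (fun p => eval q (b p)) f := by
    change ((eval q).comp (aeval b : MvPolynomial τ K →ₐ[K] _).toRingHom) f = _
    congr 1
    ext i <;> simp
  induction f using MvPolynomial.induction_on with
  | C a =>
    ext i
    simp [gradient_apply]
  | add f g hf hg =>
    simp only [map_add, hf, hg, add_smul, Finset.sum_add_distrib]
  | mul_X f p hf =>
    rw [map_mul, aeval_X, gradient_mul, hf, hev]
    simp only [Derivation.leibniz, smul_eq_mul, map_add, map_mul, add_smul, Finset.sum_add_distrib,
      eval_X, Finset.smul_sum, smul_smul, pderiv_X]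
    congr 1
    rw [Finset.sum_eq_single p]
    · simp
    · intro p' _ hp'
      simp [Pi.single_eq_of_ne hp'.symm]
    · simp

/-- A linear form is its own differential, whatever the base point `q`. -/
lemma sum_gradient_mul_of_isHomogeneous_one {b : MvPolynomial (Fin N) K} (hb : b.IsHomogeneous 1)
    (q v : Fin N → K) : ∑ i, gradient q b i * v i = eval v b := by
  classical
  rw [b.as_sum]
  simp only [map_sum, Finset.sum_apply, Finset.sum_mul]
  rw [Finset.sum_comm]
  refine Finset.sum_congr rfl fun m hm => ?_
  have h1 : m.degree = 1 := by
    rw [Finsupp.degree_eq_weight_one]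
    exact hb (mem_support_iff.1 hm)
  obtain ⟨j, rfl⟩ := (Finsupp.sum_eq_one_iff m).1 h1
  rw [Finset.sum_eq_single j]
  · simp [gradient_apply, pderiv_monomial, eval_monomial]
  · intro i _ hi
    simp [gradient_apply, pderiv_monomial, hi.symm]
  · simp

end MvPolynomial

namespace Matrix

lemma submatrix_mulVec_mem_range {A ι κ τ : Type*} [CommRing A] [Fintype κ] [Fintype τ]
    (B : Matrix ι κ A) (c : τ → κ) (y : τ → A) :
    B.submatrix id c *ᵥ y ∈ LinearMap.range B.mulVecLin := by
  classical
  refine ⟨(1 : Matrix κ κ A).submatrix id c *ᵥ y, ?_⟩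
  rw [mulVecLin_apply, mulVec_mulVec]
  congr 1
  ext i j
  simp [mul_apply, one_apply]

end Matrix

/-! ### Local depth of `R`, and what transversality gives. -/

namespace CanonicalSurface

open MvPolynomial GradedTilde

variable {n : ℕ} {α β : Matrix (Fin (n + 1)) (Fin (n + 1)) Coord}

/-- The column index set of the maximal minors of `A'`. -/
abbrev Cols (n : ℕ) : Type := Fin n → Fin (n + 1) ⊕ Fin (n + 1)

/-- The maximal minor of `A'` with columns `c`. -/
noncomputable def minor (α β : Matrix (Fin (n + 1)) (Fin (n + 1)) Coord) (c : Cols n) : Coord :=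
  ((lowerMatrix α β).submatrix id c).det

section Resolution

/-- Otherwise `0` would be a common divisor of the minors, and it is not a unit. -/
lemma exists_minor_ne_zero
    (hminors : ∀ d : Coord, (∀ f ∈ minorsIdeal (bigMatrix α β), d ∣ f) → IsUnit d) :
    ∃ c : Fin (n + 1) → Fin (n + 1) ⊕ Fin (n + 1), ((bigMatrix α β).submatrix id c).det ≠ 0 := by
  by_contra! h
  have : IsUnit (0 : Coord) := hminors 0 fun f hf => by
    have : minorsIdeal (bigMatrix α β) = ⊥ := Ideal.span_eq_bot.2 (by
      rintro _ ⟨c, rfl⟩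
      exact h c)
    rw [this] at hf
    rw [(Submodule.mem_bot _).1 hf]
  exact not_isUnit_zero this

variable (hsymm : α * β.transpose = β * α.transpose)
  (hminors : ∀ d : Coord, (∀ f ∈ minorsIdeal (bigMatrix α β), d ∣ f) → IsUnit d)

include hsymm hminors

lemma resolution_exact : Function.Exact (Matrix.symplecticDual α β).mulVecLin
    (bigMatrix α β).mulVecLin := by
  obtain ⟨c, hc⟩ := exists_minor_ne_zero hminors
  refine Matrix.symplecticDual_exact α β hsymm hc fun d hd => hminors d fun f hf => ?_
  rw [← Ideal.mem_span_singleton]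
  refine (Ideal.span_le.2 ?_ : minorsIdeal (bigMatrix α β) ≤ _) hf
  rintro _ ⟨c, rfl⟩
  exact Ideal.mem_span_singleton.2 (hd c)

/-- Local version of `depth ≥ 1`. -/
lemma R.exists_smul_eq_zero {q : Fin 5 → ℂ} {ι : Type*} {g : ι → Coord}
    (hg : (∃ k, eval q (g k) ≠ 0) ∨ ∃ f : Fin 4 → Coord,
      (∀ k, f k ∈ (Ideal.span (Set.range g)).radical) ∧
        LinearIndependent ℂ fun k => gradient q (f k))
    {r : R α β} (hr : ∀ k, g k • r = 0) : ∃ a, eval q a ≠ 0 ∧ a • r = 0 := by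
  obtain ⟨c, hc⟩ := exists_minor_ne_zero hminors
  exact exists_smul_eq_zero_at_point (Matrix.symplecticDual_injective α β hc)
    (resolution_exact hsymm hminors)
    (LinearMap.exact_map_mkQ_range _) (Submodule.mkQ_surjective _) hg hr

/-- Local version of `depth ≥ 2`. -/
lemma R.exists_smul_eq {q : Fin 5 → ℂ} {ι : Type*} [Finite ι] {g : ι → Coord}
    (hg : (∃ k, eval q (g k) ≠ 0) ∨ ∃ f : Fin 4 → Coord,
      (∀ k, f k ∈ (Ideal.span (Set.range g)).radical) ∧
        LinearIndependent ℂ fun k => gradient q (f k))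
    {m : ι → R α β} (hm : ∀ k l, g l • m k = g k • m l) :
    ∃ (a : Coord) (r : R α β), eval q a ≠ 0 ∧ ∀ k, g k • r = a • m k := by
  obtain ⟨c, hc⟩ := exists_minor_ne_zero hminors
  exact exists_smul_eq_at_point (Matrix.symplecticDual_injective α β hc)
    (resolution_exact hsymm hminors)
    (LinearMap.exact_map_mkQ_range _) (Submodule.mkQ_surjective _) hg hm

end Resolution

section Transverse

lemma eval_minor (c : Cols n) (q : Fin 5 → ℂ) :
    eval q (minor α β c) = ((evalAt (lowerMatrix α β) q).submatrix id c).det := by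
  rw [minor, RingHom.map_det]
  rfl

/-- Erasing the first row of `A` takes a principal submatrix of `αβᵗ`, so symmetry persists; full
rank would give a nonzero maximal minor. -/
lemma evalAt_mem_degCone (hsymm : α * β.transpose = β * α.transpose) {q : Fin 5 → ℂ}
    (hq : ∀ c, eval q (minor α β c) = 0) : evalAt (lowerMatrix α β) q ∈ degCone n := by
  refine ⟨?_, ?_⟩
  · ext i j
    have h := congrArg (eval q) (congrFun (congrFun hsymm i.succ) j.succ)
    rw [Matrix.mul_apply, Matrix.mul_apply, map_sum, map_sum] at h
    simpa [Matrix.mul_apply, evalAt] using h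
  · by_contra! h
    obtain ⟨c, hc⟩ := Matrix.exists_det_submatrix_ne_zero _ h
    exact hc ((eval_minor c q).symm.trans (hq c))

/-- If `ℙ⁴` is transverse to the degeneracy locus, then at each zero `q ≠ 0` of the maximal minors
of `A'` there are four elements of the radical of the ideal of these minors with independent
gradients. -/
lemma exists_linearIndependent_gradient
    (hα : ∀ (i : Fin n) (j : Fin (n + 1)), (α i.succ j).IsHomogeneous 1)
    (hβ : ∀ (i : Fin n) (j : Fin (n + 1)), (β i.succ j).IsHomogeneous 1)
    (hsymm : α * β.transpose = β * α.transpose) (htrans : IsTransverse (lowerMatrix α β))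
    {q : Fin 5 → ℂ} (hq : q ≠ 0) :
    (∃ c, eval q (minor α β c) ≠ 0) ∨ ∃ f : Fin 4 → Coord,
      (∀ k, f k ∈ (Ideal.span (Set.range (minor α β))).radical) ∧
        LinearIndependent ℂ fun k => gradient q (f k) := by
  rw [or_iff_not_imp_left]
  intro h
  push Not at h
  set J := Ideal.span (Set.range (minor α β))
  have hlin (p : Fin n × (Fin (n + 1) ⊕ Fin (n + 1))) :
      (lowerMatrix α β p.1 p.2).IsHomogeneous 1 := by
    obtain ⟨i, j | j⟩ := p
    · exact hα i j
    · exact hβ i j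
  let b : Fin n × (Fin (n + 1) ⊕ Fin (n + 1)) → Coord := fun p => lowerMatrix α β p.1 p.2
  -- Nullstellensatz: the common zeros of the minors are mapped into the degeneracy cone, where `f`
  -- vanishes.
  have hrad (f : MvPolynomial (Fin n × (Fin (n + 1) ⊕ Fin (n + 1))) ℂ)
      (hf : ∀ M ∈ degCone n, eval (fun p => M p.1 p.2) f = 0) : aeval b f ∈ J.radical := by
    rw [← vanishingIdeal_zeroLocus_eq_radical (K := ℂ)]
    intro x hx
    have hx' (c : Cols n) : eval x (minor α β c) = 0 := hx _ (Ideal.subset_span ⟨c, rfl⟩)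
    have h1 := hf _ (evalAt_mem_degCone hsymm hx')
    rw [← h1]
    change ((aeval x : Coord →ₐ[ℂ] ℂ).comp (aeval b)) f = (aeval _ : _ →ₐ[ℂ] ℂ) f
    congr 1
    ext p
    simp [b, evalAt]
  let W : Submodule ℂ (Fin 5 → ℂ) := (J.radical.restrictScalars ℂ).map (gradient q)
  have hW : 4 ≤ Module.finrank ℂ W := by
    by_contra! hlt
    let W' := W.map (dotProductEquiv ℂ (Fin 5)).toLinearMap
    have h1 := Subspace.finrank_add_finrank_dualCoannihilator_eq W'
    have h2 : Module.finrank ℂ W' = Module.finrank ℂ W := LinearEquiv.finrank_map_eq _ W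
    rw [h2, Module.finrank_fintype_fun_eq_card, Fintype.card_fin] at h1
    -- If `v` is orthogonal to all these gradients, then `A'(v)` is tangent to the degeneracy cone,
    -- since `A'` is linear, and transversality leaves only multiples of `q`. Hence `W` has
    -- codimension at most one in `ℂ⁵`.
    have h3 : W'.dualCoannihilator ≤ Submodule.span ℂ {q} := by
      intro v hv
      rw [Submodule.mem_dualCoannihilator] at hv
      refine (htrans q hq (evalAt_mem_degCone hsymm h)).1 v fun f hf => ?_
      have h4 := hv _ ⟨_, ⟨_, hrad f hf, rfl⟩, rfl⟩
      change ∑ i, gradient q (aeval b f) i * v i = 0 at h4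
      rw [gradient_aeval] at h4
      simp only [Finset.sum_apply, Pi.smul_apply, smul_eq_mul, Finset.sum_mul, mul_assoc] at h4
      rw [Finset.sum_comm] at h4
      simp only [← Finset.mul_sum] at h4
      rw [← h4]
      refine Finset.sum_congr rfl fun p _ => ?_
      rw [sum_gradient_mul_of_isHomogeneous_one (hlin p)]
      rfl
    have h4 := Submodule.finrank_mono h3
    have h5 : Module.finrank ℂ (Submodule.span ℂ {q}) ≤ 1 := by
      simpa using finrank_span_le_card (R := ℂ) ({q} : Set (Fin 5 → ℂ))
    omega
  obtain ⟨w, hw⟩ := exists_linearIndependent_of_le_finrank hW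
  choose f hf hfw using fun k => (w k).2
  refine ⟨f, hf, ?_⟩
  have : (fun k => gradient q (f k)) = W.subtype ∘ w := funext hfw
  rw [this]
  exact hw.map' _ W.ker_subtype

end Transverse

end CanonicalSurface

namespace GradedTilde

universe u

variable {A : Type u} {σ : Type*} [CommRing A] [SetLike σ A] [AddSubgroupClass σ A]
  {𝒜 : ℕ → σ} [GradedRing 𝒜] {M : Type u} [AddCommGroup M] [Module A M] {ℳ : ℤ → AddSubgroup M}
  (P : GradedProj 𝒜 ℳ)

/-- Used to cut identities with inhomogeneous multipliers down to homogeneous ones. -/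
lemma GradedProj.proj_smul_of_mem [IsGradedModule 𝒜 ℳ] {k : ℤ} {m : M} (hm : m ∈ ℳ k) (i : ℕ)
    (a : A) : P.proj (i + k) (a • m) = ((DirectSum.decompose 𝒜 a i : 𝒜 i) : A) • m := by
  classical
  conv_lhs => rw [← DirectSum.sum_support_decompose 𝒜 a, Finset.sum_smul, map_sum]
  have h (j : ℕ) : P.proj (i + k) (((DirectSum.decompose 𝒜 a j : 𝒜 j) : A) • m) =
      if j = i then ((DirectSum.decompose 𝒜 a i : 𝒜 i) : A) • m else 0 := by
    split_ifs with hji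
    · subst hji
      rw [P.proj_smul (SetLike.coe_mem _), P.proj_same hm]
    · exact P.proj_ne (IsGradedModule.smul_mem (𝒜 := 𝒜) (SetLike.coe_mem _) hm)
        (by omega)
  simp only [h, Finset.sum_ite_eq']
  split_ifs with hi
  · rfl
  · rw [DFinsupp.notMem_support_iff.1 hi]
    simp

end GradedTilde

namespace CanonicalSurface

open MvPolynomial GradedTilde

variable {n : ℕ} {α β : Matrix (Fin (n + 1)) (Fin (n + 1)) Coord}

/-! ### Vanishing of elements of `R` from local depth. -/

section Global

/-- When all coordinates lie in the radical of an ideal, four of them serve as the polynomials with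
independent gradients at any point. -/
lemma linearIndependent_gradient_X (q : Fin 5 → ℂ) :
    LinearIndependent ℂ fun k : Fin 4 => gradient q (X k.castSucc : Coord) := by
  have : (fun k : Fin 4 => gradient q (X k.castSucc : Coord)) =
      fun k : Fin 4 => Pi.basisFun ℂ (Fin 5) k.castSucc := by
    ext k i
    simp [gradient_apply, pderiv_X, Pi.single_apply, eq_comm, apply_ite]
  rw [this]
  exact (Pi.basisFun ℂ (Fin 5)).linearIndependent.comp _ (Fin.castSucc_injective 4)

variable (hsymm : α * β.transpose = β * α.transpose)
  (hminors : ∀ d : Coord, (∀ f ∈ minorsIdeal (bigMatrix α β), d ∣ f) → IsUnit d)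

/-- By the Nullstellensatz every maximal ideal is the ideal of a point, so the annihilator of `r`
lies in none of them. -/
lemma R.eq_zero_of_forall_exists {M : Type*} [AddCommGroup M] [Module Coord M] {r : M}
    (h : ∀ q : Fin 5 → ℂ, ∃ a, eval q a ≠ 0 ∧ a • r = 0) : r = 0 := by
  suffices (1 : Coord) ∈ LinearMap.ker (LinearMap.toSpanSingleton Coord M r) by simpa using this
  suffices LinearMap.ker (LinearMap.toSpanSingleton Coord M r) = ⊤ by rw [this]; trivial
  by_contra hne
  obtain ⟨m, hm, hle⟩ := Ideal.exists_le_maximal _ hne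
  obtain ⟨q, rfl⟩ := eq_vanishingIdeal_singleton_of_isMaximal ℂ hm
  obtain ⟨a, ha, har⟩ := h q
  exact ha (hle har q rfl)

include hsymm hminors

/-- The irrelevant ideal contains a regular element on `R`. -/
lemma R.eq_zero_of_X_mem_radical {ι : Type*} {g : ι → Coord}
    (hg : ∀ i, X i ∈ (Ideal.span (Set.range g)).radical) {r : R α β} (hr : ∀ k, g k • r = 0) :
    r = 0 :=
  R.eq_zero_of_forall_exists fun q => R.exists_smul_eq_zero hsymm hminors (g := g)
    (Or.inr ⟨fun k => X k.castSucc, fun _ => hg _, linearIndependent_gradient_X q⟩) hr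

/-- Away from the origin transversality provides the local depth, so the annihilator of `r` has no
zero except possibly the origin. Its radical then contains all coordinates, and depth along an ideal
with that property kills `r`. -/
lemma R.eq_zero_of_minor_smul
    (hα : ∀ (i : Fin n) (j : Fin (n + 1)), (α i.succ j).IsHomogeneous 1)
    (hβ : ∀ (i : Fin n) (j : Fin (n + 1)), (β i.succ j).IsHomogeneous 1)
    (htrans : IsTransverse (lowerMatrix α β)) {r : R α β} (hr : ∀ c, minor α β c • r = 0) :
    r = 0 := by
  -- The family `g` is the whole annihilator of `r`.
  refine R.eq_zero_of_X_mem_radical hsymm hminors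
    (g := fun a : LinearMap.ker (LinearMap.toSpanSingleton Coord (R α β) r) => (a : Coord))
    (fun i => ?_) (fun a => a.2)
  have hrange : Set.range (fun a : LinearMap.ker (LinearMap.toSpanSingleton Coord (R α β) r) =>
      (a : Coord)) = (LinearMap.ker (LinearMap.toSpanSingleton Coord (R α β) r) : Set Coord) :=
    Subtype.range_coe
  rw [hrange, Ideal.span_eq,
    ← vanishingIdeal_zeroLocus_eq_radical (K := ℂ)]
  intro q hq
  rcases eq_or_ne q 0 with rfl | hq0
  · simp
  obtain ⟨a, ha, har⟩ := R.exists_smul_eq_zero hsymm hminors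
    (exists_linearIndependent_gradient hα hβ hsymm htrans hq0) hr
  exact absurd (hq a har) ha

end Global

/-! ### The minors of `A'` multiply `R` into `𝒜 / Ann R`. -/

section Theta

variable (α β) in
/-- The determinant `det (v A_c)`, where `A_c` consists of the columns `c` of `A`, expanded along
the first row. -/
noncomputable def theta (c : Cols n) : (Fin (n + 1) → Coord) →ₗ[Coord] Coord :=
  minor α β c • LinearMap.proj 0 -
    (dotProductBilin Coord Coord ((bigMatrix α β 0) ∘ c)) ∘ₗ
      ((lowerMatrix α β).submatrix id c).adjugate.mulVecLin ∘ₗ LinearMap.funLeft Coord Coord Fin.succ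

lemma theta_apply (c : Cols n) (v : Fin (n + 1) → Coord) :
    theta α β c v = minor α β c * v 0 -
      ((bigMatrix α β 0) ∘ c) ⬝ᵥ
        (((lowerMatrix α β).submatrix id c).adjugate.mulVec fun i => v i.succ) := rfl

/-- Cramer's rule in the lower rows: the columns `c` of `A'` combine to the minor times the lower
part of `v`, and `theta` is exactly the discrepancy left in the first row. -/
lemma minor_smul_eq (c : Cols n) (v : Fin (n + 1) → Coord) :
    minor α β c • v = theta α β c v • Pi.single 0 1 + ((bigMatrix α β).submatrix id c).mulVec
      (((lowerMatrix α β).submatrix id c).adjugate.mulVec fun i => v i.succ) := by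
  ext1 i
  refine Fin.cases ?_ (fun i => ?_) i
  · rw [Pi.add_apply, Pi.smul_apply, Pi.smul_apply, theta_apply, smul_eq_mul, smul_eq_mul,
      Pi.single_eq_same, mul_one]
    exact (sub_add_cancel _ _).symm
  · rw [Pi.add_apply, Pi.smul_apply, Pi.smul_apply, Pi.single_eq_of_ne (Fin.succ_ne_zero i),
      smul_zero, zero_add]
    have h : ((lowerMatrix α β).submatrix id c).mulVec
        (((lowerMatrix α β).submatrix id c).adjugate.mulVec fun i => v i.succ) =
        minor α β c • fun i => v i.succ := by
      rw [Matrix.mulVec_mulVec, Matrix.mul_adjugate, Matrix.smul_mulVec, Matrix.one_mulVec]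
      rfl
    exact (congrFun h i).symm

variable (α β) in
/-- The generator of `R` of degree zero. -/
noncomputable def R.gen : R α β := Submodule.mkQ _ (Pi.single 0 1)

/-- A combination of columns of `A` is zero in `R`, so only the discrepancy in the first row
survives: the minors carry `R` into the cyclic submodule of `R.gen`. -/
lemma minor_smul_mk (c : Cols n) (v : Fin (n + 1) → Coord) :
    minor α β c • (Submodule.mkQ _ v : R α β) = theta α β c v • R.gen α β := by
  rw [← map_smul, minor_smul_eq, map_add, map_smul]
  have : Submodule.mkQ (LinearMap.range (bigMatrix α β).mulVecLin)
      (((bigMatrix α β).submatrix id c).mulVec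
      (((lowerMatrix α β).submatrix id c).adjugate.mulVec fun i => v i.succ)) = 0 :=
    (Submodule.Quotient.mk_eq_zero _).2 (Matrix.submatrix_mulVec_mem_range _ c _)
  rw [this, add_zero]
  rfl

variable (α β) in
/-- The homomorphism `𝒜 / Ann R → R` sending `1` to the generator of degree zero. -/
noncomputable def genMap : (Coord ⧸ idealY α β) →ₗ[Coord] R α β :=
  Submodule.liftQ _ (LinearMap.toSpanSingleton Coord _ (R.gen α β)) fun _ ha =>
    Module.mem_annihilator.1 ha _

lemma genMap_mk (a : Coord) : genMap α β (Submodule.mkQ _ a) = a • R.gen α β := rfl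

variable (hsymm : α * β.transpose = β * α.transpose)
  (hminors : ∀ d : Coord, (∀ f ∈ minorsIdeal (bigMatrix α β), d ∣ f) → IsUnit d)
  (hα : ∀ (i : Fin n) (j : Fin (n + 1)), (α i.succ j).IsHomogeneous 1)
  (hβ : ∀ (i : Fin n) (j : Fin (n + 1)), (β i.succ j).IsHomogeneous 1)
  (htrans : IsTransverse (lowerMatrix α β))

include hsymm hminors hα hβ htrans

/-- Each minor sends any `r` to a multiple of the generator, so if `a` kills the generator then all
minors kill `a • r`, which is therefore zero. This identifies `𝒜 / Ann R` with the submodule of the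
generator. -/
lemma mem_idealY_of_smul_gen {a : Coord} (ha : a • R.gen α β = 0) : a ∈ idealY α β := by
  refine Module.mem_annihilator.2 fun r => R.eq_zero_of_minor_smul hsymm hminors hα hβ htrans
    fun c => ?_
  obtain ⟨v, rfl⟩ := Submodule.mkQ_surjective _ r
  rw [smul_comm, minor_smul_mk, smul_comm, ha, smul_zero]

lemma genMap_injective : Function.Injective (genMap α β) := by
  rw [← LinearMap.ker_eq_bot, LinearMap.ker_eq_bot']
  intro a ha
  obtain ⟨a, rfl⟩ := Submodule.mkQ_surjective _ a
  exact (Submodule.Quotient.mk_eq_zero _).2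
    (mem_idealY_of_smul_gen hsymm hminors hα hβ htrans ha)

/-- If `v` is zero in `R`, then `theta v` kills the generator by `minor_smul_mk`, hence kills `R`;
so `theta` descends to the quotients. -/
lemma exists_thetaBar (c : Cols n) : ∃ θ : R α β →ₗ[Coord] (Coord ⧸ idealY α β),
    ∀ v, θ (Submodule.mkQ _ v) = Submodule.mkQ _ (theta α β c v) := by
  refine ⟨Submodule.liftQ _ (Submodule.mkQ _ ∘ₗ theta α β c) ?_, fun v => rfl⟩
  intro v hv
  refine (Submodule.Quotient.mk_eq_zero _).2
    (mem_idealY_of_smul_gen hsymm hminors hα hβ htrans ?_)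
  have h0 : (Submodule.mkQ _ v : R α β) = 0 := (Submodule.Quotient.mk_eq_zero _).2 hv
  rw [← minor_smul_mk, h0, smul_zero]

end Theta

/-! ### Degrees of the entries, minors and multiplication maps. -/

section Grading

variable (hα₀ : ∀ j, (α 0 j).IsHomogeneous 3) (hβ₀ : ∀ j, (β 0 j).IsHomogeneous 3)
  (hα : ∀ (i : Fin n) (j : Fin (n + 1)), (α i.succ j).IsHomogeneous 1)
  (hβ : ∀ (i : Fin n) (j : Fin (n + 1)), (β i.succ j).IsHomogeneous 1)

/-- The degrees of the generators of `𝒜 ⊕ 𝒜(-2)ⁿ`. -/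
abbrev genDeg (n : ℕ) : Fin (n + 1) → ℤ := Fin.cons 0 fun _ => 2

include hα₀ hβ₀ hα hβ in
lemma bigMatrix_mem_formDeg (i : Fin (n + 1)) (j : Fin (n + 1) ⊕ Fin (n + 1)) :
    bigMatrix α β i j ∈ formDeg (3 - genDeg n i) := by
  refine Fin.cases ?_ (fun i => ?_) i
  · have : (3 - genDeg n 0 : ℤ) = (3 : ℕ) := by simp [genDeg]
    rw [this, mem_formDeg_iff]
    rcases j with j | j
    exacts [hα₀ j, hβ₀ j]
  · have : (3 - genDeg n i.succ : ℤ) = (1 : ℕ) := by simp [genDeg]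
    rw [this, mem_formDeg_iff]
    rcases j with j | j
    exacts [hα i j, hβ i j]

/-- The projections onto the graded pieces of `R`. -/
noncomputable def R.gradedProj (hα₀ : ∀ j, (α 0 j).IsHomogeneous 3)
    (hβ₀ : ∀ j, (β 0 j).IsHomogeneous 3)
    (hα : ∀ (i : Fin n) (j : Fin (n + 1)), (α i.succ j).IsHomogeneous 1)
    (hβ : ∀ (i : Fin n) (j : Fin (n + 1)), (β i.succ j).IsHomogeneous 1) :
    GradedProj grading (RDeg α β) :=
  quotProj (freeProj _) _ (freeComp_mem_range _ 3 (bigMatrix_mem_formDeg hα₀ hβ₀ hα hβ))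

lemma isHomogeneous_det {m : ℕ} {B : Matrix (Fin m) (Fin m) Coord} (d : Fin m → ℕ)
    (hB : ∀ i j, (B i j).IsHomogeneous (d i)) : B.det.IsHomogeneous (∑ i, d i) := by
  rw [Matrix.det_apply']
  refine IsHomogeneous.sum _ _ _ fun s _ => ?_
  have h1 : (∏ i, B (s i) i).IsHomogeneous (∑ i, d (s i)) :=
    IsHomogeneous.prod _ _ _ fun i _ => hB (s i) i
  rw [Equiv.sum_comp s d] at h1
  have h2 : ((Equiv.Perm.sign s : ℤ) : Coord).IsHomogeneous 0 := by
    rw [← map_intCast (C : ℂ →+* Coord)]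
    exact isHomogeneous_C _ _
  simpa using h2.mul h1

include hα hβ

lemma isHomogeneous_lowerMatrix (i : Fin n) (j : Fin (n + 1) ⊕ Fin (n + 1)) :
    (lowerMatrix α β i j).IsHomogeneous 1 := by
  rcases j with j | j
  exacts [hα i j, hβ i j]

lemma minor_mem (c : Cols n) : minor α β c ∈ grading n := by
  have := isHomogeneous_det (B := (lowerMatrix α β).submatrix id c) (fun _ => 1)
    fun i j => isHomogeneous_lowerMatrix hα hβ i (c j)
  rw [Finset.sum_const, Finset.card_univ, Fintype.card_fin, smul_eq_mul, mul_one] at this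
  exact (mem_homogeneousSubmodule _ _).2 this

lemma isHomogeneous_adjugate (c : Cols n) (i j : Fin n) :
    (((lowerMatrix α β).submatrix id c).adjugate i j).IsHomogeneous (n - 1) := by
  rw [Matrix.adjugate_apply]
  -- The adjugate entry is a determinant with row `j` replaced by a basis vector, which counts with
  -- degree zero.
  have := isHomogeneous_det (B := ((lowerMatrix α β).submatrix id c).updateRow j (Pi.single i 1))
    (fun k => if k = j then 0 else 1) fun k l => by
      by_cases hk : k = j
      · subst hk
        rw [Matrix.updateRow_self, if_pos rfl, Pi.single_apply]
        split_ifs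
        · exact isHomogeneous_one _ _
        · exact isHomogeneous_zero _ _ _
      · rw [Matrix.updateRow_ne hk, if_neg hk]
        exact isHomogeneous_lowerMatrix hα hβ k (c l)
  convert this using 1
  rw [Finset.sum_ite, Finset.sum_const_zero, zero_add, Finset.sum_const, smul_eq_mul, mul_one,
    Finset.filter_ne', Finset.card_erase_of_mem (Finset.mem_univ j), Finset.card_univ,
    Fintype.card_fin]

include hα₀ hβ₀ in
lemma theta_mem (c : Cols n) {k : ℤ} {v : Fin (n + 1) → Coord} (hv : v ∈ freeDeg (genDeg n) k) :
    theta α β c v ∈ formDeg (k + n) := by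
  have hmul {i j : ℤ} {a b : Coord} {e : ℕ} (he : i = e) (ha : a.IsHomogeneous e)
      (hb : b ∈ formDeg j) : a * b ∈ formDeg (i + j) := by
    subst he
    exact IsGradedModule.smul_mem (𝒜 := grading) (ℳ := formDeg) ha hb
  rw [theta_apply]
  refine sub_mem ?_ (sum_mem fun i _ => ?_)
  · have := hmul rfl (minor_mem hα hβ c) (hv 0)
    convert this using 2
    simp [genDeg, add_comm]
  · have hn : 1 ≤ n := Nat.one_le_iff_ne_zero.2 (by rintro rfl; exact i.elim0)
    have h0 : (bigMatrix α β 0 (c i)).IsHomogeneous 3 := by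
      rcases c i with j | j
      exacts [hα₀ j, hβ₀ j]
    have : k + n = 3 + ((n - 1 : ℕ) + (k - 2)) := by omega
    rw [this]
    refine hmul rfl h0 (sum_mem fun j _ => hmul rfl (isHomogeneous_adjugate hα hβ c i j) ?_)
    simpa [genDeg] using hv j.succ

end Grading

/-! ### Closed points under homogeneous primes. -/

section Points

lemma exists_X_notMem (x : ProjectiveSpectrum grading) : ∃ i, X i ∉ x.asHomogeneousIdeal := by
  by_contra! h
  refine x.not_irrelevant_le fun a ha => ?_
  have ha' : a ∈ pointIdeal (0 : Fin 5 → ℂ) := by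
    have h1 := (HomogeneousIdeal.mem_irrelevant_iff _ _).1 ha
    change eval 0 a = 0
    have h2 : coeff 0 (homogeneousComponent 0 a) = 0 := by
      have : homogeneousComponent 0 a = 0 := by
        rw [← h1]
        exact (MvPolynomial.decomposition.decompose'_apply a 0).symm
      rw [this, coeff_zero]
    rw [coeff_homogeneousComponent, if_pos (by simp)] at h2
    rw [← h2, ← constantCoeff_eq]
    exact congrFun (congrArg DFunLike.coe (eval_zero (R := ℂ) (σ := Fin 5))) a
  rw [pointIdeal_eq] at ha'
  refine (Ideal.span_le.2 ?_ : Ideal.ofList _ ≤ x.asHomogeneousIdeal.toIdeal) ha'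
  intro p hp
  obtain ⟨i, rfl⟩ := (List.mem_ofFn ..).1 hp
  simpa using h i

/-- Some coordinate is not in the prime, so by the Nullstellensatz it is nonzero at some zero `q` of
the prime, and then `q ≠ 0`. This transfers statements at points of `ℂ⁵` to all points of `Proj`,
closed or not. -/
lemma exists_point (x : ProjectiveSpectrum grading) :
    ∃ q : Fin 5 → ℂ, q ≠ 0 ∧ x.asHomogeneousIdeal.toIdeal ≤ pointIdeal q := by
  obtain ⟨i, hi⟩ := exists_X_notMem x
  have := x.isPrime
  have h : X i ∉ vanishingIdeal ℂ (zeroLocus ℂ x.asHomogeneousIdeal.toIdeal) := by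
    rwa [vanishingIdeal_zeroLocus_eq_radical, this.radical]
  rw [mem_vanishingIdeal_iff] at h
  push Not at h
  obtain ⟨q, hq, hqi⟩ := h
  refine ⟨q, ?_, fun p hp => hq p hp⟩
  rintro rfl
  simp at hqi

end Points

end CanonicalSurface

/-! ### Sections of `M~` as fractions, and annihilators. -/

namespace GradedTilde

universe u

section Sections

variable {A : Type u} {σ : Type*} [CommRing A] [SetLike σ A] [AddSubgroupClass σ A]
  {𝒜 : ℕ → σ} [GradedRing 𝒜] {M : Type u} [AddCommGroup M] [Module A M]
  {ℳ : ℤ → AddSubgroup M} [IsGradedModule 𝒜 ℳ] {U V : (Proj 𝒜).Opens}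

/-- The value of a section of `M~` at a point. -/
def val (s : Γ(gradedTilde 𝒜 ℳ, U)) (y : ProjectiveSpectrum.top 𝒜) (hy : y ∈ U) : Fiber 𝒜 M y :=
  (show sections 𝒜 ℳ U from s).1 ⟨y, hy⟩

lemma val_ext {s t : Γ(gradedTilde 𝒜 ℳ, U)} (h : ∀ y hy, val s y hy = val t y hy) : s = t :=
  Subtype.ext (a1 := (show sections 𝒜 ℳ U from s)) (a2 := (show sections 𝒜 ℳ U from t))
    (funext fun y => h y.1 y.2)

/-- The section `m / h`. -/
def mkSection {i : ℕ} {m : M} {h : A} (hm : m ∈ ℳ i) (hh : h ∈ 𝒜 i)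
    (hU : U ≤ Proj.basicOpen 𝒜 h) : Γ(gradedTilde 𝒜 ℳ, U) :=
  show sections 𝒜 ℳ U from
  ⟨fun y => LocalizedModule.mk m ⟨h, hU y.2⟩, fun x => ⟨U, x.2, 𝟙 _, i, m, h, hm, hh,
    fun y => ⟨hU y.2, rfl⟩⟩⟩

/-- The regular function `a / h`. -/
def mkFunction {i : ℕ} {a h : A} (ha : a ∈ 𝒜 i) (hh : h ∈ 𝒜 i)
    (hU : U ≤ Proj.basicOpen 𝒜 h) : Γ(Proj 𝒜, U) :=
  show (ProjectiveSpectrum.Proj.structureSheaf 𝒜).1.obj (op U) from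
  ⟨fun y => .mk ⟨i, ⟨a, ha⟩, ⟨h, hh⟩, hU y.2⟩, fun x => ⟨U, x.2, 𝟙 _, i, ⟨a, ha⟩, ⟨h, hh⟩,
    fun y => hU y.2, fun _ => rfl⟩⟩

/-- Inside the open set where `s` is a fraction one finds the locus `f' ≠ 0` for a homogeneous `f'`;
expanding the fraction by `f'` makes its domain the basic open set of its own denominator. -/
lemma exists_val_eq_mk (s : Γ(gradedTilde 𝒜 ℳ, U)) {x : ProjectiveSpectrum.top 𝒜} (hx : x ∈ U) :
    ∃ (i : ℕ) (m : M) (h : A), m ∈ ℳ i ∧ h ∈ 𝒜 i ∧ h ∉ x.asHomogeneousIdeal.toIdeal ∧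
      ∃ hU : Proj.basicOpen 𝒜 h ≤ U, ∀ y (hy : y ∈ Proj.basicOpen 𝒜 h),
        val s y (hU hy) = LocalizedModule.mk m ⟨h, hy⟩ := by
  obtain ⟨V, hxV, iV, i, m, h, hm, hh, w⟩ := (show sections 𝒜 ℳ U from s).2 ⟨x, hx⟩
  obtain ⟨_, ⟨f, rfl⟩, hxf, hfV⟩ :=
    (ProjectiveSpectrum.isTopologicalBasis_basic_opens 𝒜).exists_subset_of_mem_open hxV V.2
  obtain ⟨j, hj⟩ : ∃ j, ((DirectSum.decompose 𝒜 f j : 𝒜 j) : A) ∉ x.asHomogeneousIdeal := by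
    classical
    by_contra! hcon
    refine hxf ?_
    rw [← DirectSum.sum_support_decompose 𝒜 f]
    exact sum_mem fun j _ => hcon j
  have hjV : Proj.basicOpen 𝒜 ((DirectSum.decompose 𝒜 f j : 𝒜 j) : A) ≤ V := fun y hy =>
    hfV fun hyf => hy (y.asHomogeneousIdeal.isHomogeneous j hyf)
  set f' : A := ((DirectSum.decompose 𝒜 f j : 𝒜 j) : A)
  have hf' : f' ∈ 𝒜 j := SetLike.coe_mem _
  refine ⟨j + i, f' • m, f' * h, ?_, SetLike.mul_mem_graded hf' hh,
    x.asHomogeneousIdeal.toIdeal.primeCompl.mul_mem hj (w ⟨x, hxV⟩).1,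
    fun y hy => iV.le (hjV fun hy' => hy (Ideal.mul_mem_right _ _ hy')), fun y hy => ?_⟩
  · have := IsGradedModule.smul_mem (𝒜 := 𝒜) (ℳ := ℳ) hf' hm
    rwa [← Nat.cast_add] at this
  · have hyf' : f' ∉ y.asHomogeneousIdeal.toIdeal := fun hy' => hy (Ideal.mul_mem_right _ _ hy')
    obtain ⟨hyh, hyw⟩ := w ⟨y, hjV hyf'⟩
    refine hyw.trans ?_
    rw [LocalizedModule.mk_eq]
    exact ⟨1, by simp [Submonoid.smul_def, smul_smul, mul_comm]⟩

end Sections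

section Radical

variable {A : Type u} {σ : Type*} [CommRing A] [SetLike σ A] [AddSubmonoidClass σ A]
  {𝒜 : ℕ → σ} [GradedRing 𝒜]

/-- The homogeneous core of a prime containing `I` is a homogeneous prime containing `I`. If it
misses `f`, the positive degree of `f` shows that it does not contain the irrelevant ideal, so it is
a point of the projective spectrum. -/
lemma mem_radical_of_forall {I : Ideal A} (hI : I.IsHomogeneous 𝒜) {i : ℕ} (hi : i ≠ 0) {f : A}
    (hf : f ∈ 𝒜 i)
    (h : ∀ x : ProjectiveSpectrum 𝒜, I ≤ x.asHomogeneousIdeal.toIdeal →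
      f ∈ x.asHomogeneousIdeal.toIdeal) : f ∈ I.radical := by
  rw [Ideal.radical_eq_sInf]
  refine Ideal.mem_sInf.2 fun {p} hp => by_contra fun hfp => ?_
  have hle : I ≤ (p.homogeneousCore 𝒜).toIdeal := by
    have := (Ideal.homogeneousCore.gc 𝒜 ⟨I, hI⟩ p).1 hp.1
    exact this
  have hfp' : f ∉ (p.homogeneousCore 𝒜).toIdeal := fun h' =>
    hfp (Ideal.toIdeal_homogeneousCore_le 𝒜 p h')
  refine hfp' (h ⟨p.homogeneousCore 𝒜, hp.2.homogeneousCore, fun hirr => hfp' (hirr ?_)⟩ hle)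
  rw [HomogeneousIdeal.mem_irrelevant_iff, GradedRing.proj_apply]
  exact DirectSum.decompose_of_mem_ne 𝒜 hf hi

end Radical

section Annihilator

variable {A : Type u} {σ : Type*} [CommRing A] [SetLike σ A] [AddSubgroupClass σ A]
  {𝒜 : ℕ → σ} [GradedRing 𝒜] {M : Type u} [AddCommGroup M] [Module A M]
  {ℳ : ℤ → AddSubgroup M} [IsGradedModule 𝒜 ℳ] (P : GradedProj 𝒜 ℳ)

include P

lemma GradedProj.isHomogeneous_annihilator {k : ℤ} {m : M} (hm : m ∈ ℳ k) :
    (Ideal.torsionOf A M m).IsHomogeneous 𝒜 := by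
  intro i a ha
  have ha' : a • m = 0 := ha
  change ((DirectSum.decompose 𝒜 a i : 𝒜 i) : A) • m = 0
  rw [← P.proj_smul_of_mem hm, ha', map_zero]

/-- A homogeneous element whose germs vanish on the locus `f ≠ 0` is killed by a power of `f`. -/
lemma GradedProj.mem_radical_annihilator {k : ℤ} {m : M} (hm : m ∈ ℳ k) {i : ℕ} (hi : i ≠ 0)
    {f : A} (hf : f ∈ 𝒜 i) (h : ∀ x : ProjectiveSpectrum.top 𝒜,
      f ∉ x.asHomogeneousIdeal.toIdeal → (LocalizedModule.mk m 1 : Fiber 𝒜 M x) = 0) :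
    f ∈ (Ideal.torsionOf A M m).radical := by
  refine mem_radical_of_forall (P.isHomogeneous_annihilator hm) hi hf fun x hx =>
    by_contra fun hfx => ?_
  have h1 := h x hfx
  rw [← LocalizedModule.zero_mk 1, LocalizedModule.mk_eq] at h1
  obtain ⟨u, hu⟩ := h1
  refine u.2 (hx ?_)
  simpa [Submonoid.smul_def] using hu

end Annihilator

end GradedTilde

/-! ### Depth at the irrelevant ideal and the module of all sections. -/

namespace CanonicalSurface

open MvPolynomial GradedTilde

section Sections

variable {M : Type} [AddCommGroup M] [Module Coord M] {ℳ : ℤ → AddSubgroup M}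
  [IsGradedModule grading ℳ]

lemma X_mem_grading (i : Fin 5) : (X i : Coord) ∈ grading 1 :=
  (mem_homogeneousSubmodule _ _).2 (isHomogeneous_X _ _)

/-- A denominator of positive degree exists locally. -/
lemma exists_val_eq_mk_of_pos {U : P4.Opens} (s : Γ(gradedTilde grading ℳ, U))
    {x : ProjectiveSpectrum.top grading} (hx : x ∈ U) :
    ∃ (i : ℕ) (m : M) (h : Coord), i ≠ 0 ∧ m ∈ ℳ i ∧ h ∈ grading i ∧
      h ∉ x.asHomogeneousIdeal.toIdeal ∧
      ∃ hU : Proj.basicOpen grading h ≤ U, ∀ y (hy : y ∈ Proj.basicOpen grading h),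
        val s y (hU hy) = LocalizedModule.mk m ⟨h, hy⟩ := by
  obtain ⟨i, m, h, hm, hh, hhx, hU, hval⟩ := exists_val_eq_mk s hx
  obtain ⟨l, hl⟩ := exists_X_notMem x
  refine ⟨1 + i, (X l : Coord) • m, X l * h, by omega, ?_,
    SetLike.mul_mem_graded (X_mem_grading l) hh,
    x.asHomogeneousIdeal.toIdeal.primeCompl.mul_mem hl hhx,
    fun y hy => hU fun hy' => hy (Ideal.mul_mem_left _ _ hy'), fun y hy => ?_⟩
  · have := IsGradedModule.smul_mem (𝒜 := grading) (ℳ := ℳ) (X_mem_grading l) hm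
    rwa [← Nat.cast_add] at this
  · refine (hval y fun hy' => hy (Ideal.mul_mem_left _ _ hy')).trans ?_
    rw [LocalizedModule.mk_eq]
    exact ⟨1, by simp [Submonoid.smul_def, smul_smul, mul_comm]⟩

lemma decompose_zero_eq (a : Coord) :
    ((DirectSum.decompose grading a 0 : grading 0) : Coord) = C (eval 0 a) := by
  have : ((DirectSum.decompose grading a 0 : grading 0) : Coord) = homogeneousComponent 0 a :=
    MvPolynomial.decomposition.decompose'_apply a 0
  rw [this, homogeneousComponent_zero, eval_zero, constantCoeff_eq]

/-- Global sections of `M(j)~` come from `M` if `M` has depth at least two at the irrelevant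
ideal. -/
lemma exists_toGlobalSections_eq (P : GradedProj grading ℳ)
    (hdepth : ∀ {κ : Type} [Finite κ] (g : κ → Coord) (m : κ → M),
      (∀ i, X i ∈ (Ideal.span (Set.range g)).radical) → (∀ k l, g l • m k = g k • m l) →
      ∃ (a : Coord) (r : M), eval 0 a ≠ 0 ∧ ∀ k, g k • r = a • m k)
    (j : ℤ) (s : Γ(gradedTilde grading (shift ℳ j), ⊤)) :
    ∃ m : ℳ j, toGlobalSections grading ℳ j m = s := by
  have hloc := fun x : ProjectiveSpectrum.top grading =>
    exists_val_eq_mk_of_pos s (Opens.mem_top x)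
  choose i m h hi hm hh hhx _ hval using hloc
  -- Finitely many denominators generate the ideal of all of them, so their basic open sets still
  -- cover.
  obtain ⟨T, hT, hspan⟩ := (Submodule.fg_span_iff_fg_span_finset_subset (R := Coord)
    (Set.range h)).1 (IsNoetherian.noetherian _)
  have hT' : ∀ t : T, ∃ x, h x = t := fun t => hT t.2
  choose p hp using hT'
  have hcov (y : ProjectiveSpectrum.top grading) :
      ∃ t, h (p t) ∉ y.asHomogeneousIdeal.toIdeal := by
    by_contra! hcon
    have hle : Submodule.span Coord (T : Set Coord) ≤ y.asHomogeneousIdeal.toIdeal :=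
      Submodule.span_le.2 fun t ht => by
        have := hcon ⟨t, ht⟩
        rwa [hp] at this
    rw [← hspan] at hle
    exact hhx y (hle (Submodule.subset_span ⟨y, rfl⟩))
  -- On an overlap the two fractions agree in every stalk, so the cross difference of their
  -- numerators is killed by a power of the product of the denominators.
  have hann (t u : T) : ∃ N, (h (p t) * h (p u)) ^ N •
      (h (p u) • m (p t) - h (p t) • m (p u)) = 0 := by
    refine P.mem_radical_annihilator (k := j + i (p t) + i (p u)) ?_ (i := i (p t) + i (p u)) ?_
      (SetLike.mul_mem_graded (hh _) (hh _)) fun x hx => ?_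
    · refine sub_mem ?_ ?_
      · have := IsGradedModule.smul_mem (𝒜 := grading) (ℳ := ℳ) (hh (p u)) (hm (p t))
        rwa [add_comm] at this
      · have := IsGradedModule.smul_mem (𝒜 := grading) (ℳ := ℳ) (hh (p t)) (hm (p u))
        rwa [add_left_comm, ← add_assoc] at this
    · have := hi (p t)
      omega
    · have h1 := hval (p t) x fun hy => hx (Ideal.mul_mem_right _ _ hy)
      have h2 := hval (p u) x fun hy => hx (Ideal.mul_mem_left _ _ hy)
      have h3 := h1.symm.trans h2
      rw [LocalizedModule.mk_eq] at h3
      obtain ⟨v, hv⟩ := h3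
      rw [← LocalizedModule.zero_mk 1, LocalizedModule.mk_eq]
      refine ⟨v, ?_⟩
      simp only [Submonoid.smul_def, one_smul, smul_zero] at hv ⊢
      rw [smul_sub, hv, sub_self]
  choose N hN using hann
  obtain ⟨N₀, hN₀⟩ := (Set.finite_range fun z : T × T => N z.1 z.2).bddAbove
  have hN' (t u : T) : (h (p t) * h (p u)) ^ N₀ •
      (h (p u) • m (p t) - h (p t) • m (p u)) = 0 := by
    rw [← Nat.sub_add_cancel (hN₀ ⟨(t, u), rfl⟩ : N t u ≤ N₀), pow_add, mul_smul, hN, smul_zero]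
  -- Rewriting each fraction as `h ^ N₀ • m / h ^ (N₀ + 1)` makes the cross relations hold exactly,
  -- so depth two applies.
  obtain ⟨a, r, ha, hr⟩ := hdepth (fun t : T => h (p t) ^ (N₀ + 1))
    (fun t => h (p t) ^ N₀ • m (p t)) (fun l => by
      have h1 : X l ∈ (Ideal.span (Set.range h)).radical :=
        mem_radical_of_forall (Ideal.homogeneous_span _ _ (by
          rintro _ ⟨x, rfl⟩
          exact ⟨_, hh x⟩)) one_ne_zero (X_mem_grading l) fun x hx =>
          absurd (hx (Ideal.subset_span ⟨x, rfl⟩)) (hhx x)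
      have h2 : Ideal.span (Set.range h) ≤
          (Ideal.span (Set.range fun t : T => h (p t) ^ (N₀ + 1))).radical := by
        change Submodule.span Coord (Set.range h) ≤ _
        rw [hspan]
        refine Submodule.span_le.2 fun t ht => ⟨N₀ + 1, ?_⟩
        have : h (p ⟨t, ht⟩) ^ (N₀ + 1) ∈
            Ideal.span (Set.range fun t : T => h (p t) ^ (N₀ + 1)) :=
          Ideal.subset_span ⟨⟨t, ht⟩, rfl⟩
        rwa [hp] at this
      have h3 := Ideal.radical_mono h2 h1
      rwa [Ideal.radical_idem] at h3) (fun t u => by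
      have h1 := hN' t u
      rw [smul_sub, sub_eq_zero, smul_smul, smul_smul] at h1
      rw [smul_smul, smul_smul]
      convert h1 using 2 <;> ring)
  have hC (c : ℂ) : C c ∈ grading 0 := (mem_homogeneousSubmodule _ _).2 (isHomogeneous_C _ _)
  -- Only the constant term of `a` contributes in the relevant degree. Taking the component of `r`
  -- of degree `j` and dividing by that nonzero constant gives the global element.
  have hmem : (C (eval 0 a)⁻¹ : Coord) • P.proj j r ∈ ℳ j := by
    have := IsGradedModule.smul_mem (𝒜 := grading) (ℳ := ℳ) (hC (eval 0 a)⁻¹) (P.proj_mem j r)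
    simpa using this
  have hr' (t : T) : h (p t) ^ (N₀ + 1) • (C (eval 0 a)⁻¹ : Coord) • P.proj j r =
      h (p t) ^ N₀ • m (p t) := by
    have h1 : h (p t) ^ (N₀ + 1) ∈ grading ((N₀ + 1) • i (p t)) :=
      SetLike.pow_mem_graded _ (hh (p t))
    have h2 : h (p t) ^ N₀ • m (p t) ∈ ℳ ((N₀ • i (p t) : ℕ) + (j + i (p t))) :=
      IsGradedModule.smul_mem (𝒜 := grading) (ℳ := ℳ) (SetLike.pow_mem_graded N₀ (hh (p t)))
        (hm (p t))
    have h3 := P.proj_smul_of_mem h2 0 a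
    rw [← hr t, decompose_zero_eq] at h3
    have h4 : ((0 : ℕ) : ℤ) + ((N₀ • i (p t) : ℕ) + (j + i (p t))) =
        ((N₀ + 1) • i (p t) : ℕ) + j := by
      simp only [smul_eq_mul]
      push_cast
      ring
    rw [h4, P.proj_smul h1] at h3
    rw [smul_comm, h3, smul_smul, ← C_mul, inv_mul_cancel₀ ha, C_1, one_smul]
  refine ⟨⟨_, hmem⟩, val_ext fun y hy => ?_⟩
  obtain ⟨t, ht⟩ := hcov y
  refine Eq.trans ?_ (hval (p t) y ht).symm
  change LocalizedModule.mk _ _ = _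
  rw [LocalizedModule.mk_eq]
  refine ⟨⟨h (p t) ^ N₀, y.asHomogeneousIdeal.toIdeal.primeCompl.pow_mem ht N₀⟩, ?_⟩
  have := hr' t
  rw [pow_succ, mul_smul] at this
  simpa [Submonoid.smul_def] using this

lemma toGlobalSections_injective (P : GradedProj grading ℳ)
    (hdepth : ∀ m : M, (∀ i, X i ∈ (Ideal.torsionOf Coord M m).radical) → m = 0) (j : ℤ) :
    Function.Injective (toGlobalSections grading ℳ j) := by
  rw [injective_iff_map_eq_zero]
  intro m hm
  refine Subtype.ext (hdepth m fun i => ?_)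
  exact P.mem_radical_annihilator m.2 one_ne_zero (X_mem_grading i) fun x _ =>
    congrArg (fun s => val s x (Opens.mem_top x)) hm

lemma smul_gammaStar_of {i : ℕ} {j : ℤ} {a : Coord} (ha : a ∈ grading i) (m : ℳ j) :
    a • GammaStar.of grading ℳ j (toGlobalSections grading ℳ j m) =
      GammaStar.of grading ℳ (i + j) (toGlobalSections grading ℳ (i + j)
        ⟨a • m.1, IsGradedModule.smul_mem (𝒜 := grading) ha m.2⟩) := by
  let _ := natTranslation
  refine (congrArg (fun z => DirectSum.Gmodule.smulAddMonoidHom (fun i => grading i)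
    (fun j : ℤ => sections grading (shift ℳ j) ⊤) z
      (DirectSum.of (fun j : ℤ => sections grading (shift ℳ j) ⊤) j
        (toGlobalSections grading ℳ j m))) (DirectSum.decompose_of_mem grading ha)).trans ?_
  refine (DirectSum.Gmodule.smulAddMonoidHom_apply_of_of (fun i => grading i)
    (fun j : ℤ => sections grading (shift ℳ j) ⊤) _ _).trans ?_
  refine congrArg (DirectSum.of (fun j : ℤ => sections grading (shift ℳ j) ⊤) (i + j)) ?_
  refine Subtype.ext (funext fun x => ?_)
  exact LocalizedModule.smul'_mk _ _ _

/-- A graded module of depth at least two at the irrelevant ideal is the module of sections of the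
associated sheaf. -/
theorem exists_linearEquiv_gammaStar (P : GradedProj grading ℳ)
    (hdepth₁ : ∀ m : M, (∀ i, X i ∈ (Ideal.torsionOf Coord M m).radical) → m = 0)
    (hdepth₂ : ∀ {κ : Type} [Finite κ] (g : κ → Coord) (m : κ → M),
      (∀ i, X i ∈ (Ideal.span (Set.range g)).radical) → (∀ k l, g l • m k = g k • m l) →
      ∃ (a : Coord) (r : M), eval 0 a ≠ 0 ∧ ∀ k, g k • r = a • m k) :
    ∃ e : M ≃ₗ[Coord] GammaStar grading ℳ, ∀ (j : ℤ) (m : ℳ j),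
      e m = GammaStar.of grading ℳ j (toGlobalSections grading ℳ j m) := by
  let E (j : ℤ) : ℳ j ≃+ Γ(gradedTilde grading (shift ℳ j), ⊤) :=
    AddEquiv.ofBijective (toGlobalSections grading ℳ j)
      ⟨toGlobalSections_injective P hdepth₁ j, exists_toGlobalSections_eq P hdepth₂ j⟩
  -- Maps out of a direct sum are given summand by summand, so the inverse of the natural map is the
  -- one that is built.
  let ψ : GammaStar grading ℳ →+ M :=
    DirectSum.toAddMonoid fun j => (ℳ j).subtype.comp (E j).symm.toAddMonoidHom
  have hψ (j : ℤ) (m : ℳ j) :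
      ψ (GammaStar.of grading ℳ j (toGlobalSections grading ℳ j m)) = m := by
    refine (DirectSum.toAddMonoid_of _ _ _).trans ?_
    exact congrArg Subtype.val ((E j).symm_apply_apply m)
  have hind {p : GammaStar grading ℳ → Prop} (h0 : p 0)
      (hof : ∀ (j : ℤ) (m : ℳ j), p (GammaStar.of grading ℳ j (toGlobalSections grading ℳ j m)))
      (hadd : ∀ y z, p y → p z → p (y + z)) (z : GammaStar grading ℳ) : p z := by
    refine DirectSum.induction_on z h0 (fun j s => ?_) hadd
    obtain ⟨m, rfl⟩ := (E j).surjective s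
    exact hof j m
  have hsmul (a : Coord) (z : GammaStar grading ℳ) : ψ (a • z) = a • ψ z := by
    induction z using hind with
    | h0 => rw [smul_zero, map_zero, smul_zero]
    | hadd y z hy hz => rw [smul_add, map_add, map_add, smul_add, hy, hz]
    | hof j m =>
      classical
      rw [← DirectSum.sum_support_decompose grading a, Finset.sum_smul, map_sum, Finset.sum_smul]
      refine Finset.sum_congr rfl fun i _ => ?_
      rw [smul_gammaStar_of (SetLike.coe_mem _), hψ, hψ]
  -- Homogeneous components in `M` recover the summands of `z`, which gives injectivity of `ψ`.
  have hproj (z : GammaStar grading ℳ) (j : ℤ) :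
      P.proj j (ψ z) = (E j).symm (DFinsupp.toFun z j) := by
    induction z using hind with
    | h0 =>
      rw [map_zero, map_zero]
      exact congrArg Subtype.val (map_zero (E j).symm).symm
    | hadd y z hy hz =>
      rw [map_add, map_add, hy, hz]
      exact congrArg Subtype.val (map_add (E j).symm _ _).symm
    | hof k m =>
      rw [hψ]
      change _ = (((E j).symm ((DirectSum.of
        (fun j => Γ(gradedTilde grading (shift ℳ j), ⊤)) k (E k m)) j) : ℳ j) : M)
      rcases eq_or_ne j k with rfl | hjk
      · rw [DirectSum.of_eq_same, AddEquiv.symm_apply_apply, P.proj_same m.2]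
      · rw [DirectSum.of_eq_of_ne _ _ _ hjk, map_zero, P.proj_ne m.2 hjk]
        rfl
  have hinj : Function.Injective ψ := by
    rw [injective_iff_map_eq_zero]
    intro z hz
    refine DFinsupp.ext fun j => ?_
    have h1 := hproj z j
    rw [hz, map_zero] at h1
    exact (map_eq_zero_iff (E j).symm (E j).symm.injective).1 (Subtype.ext h1.symm)
  have hsurj : Function.Surjective ψ := by
    intro m
    obtain ⟨s, -, hs⟩ := P.exists_sum m
    refine ⟨∑ k ∈ s, GammaStar.of grading ℳ k
      (toGlobalSections grading ℳ k ⟨P.proj k m, P.proj_mem k m⟩), ?_⟩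
    rw [map_sum]
    simp only [hψ, hs]
  let e := (LinearEquiv.ofBijective (⟨ψ.toAddHom, hsmul⟩ : GammaStar grading ℳ →ₗ[Coord] M)
    ⟨hinj, hsurj⟩).symm
  exact ⟨e, fun j m => (LinearEquiv.symm_apply_eq _).2 (hψ j m).symm⟩

end Sections

end CanonicalSurface

/-! ### A local criterion for reflexivity. -/

namespace AlgebraicGeometry.Scheme.Modules

universe u

variable {X : Scheme.{u}}

/-- A criterion for a sheaf of modules `F` to be reflexive with respect to `G`. -/
lemma isIso_toDoubleHom (F G : X.Modules)
    (hinj : ∀ (U : X.Opens) (s : Γ(F, U)), (∀ (V : X.Opens) (hV : V ≤ U)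
      (φ : Γ(sheafHom F G, V)), evalSection F G (F.res hV s) φ = 0) → s = 0)
    (hsurj : ∀ (U : X.Opens) (Ψ : homOn (sheafHom F G) G U) (x : U), ∃ (V : X.Opens) (hV : V ≤ U)
      (s : Γ(F, V)), x.1 ∈ V ∧ ∀ (W : X.Opens) (hW : W ≤ V) (φ : Γ(sheafHom F G, W)),
        evalSection F G (F.res hW s) φ = Ψ.1 ⟨W, hW.trans hV⟩ φ) :
    IsIso (toDoubleHom F G) := by
  rw [Hom.isIso_iff_isIso_app]
  intro U
  rw [ConcreteCategory.isIso_iff_bijective]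
  change Function.Bijective (evalHom F G U)
  have hsub {V W : X.Opens} (h : W ≤ V) (s t : Γ(F, V)) : F.res h (s - t) = F.res h s - F.res h t :=
    map_sub _ _ _
  have hevalsub {V : X.Opens} (s t : Γ(F, V)) (φ : Γ(sheafHom F G, V)) :
      evalSection F G (s - t) φ = evalSection F G s φ - evalSection F G t φ :=
    map_sub ((homSections F G V φ).1 ⟨V, le_rfl⟩) s t
  constructor
  · rw [injective_iff_map_eq_zero]
    intro s hs
    exact hinj U s fun V hV φ => LinearMap.congr_fun (congrFun (congrArg Subtype.val hs) ⟨V, hV⟩) φ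
  · intro Ψ
    choose V hV t hxV ht using hsurj U Ψ
    have hcov {W : X.Opens} (hW : W ≤ U) : W ≤ ⨆ x, W ⊓ V x := fun x hx =>
      Opens.mem_iSup.2 ⟨⟨x, hW hx⟩, hx, hxV _⟩
    -- A section is determined by its evaluations, so local sections representing the same `Ψ` agree
    -- on overlaps and glue.
    obtain ⟨s, hs⟩ := F.exists_glue V hV (fun x hx => Opens.mem_iSup.2 ⟨⟨x, hx⟩, hxV _⟩) t
      fun x y => by
        refine sub_eq_zero.1 (hinj _ _ fun W hW φ => ?_)
        rw [hsub, hevalsub, res_res, res_res, ht x W (hW.trans inf_le_left),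
          ht y W (hW.trans inf_le_right), sub_self]
    refine ⟨s, Subtype.ext (funext fun W => LinearMap.ext fun φ => ?_)⟩
    refine G.eq_of_res_eq (fun x => W.1 ⊓ V x) (fun x => inf_le_left) (hcov W.2) _ _ fun x => ?_
    refine ((evalHom F G U s).2 W ⟨W.1 ⊓ V x, inf_le_left.trans W.2⟩ inf_le_left φ).trans ?_
    refine Eq.trans ?_ (Ψ.2 W ⟨W.1 ⊓ V x, inf_le_left.trans W.2⟩ inf_le_left φ).symm
    refine Eq.trans ?_ (ht x (W.1 ⊓ V x) inf_le_right _)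
    rw [← hs x, res_res]
    rfl

end AlgebraicGeometry.Scheme.Modules

/-! ### Auxiliary facts on localized modules and sections of sheaf Hom. -/

namespace LocalizedModule

variable {A : Type*} [CommRing A] {S : Submonoid A} {M N : Type*} [AddCommGroup M] [Module A M]
  [AddCommGroup N] [Module A N]

lemma localizationMk_smul (a : A) (s : S) (z : LocalizedModule S M) :
    Localization.mk a s • z = Localization.mk 1 s • a • z := by
  induction z using LocalizedModule.induction_on with
  | h m t => rw [smul'_mk, mk_smul_mk, mk_smul_mk, one_smul]

lemma localizationMk_one_smul_injective (s : S) :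
    Function.Injective fun z : LocalizedModule S M => Localization.mk (1 : A) s • z := by
  intro z w h
  have key (z : LocalizedModule S M) : (s : A) • (Localization.mk (1 : A) s • z) = z := by
    induction z using LocalizedModule.induction_on with
    | h m t =>
      rw [mk_smul_mk, smul'_mk, one_smul, mk_eq]
      exact ⟨1, by simp [Submonoid.smul_def, smul_smul, mul_comm]⟩
  rw [← key z, ← key w]
  exact congrArg _ h

lemma mk_eq_zero_iff {m : M} {s : S} : mk m s = 0 ↔ ∃ u ∈ S, u • m = 0 := by
  rw [← zero_mk s, mk_eq]
  constructor
  · rintro ⟨u, hu⟩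
    refine ⟨u * s, S.mul_mem u.2 s.2, ?_⟩
    simpa [Submonoid.smul_def, smul_smul] using hu
  · rintro ⟨u, hu, h⟩
    refine ⟨⟨u, hu⟩, ?_⟩
    rw [smul_zero, smul_zero, smul_comm, Submonoid.smul_def ⟨u, hu⟩, h, smul_zero]

lemma map_map_of_comp_eq_smul {θ : M →ₗ[A] N} {e : N →ₗ[A] M} {g : A} (h : ∀ m, e (θ m) = g • m)
    (z : LocalizedModule S M) : map S e (map S θ z) = g • z := by
  induction z using LocalizedModule.induction_on with
  | h m t => rw [map_mk, map_mk, h, smul'_mk]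

/-- With finitely many `g k`, the product of the local witnesses lets the hypothesis on `M` act on a
single numerator. -/
lemma eq_zero_of_forall_smul {κ : Type*} [Finite κ] {g : κ → A}
    (hM : ∀ m : M, (∀ k, g k • m = 0) → m = 0) {z : LocalizedModule S M}
    (hz : ∀ k, g k • z = 0) : z = 0 := by
  cases nonempty_fintype κ
  induction z using LocalizedModule.induction_on with
  | h m t =>
    simp only [smul'_mk, mk_eq_zero_iff] at hz
    choose u hu huz using hz
    refine mk_eq_zero_iff.2 ⟨∏ k, u k, S.prod_mem fun k _ => hu k, hM _ fun k => ?_⟩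
    classical
    rw [← Finset.prod_erase_mul _ _ (Finset.mem_univ k), mul_smul, smul_comm, smul_comm (g k),
      huz, smul_zero]

end LocalizedModule

namespace AlgebraicGeometry.Scheme.Modules

universe u

variable {X : Scheme.{u}} {F G : X.Modules}

/-- The action of a section of `ℋom(F, G)` on sections of `F` over a smaller open set. -/
noncomputable def homApp {U : X.Opens} (φ : Γ(sheafHom F G, U)) {V : X.Opens} (h : V ≤ U) (s : Γ(F, V)) :
    Γ(G, V) :=
  (homSections F G U φ).1 ⟨V, h⟩ s

lemma res_homApp {U : X.Opens} (φ : Γ(sheafHom F G, U)) {V W : X.Opens} (h : V ≤ U) (hW : W ≤ V)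
    (s : Γ(F, V)) : G.res hW (homApp φ h s) = homApp φ (hW.trans h) (F.res hW s) :=
  (homSections F G U φ).2 ⟨V, h⟩ ⟨W, hW.trans h⟩ hW s

lemma homApp_smul {U : X.Opens} (φ : Γ(sheafHom F G, U)) {V : X.Opens} (h : V ≤ U) (r : Γ(X, V))
    (s : Γ(F, V)) : homApp φ h (r • s) = r • homApp φ h s :=
  LinearMap.map_smul ((homSections F G U φ).1 ⟨V, h⟩) r s

lemma homApp_ext {U : X.Opens} {φ ψ : Γ(sheafHom F G, U)}
    (h : ∀ (V : X.Opens) (hV : V ≤ U) (s : Γ(F, V)), homApp φ hV s = homApp ψ hV s) : φ = ψ :=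
  (homSections F G U).injective (Subtype.ext (funext fun V => LinearMap.ext fun s => h V.1 V.2 s))

end AlgebraicGeometry.Scheme.Modules

/-! ### Fractions of graded maps as homomorphisms of sheaves, and conductor data. -/

namespace GradedTilde

open Scheme.Modules

universe u

variable {A : Type u} {σ : Type*} [CommRing A] [SetLike σ A] [AddSubgroupClass σ A]
  {𝒜 : ℕ → σ} [GradedRing 𝒜] {M N : Type u} [AddCommGroup M] [Module A M]
  [AddCommGroup N] [Module A N]
  {ℳ : ℤ → AddSubgroup M} [IsGradedModule 𝒜 ℳ] {𝒩 : ℤ → AddSubgroup N} [IsGradedModule 𝒜 𝒩]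

variable (𝒜) in
/-- The homomorphism `θ / t` on the localizations at a point where `t` does not vanish. -/
noncomputable def fiberFraction (θ : M →ₗ[A] N) {t : A} (y : ProjectiveSpectrum.top 𝒜)
    (ht : t ∉ y.asHomogeneousIdeal.toIdeal) :
    Fiber 𝒜 M y →ₗ[Localization y.asHomogeneousIdeal.toIdeal.primeCompl] Fiber 𝒜 N y :=
  (Localization.mk 1 ⟨t, ht⟩ : Localization y.asHomogeneousIdeal.toIdeal.primeCompl) •
    LocalizedModule.map _ θ

lemma fiberFraction_apply (θ : M →ₗ[A] N) {t : A} (y : ProjectiveSpectrum.top 𝒜)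
    (ht : t ∉ y.asHomogeneousIdeal.toIdeal) (z : Fiber 𝒜 M y) : fiberFraction 𝒜 θ y ht z =
      (Localization.mk 1 ⟨t, ht⟩ : Localization y.asHomogeneousIdeal.toIdeal.primeCompl) •
        LocalizedModule.map _ θ z := rfl

lemma fiberFraction_mk (θ : M →ₗ[A] N) {t h : A} (y : ProjectiveSpectrum.top 𝒜)
    (ht : t ∉ y.asHomogeneousIdeal.toIdeal) (hh : h ∉ y.asHomogeneousIdeal.toIdeal) (m : M) :
    fiberFraction 𝒜 θ y ht (LocalizedModule.mk m ⟨h, hh⟩) =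
      LocalizedModule.mk (θ m) ⟨t * h, y.asHomogeneousIdeal.toIdeal.primeCompl.mul_mem ht hh⟩ := by
  rw [fiberFraction_apply, LocalizedModule.map_mk, LocalizedModule.mk_smul_mk, one_smul]
  rfl

lemma fiberFraction_mem {d : ℕ} {θ : M →ₗ[A] N} (hθ : ∀ k, ∀ m ∈ ℳ k, θ m ∈ 𝒩 (k + d))
    {t : A} (ht : t ∈ 𝒜 d) {V : (Proj 𝒜).Opens} (hV : V ≤ Proj.basicOpen 𝒜 t)
    (s : Γ(gradedTilde 𝒜 ℳ, V)) :
    (fun y : V => fiberFraction 𝒜 θ y.1 (hV y.2) (val s y.1 y.2)) ∈ sections 𝒜 𝒩 V := by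
  intro x
  obtain ⟨i, m, h, hm, hh, hhx, hU, hval⟩ := exists_val_eq_mk s x.2
  refine ⟨Proj.basicOpen 𝒜 h, hhx, homOfLE hU, d + i, θ m, t * h, ?_, SetLike.mul_mem_graded ht hh,
    fun y => ⟨Submonoid.mul_mem (Ideal.primeCompl _) (hV (hU y.2)) y.2, ?_⟩⟩
  · have := hθ _ m hm
    rwa [add_comm, ← Nat.cast_add] at this
  · exact (congrArg (fiberFraction 𝒜 θ y.1 (hV (hU y.2))) (hval y.1 y.2)).trans
      (fiberFraction_mk ..)

/-- The homomorphism `θ / t : M~ → N~` on the open set where `t` does not vanish. -/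
noncomputable def fractionHom {d : ℕ} {θ : M →ₗ[A] N} (hθ : ∀ k, ∀ m ∈ ℳ k, θ m ∈ 𝒩 (k + d))
    {t : A} (ht : t ∈ 𝒜 d) {U : (Proj 𝒜).Opens} (hU : U ≤ Proj.basicOpen 𝒜 t) :
    Γ(sheafHom (gradedTilde 𝒜 ℳ) (gradedTilde 𝒜 𝒩), U) :=
  (homSections _ _ U).symm ⟨fun V =>
    { toFun := fun s => show sections 𝒜 𝒩 V.1 from ⟨_, fiberFraction_mem hθ ht (V.2.trans hU) s⟩
      map_add' := fun _ _ => val_ext fun y _ => map_add (fiberFraction 𝒜 θ y _) _ _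
      map_smul' := fun r s => val_ext fun y hy =>
        LinearMap.map_smul (fiberFraction 𝒜 θ y (hU (V.2 hy)))
          ((show (ProjectiveSpectrum.Proj.structureSheaf 𝒜).1.obj (op V.1) from r).1 ⟨y, hy⟩).val
          (val s y hy) }, fun _ _ _ _ => rfl⟩

end GradedTilde

namespace GradedTilde

open Scheme.Modules

universe u

section CommonDenominator

variable {A : Type u} {σ : Type*} [CommRing A] [SetLike σ A] [AddSubgroupClass σ A]
  {𝒜 : ℕ → σ} [GradedRing 𝒜] {N : Type u} [AddCommGroup N] [Module A N]
  {𝒩 : ℤ → AddSubgroup N} [IsGradedModule 𝒜 𝒩]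

lemma exists_common_denominator {κ : Type*} [Finite κ] [Nonempty κ] {U : (Proj 𝒜).Opens}
    (s : κ → Γ(gradedTilde 𝒜 𝒩, U)) {x : ProjectiveSpectrum.top 𝒜} (hx : x ∈ U) :
    ∃ (i : ℕ) (m : κ → N) (h : A), (∀ k, m k ∈ 𝒩 i) ∧ h ∈ 𝒜 i ∧
      h ∉ x.asHomogeneousIdeal.toIdeal ∧
      ∃ hU : Proj.basicOpen 𝒜 h ≤ U, ∀ k y (hy : y ∈ Proj.basicOpen 𝒜 h),
        val (s k) y (hU hy) = LocalizedModule.mk (m k) ⟨h, hy⟩ := by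
  classical
  cases nonempty_fintype κ
  have hloc := fun k => exists_val_eq_mk (s k) hx
  choose i m h hm hh hhx hU hval using hloc
  have hdvd (k : κ) : h k ∣ ∏ l, h l := Finset.dvd_prod_of_mem _ (Finset.mem_univ k)
  have hle (k : κ) : Proj.basicOpen 𝒜 (∏ l, h l) ≤ Proj.basicOpen 𝒜 (h k) := fun y hy hy' =>
    hy (Ideal.mem_of_dvd _ (hdvd k) hy')
  refine ⟨∑ k, i k, fun k => (∏ l ∈ Finset.univ.erase k, h l) • m k, ∏ k, h k, fun k => ?_,
    SetLike.prod_mem_graded _ _ _ fun k _ => hh k,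
    x.asHomogeneousIdeal.toIdeal.primeCompl.prod_mem fun k _ => hhx k,
    (hle (Classical.arbitrary κ)).trans (hU _), fun k y hy => ?_⟩
  · have := IsGradedModule.smul_mem (𝒜 := 𝒜) (ℳ := 𝒩)
      (SetLike.prod_mem_graded (F := Finset.univ.erase k) 𝒜 i h fun l _ => hh l) (hm k)
    rwa [← Nat.cast_add, Finset.sum_erase_add _ _ (Finset.mem_univ k)] at this
  · rw [hval k y (hle k hy), LocalizedModule.mk_eq]
    refine ⟨1, ?_⟩
    simp only [Submonoid.smul_def, one_smul, smul_smul]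
    rw [Finset.mul_prod_erase _ _ (Finset.mem_univ k)]

end CommonDenominator

variable {A : Type u} {σ : Type*} [CommRing A] [SetLike σ A] [AddSubgroupClass σ A]
  (𝒜 : ℕ → σ) [GradedRing 𝒜] {M N : Type u} [AddCommGroup M] [Module A M]
  [AddCommGroup N] [Module A N] (ℳ : ℤ → AddSubgroup M) (𝒩 : ℤ → AddSubgroup N)

/-- A graded cyclic module `N` embedded in a graded module `M`, and homogeneous elements `g k` of
degree `d` that multiply `M` into `N`, such that `M` has depth at least two along the `g k`. -/
structure ConductorData (κ : Type*) where
  /-- The embedding. -/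
  e : N →ₗ[A] M
  e_injective : Function.Injective e
  e_mem : ∀ k, ∀ n ∈ 𝒩 k, e n ∈ ℳ k
  /-- The degree of the multipliers. -/
  d : ℕ
  /-- The multipliers. -/
  g : κ → A
  g_mem : ∀ k, g k ∈ 𝒜 d
  /-- Multiplication by `g k`, as a map to `N`. -/
  θ : κ → M →ₗ[A] N
  θ_mem : ∀ k, ∀ i, ∀ m ∈ ℳ i, θ k m ∈ 𝒩 (i + d)
  e_θ : ∀ k m, e (θ k m) = g k • m
  /-- The generator of `N`. -/
  one : N
  one_mem : one ∈ 𝒩 0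
  exists_smul_one : ∀ i : ℕ, ∀ n ∈ 𝒩 i, ∃ a ∈ 𝒜 i, a • one = n
  eq_zero : ∀ m : M, (∀ k, g k • m = 0) → m = 0
  exists_smul_eq : ∀ (x : ProjectiveSpectrum 𝒜) (c : ℤ) (m : κ → M), (∀ k, m k ∈ ℳ (c + d)) →
    ∀ u ∉ x.asHomogeneousIdeal.toIdeal, (∀ k l, u • g l • m k = u • g k • m l) →
    ∃ (i : ℕ) (h : A) (r : M), h ∈ 𝒜 i ∧ h ∉ x.asHomogeneousIdeal.toIdeal ∧ r ∈ ℳ (i + c) ∧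
      ∀ k, g k • r = h • m k
  exists_notMem : ∀ x : ProjectiveSpectrum 𝒜, ∃ t ∈ 𝒜 d, t ∉ x.asHomogeneousIdeal.toIdeal

namespace ConductorData

variable {𝒜 ℳ 𝒩} {κ : Type*} (D : ConductorData 𝒜 ℳ 𝒩 κ)

include D

lemma eq_zero' (n : N) (hn : ∀ k, D.g k • n = 0) : n = 0 :=
  D.e_injective <| (D.eq_zero _ fun k => by rw [← LinearMap.map_smul, hn, map_zero]).trans (map_zero _).symm

/-- After the embedding into `M`, both sides are multiplication by `g k` and `g l` in succession. -/
lemma smul_θ (k l : κ) : D.g l • D.θ k = D.g k • D.θ l :=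
  LinearMap.ext fun m => D.e_injective <| by
    rw [LinearMap.smul_apply, LinearMap.smul_apply, LinearMap.map_smul, LinearMap.map_smul, D.e_θ, D.e_θ, smul_comm]

lemma smul_fiberFraction {y : ProjectiveSpectrum.top 𝒜} {t : A}
    (hty : t ∉ y.asHomogeneousIdeal.toIdeal) (z : Fiber 𝒜 M y) (k l : κ) :
    (Localization.mk (D.g l) ⟨t, hty⟩ : Localization y.asHomogeneousIdeal.toIdeal.primeCompl) •
      fiberFraction 𝒜 (D.θ k) y hty z =
    (Localization.mk (D.g k) ⟨t, hty⟩ : Localization y.asHomogeneousIdeal.toIdeal.primeCompl) •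
      fiberFraction 𝒜 (D.θ l) y hty z := by
  obtain ⟨m, p, hp, rfl⟩ : ∃ (m : M) (p : A) (hp : p ∉ y.asHomogeneousIdeal.toIdeal),
      z = LocalizedModule.mk m ⟨p, hp⟩ := by
    induction z using LocalizedModule.induction_on with
    | h m p => exact ⟨m, p.1, p.2, rfl⟩
  rw [fiberFraction_mk, fiberFraction_mk, LocalizedModule.mk_smul_mk, LocalizedModule.mk_smul_mk,
    ← LinearMap.smul_apply, ← LinearMap.smul_apply, D.smul_θ]

lemma smul_mk_eq {y : ProjectiveSpectrum.top 𝒜} {t p h : A}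
    (hty : t ∉ y.asHomogeneousIdeal.toIdeal) (hpy : p ∉ y.asHomogeneousIdeal.toIdeal)
    (hhy : h ∉ y.asHomogeneousIdeal.toIdeal) {b c : A} {m : M} {k : κ}
    (hc : c • D.one = D.θ k m) :
    (Localization.mk c ⟨t * p, y.asHomogeneousIdeal.toIdeal.primeCompl.mul_mem hty hpy⟩ :
      Localization y.asHomogeneousIdeal.toIdeal.primeCompl) •
        LocalizedModule.mk (b • D.one) ⟨h, hhy⟩ =
      (Localization.mk b ⟨h, hhy⟩ : Localization y.asHomogeneousIdeal.toIdeal.primeCompl) •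
        fiberFraction 𝒜 (D.θ k) y hty (LocalizedModule.mk m ⟨p, hpy⟩) := by
  rw [fiberFraction_mk, LocalizedModule.mk_smul_mk, LocalizedModule.mk_smul_mk, ← hc, smul_comm,
    mul_comm]

lemma smul_mk_one {y : ProjectiveSpectrum.top 𝒜} {t p : A}
    (hty : t ∉ y.asHomogeneousIdeal.toIdeal) (hpy : p ∉ y.asHomogeneousIdeal.toIdeal)
    {c : A} {m : M} {k : κ} (hc : c • D.one = D.θ k m) :
    (Localization.mk (D.g k) ⟨t, hty⟩ : Localization y.asHomogeneousIdeal.toIdeal.primeCompl) •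
      LocalizedModule.mk m ⟨p, hpy⟩ =
    (Localization.mk c ⟨t * p, y.asHomogeneousIdeal.toIdeal.primeCompl.mul_mem hty hpy⟩ :
      Localization y.asHomogeneousIdeal.toIdeal.primeCompl) •
        (LocalizedModule.mk (D.e D.one) 1 : Fiber 𝒜 M y) := by
  rw [LocalizedModule.mk_smul_mk, LocalizedModule.mk_smul_mk, ← D.e_θ, ← hc, LinearMap.map_smul,
    mul_one]
  rfl

/-- Composing `θ k` with the embedding is multiplication by `g k`, so every `g k` kills `z`. -/
lemma eq_zero_of_fiberFraction [Finite κ] {y : ProjectiveSpectrum.top 𝒜} {t : A}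
    (hty : t ∉ y.asHomogeneousIdeal.toIdeal) {z : Fiber 𝒜 M y}
    (hz : ∀ k, fiberFraction 𝒜 (D.θ k) y hty z = 0) : z = 0 := by
  refine LocalizedModule.eq_zero_of_forall_smul D.eq_zero fun k => ?_
  have h : LocalizedModule.map _ (D.θ k) z = 0 :=
    LocalizedModule.localizationMk_one_smul_injective _ ((hz k).trans (smul_zero _).symm)
  rw [← LocalizedModule.map_map_of_comp_eq_smul (D.e_θ k), h, map_zero]

lemma eq_of_smul_eq [Finite κ] {y : ProjectiveSpectrum.top 𝒜} {t : A}
    (hty : t ∉ y.asHomogeneousIdeal.toIdeal) {z w : Fiber 𝒜 N y}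
    (h : ∀ k, (Localization.mk (D.g k) ⟨t, hty⟩ :
      Localization y.asHomogeneousIdeal.toIdeal.primeCompl) • z =
      (Localization.mk (D.g k) ⟨t, hty⟩ :
        Localization y.asHomogeneousIdeal.toIdeal.primeCompl) • w) : z = w := by
  refine sub_eq_zero.1 (LocalizedModule.eq_zero_of_forall_smul D.eq_zero' fun k => ?_)
  have := h k
  rw [LocalizedModule.localizationMk_smul, LocalizedModule.localizationMk_smul (D.g k)] at this
  rw [smul_sub, sub_eq_zero]
  exact LocalizedModule.localizationMk_one_smul_injective _ this

variable [IsGradedModule 𝒜 ℳ] [IsGradedModule 𝒜 𝒩]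

/-- The homomorphism `g k / t : M~ → N~`. -/
noncomputable def hom {t : A} (ht : t ∈ 𝒜 D.d) {U : (Proj 𝒜).Opens} (hU : U ≤ Proj.basicOpen 𝒜 t)
    (k : κ) : Γ(sheafHom (gradedTilde 𝒜 ℳ) (gradedTilde 𝒜 𝒩), U) :=
  fractionHom (D.θ_mem k) ht hU

/-- The section of `M~` defined by the generator of `N`. -/
noncomputable def oneSection (U : (Proj 𝒜).Opens) : Γ(gradedTilde 𝒜 ℳ, U) :=
  mkSection (i := 0) (D.e_mem 0 _ D.one_mem) SetLike.GradedOne.one_mem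
    (le_top.trans (Proj.basicOpen_one 𝒜).ge)

lemma smul_hom {t : A} (ht : t ∈ 𝒜 D.d) {U : (Proj 𝒜).Opens} (hU : U ≤ Proj.basicOpen 𝒜 t)
    (k l : κ) : mkFunction (D.g_mem l) ht hU • D.hom ht hU k =
      mkFunction (D.g_mem k) ht hU • D.hom ht hU l := by
  exact homApp_ext fun V hV s => val_ext fun y hy =>
    D.smul_fiberFraction (hU (hV hy)) (val s y hy) k l

/-- Sections of `M~` killed by all homomorphisms to `N~` vanish. -/
lemma eq_zero_of_evalSection [Finite κ] {U : (Proj 𝒜).Opens} {s : Γ(gradedTilde 𝒜 ℳ, U)}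
    (hs : ∀ (V : (Proj 𝒜).Opens) (hV : V ≤ U)
      (φ : Γ(sheafHom (gradedTilde 𝒜 ℳ) (gradedTilde 𝒜 𝒩), V)),
      evalSection _ _ ((gradedTilde 𝒜 ℳ).res hV s) φ = 0) : s = 0 := by
  refine val_ext fun x hx => ?_
  obtain ⟨t, ht, htx⟩ := D.exists_notMem x
  have hxt : x ∈ U ⊓ Proj.basicOpen 𝒜 t := ⟨hx, htx⟩
  exact D.eq_zero_of_fiberFraction htx fun k => congrArg (fun w => val w x hxt)
    (hs (U ⊓ Proj.basicOpen 𝒜 t) inf_le_left (D.hom ht inf_le_right k))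

/-- A homomorphism `φ : M~ → N~` satisfies `(g k / t) φ = φ(1) (g k / t)`. -/
lemma smul_eq_smul_hom {t : A} (ht : t ∈ 𝒜 D.d) {U V : (Proj 𝒜).Opens}
    (hU : U ≤ Proj.basicOpen 𝒜 t) (φ : Γ(sheafHom (gradedTilde 𝒜 ℳ) (gradedTilde 𝒜 𝒩), U))
    {i : ℕ} {b h : A} (hb : b ∈ 𝒜 i) (hh : h ∈ 𝒜 i) (hV : V ≤ U)
    (hVh : V ≤ Proj.basicOpen 𝒜 h)
    (hφ : ∀ y (hy : y ∈ V), val (homApp φ le_rfl (D.oneSection U)) y (hV hy) =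
      LocalizedModule.mk (b • D.one) ⟨h, hVh hy⟩) (k : κ) :
    mkFunction (D.g_mem k) ht (hV.trans hU) • (sheafHom _ _).res hV φ =
      mkFunction hb hh hVh • D.hom ht (hV.trans hU) k := by
  refine homApp_ext fun W hW s => val_ext fun y hy => ?_
  obtain ⟨j, m, p, hm, hp, hpy, hW', hval⟩ := exists_val_eq_mk s hy
  have hty : t ∉ y.asHomogeneousIdeal.toIdeal := hU (hV (hW hy))
  have hhy : h ∉ y.asHomogeneousIdeal.toIdeal := hVh (hW hy)
  obtain ⟨c, hc, hcm⟩ := D.exists_smul_one (D.d + j) (D.θ k m) (by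
    have := D.θ_mem k _ m hm
    rwa [add_comm, ← Nat.cast_add] at this)
  have hTP : Proj.basicOpen 𝒜 p ≤ Proj.basicOpen 𝒜 (t * p) := fun z hz =>
    have := ProjectiveSpectrum.isPrime z
    Submonoid.mul_mem (Ideal.primeCompl _) (hU (hV (hW (hW' hz)))) hz
  -- `N` is cyclic, so `g k` times the numerator of `s` is a multiple `c` of its generator.
  -- Multiplied by `g k / t`, any section of `M~` thus becomes a function times the section `1`,
  -- where `φ` is known.
  have hsec : mkFunction (D.g_mem k) ht (hW'.trans (hW.trans (hV.trans hU))) •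
      (gradedTilde 𝒜 ℳ).res hW' s =
      mkFunction hc (SetLike.mul_mem_graded ht hp) hTP •
        (gradedTilde 𝒜 ℳ).res (hW'.trans (hW.trans hV)) (D.oneSection U) := by
    refine val_ext fun z hz => ?_
    refine Eq.trans (congrArg (Localization.mk (D.g k) (⟨t, hU (hV (hW (hW' hz)))⟩ :
      Ideal.primeCompl _) • ·) (hval z hz)) ?_
    exact D.smul_mk_one (hU (hV (hW (hW' hz)))) hz hcm
  have hsec' : mkFunction (D.g_mem k) ht (hW'.trans (hW.trans (hV.trans hU))) •
      (gradedTilde 𝒜 𝒩).res hW' (homApp φ (hW.trans hV) s) =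
      mkFunction hc (SetLike.mul_mem_graded ht hp) hTP •
        (gradedTilde 𝒜 𝒩).res (hW'.trans (hW.trans hV)) (homApp φ le_rfl (D.oneSection U)) := by
    rw [res_homApp, res_homApp, ← homApp_smul, ← homApp_smul, hsec]
  have hpy' : y ∈ Proj.basicOpen 𝒜 p := hpy
  refine (congrArg (fun r => val r y hpy') hsec').trans ?_
  refine (congrArg (Localization.mk c (⟨t * p, hTP hpy'⟩ : Ideal.primeCompl _) • ·)
    (hφ y (hW hy))).trans ?_
  refine (D.smul_mk_eq hty hpy hhy hcm).trans ?_
  exact congrArg (fun z => (Localization.mk b ⟨h, hhy⟩ :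
    Localization y.asHomogeneousIdeal.toIdeal.primeCompl) • fiberFraction 𝒜 (D.θ k) y hty z)
    (hval y hpy').symm

end ConductorData

end GradedTilde

/-! ### Homomorphisms out of the conductor are evaluations. -/

namespace GradedTilde

open Scheme.Modules

universe u

variable {A : Type u} {σ : Type*} [CommRing A] [SetLike σ A] [AddSubgroupClass σ A]
  {𝒜 : ℕ → σ} [GradedRing 𝒜] {M N : Type u} [AddCommGroup M] [Module A M]
  [AddCommGroup N] [Module A N] {ℳ : ℤ → AddSubgroup M} {𝒩 : ℤ → AddSubgroup N}

lemma exists_smul_eq_of_localizationMk_smul_eq {y : ProjectiveSpectrum.top 𝒜} {t h : A}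
    (hty : t ∉ y.asHomogeneousIdeal.toIdeal) (hhy : h ∉ y.asHomogeneousIdeal.toIdeal)
    {a b : A} {n n' : N}
    (heq : (Localization.mk a ⟨t, hty⟩ : Localization y.asHomogeneousIdeal.toIdeal.primeCompl) •
        (LocalizedModule.mk n ⟨h, hhy⟩ : Fiber 𝒜 N y) =
      (Localization.mk b ⟨t, hty⟩ : Localization y.asHomogeneousIdeal.toIdeal.primeCompl) •
        (LocalizedModule.mk n' ⟨h, hhy⟩ : Fiber 𝒜 N y)) :
    ∃ u ∉ y.asHomogeneousIdeal.toIdeal, u • a • n = u • b • n' := by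
  rw [LocalizedModule.mk_smul_mk, LocalizedModule.mk_smul_mk, LocalizedModule.mk_eq] at heq
  obtain ⟨u, hu⟩ := heq
  refine ⟨u * (t * h), Submonoid.mul_mem (Ideal.primeCompl _) u.2
    (Submonoid.mul_mem (Ideal.primeCompl _) hty hhy), ?_⟩
  rw [mul_smul, mul_smul (u : A)]
  exact hu

namespace ConductorData

variable {κ : Type*} (D : ConductorData 𝒜 ℳ 𝒩 κ)

include D

lemma fiberFraction_mk_smul {y : ProjectiveSpectrum.top 𝒜} {t p h : A}
    (hty : t ∉ y.asHomogeneousIdeal.toIdeal) (hhy : h ∉ y.asHomogeneousIdeal.toIdeal)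
    (hphy : p * h ∉ y.asHomogeneousIdeal.toIdeal) {r : M} {n : N} {k : κ}
    (hr : D.θ k r = p • n) :
    fiberFraction 𝒜 (D.θ k) y hty (LocalizedModule.mk (t • r) ⟨p * h, hphy⟩) =
      LocalizedModule.mk n ⟨h, hhy⟩ := by
  rw [fiberFraction_mk, LinearMap.map_smul, hr, LocalizedModule.mk_eq]
  exact ⟨1, by simp only [Submonoid.smul_def, smul_smul]; congr 1; ring⟩

variable [IsGradedModule 𝒜 ℳ] [IsGradedModule 𝒜 𝒩]

/-- Homomorphisms `ℋom(M~, N~) → N~` are locally evaluations at sections of `M~`. -/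
lemma exists_evalSection_eq [Finite κ] [Nonempty κ] {U : (Proj 𝒜).Opens}
    (Ψ : Γ(sheafHom (sheafHom (gradedTilde 𝒜 ℳ) (gradedTilde 𝒜 𝒩)) (gradedTilde 𝒜 𝒩), U))
    {x : ProjectiveSpectrum.top 𝒜} (hx : x ∈ U) :
    ∃ (V : (Proj 𝒜).Opens) (hV : V ≤ U) (s : Γ(gradedTilde 𝒜 ℳ, V)), x ∈ V ∧
      ∀ (W : (Proj 𝒜).Opens) (hW : W ≤ V)
        (φ : Γ(sheafHom (gradedTilde 𝒜 ℳ) (gradedTilde 𝒜 𝒩), W)),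
        evalSection _ _ ((gradedTilde 𝒜 ℳ).res hW s) φ = homApp Ψ (hW.trans hV) φ := by
  obtain ⟨t, ht, htx⟩ := D.exists_notMem x
  have hxt : x ∈ U ⊓ Proj.basicOpen 𝒜 t := ⟨hx, htx⟩
  -- The values of `Ψ` on the sections `g k / t` determine it; they are compatible because the `g k
  -- / t` are.
  let T (k : κ) : Γ(gradedTilde 𝒜 𝒩, U ⊓ Proj.basicOpen 𝒜 t) :=
    homApp Ψ inf_le_left (D.hom ht inf_le_right k)
  have hUt : U ⊓ Proj.basicOpen 𝒜 t ≤ Proj.basicOpen 𝒜 t := inf_le_right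
  have hT (k l : κ) : mkFunction (D.g_mem l) ht hUt • T k =
      mkFunction (D.g_mem k) ht hUt • T l := by
    rw [← homApp_smul, ← homApp_smul, D.smul_hom]
  obtain ⟨d, m, h, hm, hh, hhx, hhU, hval⟩ := exists_common_denominator T hxt
  have hxh : x ∈ Proj.basicOpen 𝒜 h := hhx
  have hloc (z : κ × κ) : ∃ u ∉ x.asHomogeneousIdeal.toIdeal,
      u • D.g z.2 • m z.1 = u • D.g z.1 • m z.2 := by
    refine exists_smul_eq_of_localizationMk_smul_eq htx hhx ?_
    have h1 (k l : κ) : val (mkFunction (D.g_mem l) ht hUt • T k) x hxt =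
        (Localization.mk (D.g l) ⟨t, htx⟩ :
          Localization x.asHomogeneousIdeal.toIdeal.primeCompl) •
          LocalizedModule.mk (m k) ⟨h, hhx⟩ :=
      congrArg ((Localization.mk (D.g l) ⟨t, htx⟩ :
          Localization x.asHomogeneousIdeal.toIdeal.primeCompl) • ·) (hval k x hxh)
    exact (h1 z.1 z.2).symm.trans
      ((congrArg (fun r => val r x hxt) (hT z.1 z.2)).trans (h1 z.2 z.1))
  choose u hu hum using hloc
  cases nonempty_fintype κ
  -- The numerators of the `T k` define a homomorphism from the ideal of the `g k` into `M`, near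
  -- `x`; depth two represents it by `r / p`. The degree shift `d - D.d` is that of numerator minus
  -- multiplier.
  obtain ⟨i, p, r, hp, hpx, hr, hpr⟩ := D.exists_smul_eq x (d - D.d) (fun k => D.e (m k))
    (fun k => by
      rw [sub_add_cancel]
      exact D.e_mem _ _ (hm k))
    (∏ z, u z) (Submonoid.prod_mem x.asHomogeneousIdeal.toIdeal.primeCompl fun z _ => hu z) (fun k l => by
      classical
      have h1 := congrArg D.e (hum (k, l))
      simp only [LinearMap.map_smul] at h1
      rw [← Finset.prod_erase_mul _ _ (Finset.mem_univ (k, l)), mul_smul, h1, ← mul_smul])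
  have hθ (k : κ) : D.θ k r = p • m k := D.e_injective (by rw [D.e_θ, hpr, LinearMap.map_smul])
  have htr : t • r ∈ ℳ ((i + d : ℕ) : ℤ) := by
    have := IsGradedModule.smul_mem (𝒜 := 𝒜) (ℳ := ℳ) ht hr
    convert this using 2
    push_cast
    ring
  have hle : Proj.basicOpen 𝒜 (p * h) ≤ Proj.basicOpen 𝒜 h := fun y hy hy' =>
    hy (Ideal.mul_mem_left _ _ hy')
  -- The section `t r / (p h)` is chosen so that `g k / t` sends it to `m k / h`, which is `T k`.
  refine ⟨Proj.basicOpen 𝒜 (p * h), hle.trans (hhU.trans inf_le_left),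
    mkSection htr (SetLike.mul_mem_graded hp hh) le_rfl,
    Submonoid.mul_mem (Ideal.primeCompl _) hpx hhx, fun W hW φ => val_ext fun y hy => ?_⟩
  have hWt : W ≤ Proj.basicOpen 𝒜 t := hW.trans (hle.trans (hhU.trans inf_le_right))
  obtain ⟨j, w, q, hw, hq, hqy, hqW, hφ⟩ := exists_val_eq_mk (homApp φ le_rfl (D.oneSection W)) hy
  have hyq : y ∈ Proj.basicOpen 𝒜 q := hqy
  obtain ⟨b, hb, rfl⟩ := D.exists_smul_one j w hw
  have hlin := D.smul_eq_smul_hom ht hWt φ hb hq hqW le_rfl hφ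
  -- Multiplied by `g k / t`, the homomorphism `φ` becomes `b / q` times `g k / t`, on which both
  -- `Ψ` and evaluation at the section give `(b / q) T k`; the multipliers `g k / t` are jointly
  -- injective on `N~`.
  refine D.eq_of_smul_eq (hWt hy) fun k => ?_
  have hq0 : Proj.basicOpen 𝒜 q ≤ U :=
    hqW.trans (hW.trans (hle.trans (hhU.trans inf_le_left)))
  have hres : (gradedTilde 𝒜 𝒩).res (hqW.trans (hW.trans (hle.trans hhU))) (T k) =
      homApp Ψ hq0 (D.hom ht (hqW.trans hWt) k) := res_homApp _ _ _ _
  have h1 : mkFunction (D.g_mem k) ht (hqW.trans hWt) •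
      (gradedTilde 𝒜 𝒩).res hqW
        (homApp Ψ (hW.trans (hle.trans (hhU.trans inf_le_left))) φ) =
      mkFunction hb hq le_rfl •
        (gradedTilde 𝒜 𝒩).res (hqW.trans (hW.trans (hle.trans hhU))) (T k) := by
    rw [hres, res_homApp, ← homApp_smul, ← homApp_smul, hlin]
  have h2 := congrArg (fun ψ => homApp ψ le_rfl ((gradedTilde 𝒜 ℳ).res (hqW.trans hW)
    (mkSection htr (SetLike.mul_mem_graded hp hh) le_rfl))) (hlin k)
  have h3 : (gradedTilde 𝒜 𝒩).res hqW (homApp φ le_rfl ((gradedTilde 𝒜 ℳ).res hW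
      (mkSection htr (SetLike.mul_mem_graded hp hh) le_rfl))) =
      homApp ((sheafHom _ _).res hqW φ) le_rfl ((gradedTilde 𝒜 ℳ).res (hqW.trans hW)
        (mkSection htr (SetLike.mul_mem_graded hp hh) le_rfl)) := res_homApp _ _ _ _
  refine (congrArg (fun r => (Localization.mk (D.g k) ⟨t, hWt hy⟩ :
    Localization y.asHomogeneousIdeal.toIdeal.primeCompl) • val r y hyq) h3).trans ?_
  refine (congrArg (fun r => val r y hyq) h2).trans
    (Eq.trans ?_ (congrArg (fun r => val r y hyq) h1).symm)
  refine congrArg (fun z : Fiber 𝒜 N y => (Localization.mk b ⟨q, hqy⟩ :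
    Localization y.asHomogeneousIdeal.toIdeal.primeCompl) • z) ?_
  exact (D.fiberFraction_mk_smul (hWt hy) (hle (hW hy)) (hW hy) (hθ k)).trans
    (hval k y (hle (hW hy))).symm

/-- In the situation of `ConductorData`, `M~` is reflexive with respect to `N~`. -/
theorem isIso_toDoubleHom [Finite κ] [Nonempty κ] :
    IsIso (toDoubleHom (gradedTilde 𝒜 ℳ) (gradedTilde 𝒜 𝒩)) :=
  Scheme.Modules.isIso_toDoubleHom _ _ (fun _ _ hs => D.eq_zero_of_evalSection hs)
    fun U Ψ x => D.exists_evalSection_eq ((homSections _ _ U).symm Ψ) x.2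

end ConductorData

end GradedTilde

/-! ### The conductor data of `R`, and the theorem. -/

namespace CanonicalSurface

open MvPolynomial GradedTilde

variable {n : ℕ} {α β : Matrix (Fin (n + 1)) (Fin (n + 1)) Coord}
  (hα₀ : ∀ j, (α 0 j).IsHomogeneous 3) (hβ₀ : ∀ j, (β 0 j).IsHomogeneous 3)
  (hα : ∀ (i : Fin n) (j : Fin (n + 1)), (α i.succ j).IsHomogeneous 1)
  (hβ : ∀ (i : Fin n) (j : Fin (n + 1)), (β i.succ j).IsHomogeneous 1)
  (hsymm : α * β.transpose = β * α.transpose) (htrans : IsTransverse (lowerMatrix α β))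
  (hminors : ∀ d : Coord, (∀ f ∈ minorsIdeal (bigMatrix α β), d ∣ f) → IsUnit d)

include hα₀ hβ₀ hα hβ hsymm htrans hminors

/-- Depth at a closed point `q` below `x` gives a solution with inhomogeneous `a` and `r`. Some
homogeneous component of `a * u` misses the prime `x`, and the matching component of `r` solves the
homogeneous problem. -/
lemma R.exists_homogeneous_smul_eq (x : ProjectiveSpectrum grading) (c : ℤ)
    (m : Cols n → R α β) (hm : ∀ k, m k ∈ RDeg α β (c + n)) (u : Coord)
    (hu : u ∉ x.asHomogeneousIdeal.toIdeal)
    (hum : ∀ k l, u • minor α β l • m k = u • minor α β k • m l) :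
    ∃ (i : ℕ) (h : Coord) (r : R α β), h ∈ grading i ∧ h ∉ x.asHomogeneousIdeal.toIdeal ∧
      r ∈ RDeg α β (i + c) ∧ ∀ k, minor α β k • r = h • m k := by
  classical
  obtain ⟨q, hq, hxq⟩ := exists_point x
  obtain ⟨a, r, ha, hr⟩ := R.exists_smul_eq hsymm hminors
    (exists_linearIndependent_gradient hα hβ hsymm htrans hq) (m := fun k => u • m k)
    (fun k l => by rw [smul_comm, hum, smul_comm])
  have hau : a * u ∉ x.asHomogeneousIdeal.toIdeal := fun h =>
    (x.isPrime.mem_or_mem h).elim (fun h => ha (hxq h)) hu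
  obtain ⟨i, hi⟩ : ∃ i, ((DirectSum.decompose grading (a * u) i : grading i) : Coord) ∉
      x.asHomogeneousIdeal.toIdeal := by
    by_contra! hcon
    rw [← DirectSum.sum_support_decompose grading (a * u)] at hau
    exact hau (sum_mem fun i _ => hcon i)
  let P := R.gradedProj hα₀ hβ₀ hα hβ
  refine ⟨i, _, P.proj (i + c) r, SetLike.coe_mem _, hi, P.proj_mem _ _, fun k => ?_⟩
  rw [← P.proj_smul_of_mem (hm k), ← P.proj_smul (minor_mem hα hβ k), hr, mul_smul]
  congr 2
  ring

/-- The maximal minors of `A'` multiply `R` into `𝒜 / Ann R`. -/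
noncomputable def conductorData :
    ConductorData grading (RDeg α β) (quotDeg formDeg (idealY α β)) (Cols n) where
  e := genMap α β
  e_injective := genMap_injective hsymm hminors hα hβ htrans
  e_mem k _ := by
    rintro ⟨a, ha, rfl⟩
    refine ⟨a • Pi.single 0 1, fun i => ?_, rfl⟩
    refine Fin.cases ?_ (fun i => ?_) i
    · simpa using ha
    · simp
  d := n
  g := minor α β
  g_mem := minor_mem hα hβ
  θ c := (exists_thetaBar hsymm hminors hα hβ htrans c).choose
  θ_mem c i _ := by
    rintro ⟨v, hv, rfl⟩
    exact ⟨theta α β c v, theta_mem hα₀ hβ₀ hα hβ c hv,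
      ((exists_thetaBar hsymm hminors hα hβ htrans c).choose_spec v).symm⟩
  e_θ c r := by
    obtain ⟨v, rfl⟩ := Submodule.mkQ_surjective _ r
    rw [(exists_thetaBar hsymm hminors hα hβ htrans c).choose_spec, genMap_mk, minor_smul_mk]
  one := Submodule.mkQ _ 1
  one_mem := ⟨1, (mem_formDeg_iff (i := 0)).2
    ((mem_homogeneousSubmodule _ _).2 (isHomogeneous_one _ _)), rfl⟩
  exists_smul_one i _ := by
    rintro ⟨a, ha, rfl⟩
    refine ⟨a, mem_formDeg_iff.1 ha, ?_⟩
    rw [← map_smul, smul_eq_mul, mul_one]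
    rfl
  eq_zero _ := R.eq_zero_of_minor_smul hsymm hminors hα hβ htrans
  exists_smul_eq := R.exists_homogeneous_smul_eq hα₀ hβ₀ hα hβ hsymm htrans hminors
  exists_notMem x := by
    obtain ⟨i, hi⟩ := exists_X_notMem x
    -- The denominator must have the degree `n` of the minors, whence this power.
    refine ⟨X i ^ n, by simpa using SetLike.pow_mem_graded n (X_mem_grading i), fun h => hi ?_⟩
    exact x.isPrime.mem_of_pow_mem n h

end CanonicalSurface

theorem lemma3p3 (n : ℕ)
    (α β : Matrix (Fin (n + 1)) (Fin (n + 1)) CanonicalSurface.Coord)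
    -- the first row of `A = (α β)` consists of cubic forms, the others of linear forms
    (hα₀ : ∀ j, (α 0 j).IsHomogeneous 3) (hβ₀ : ∀ j, (β 0 j).IsHomogeneous 3)
    (hα : ∀ (i : Fin n) (j : Fin (n + 1)), (α i.succ j).IsHomogeneous 1)
    (hβ : ∀ (i : Fin n) (j : Fin (n + 1)), (β i.succ j).IsHomogeneous 1)
    (hsymm : α * β.transpose = β * α.transpose)
    (htrans : CanonicalSurface.IsTransverse (CanonicalSurface.lowerMatrix α β))
    -- the maximal minors of `A` have no common factor
    (hminors : ∀ d : CanonicalSurface.Coord,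
      (∀ f ∈ CanonicalSurface.minorsIdeal (CanonicalSurface.bigMatrix α β), d ∣ f) → IsUnit d)
    (hprime : (CanonicalSurface.idealY α β).IsPrime) :
    -- the natural map `R → Γ_*(R~)` is an isomorphism of graded modules
    (∃ e : CanonicalSurface.R α β ≃ₗ[CanonicalSurface.Coord]
        GradedTilde.GammaStar CanonicalSurface.grading (CanonicalSurface.RDeg α β),
      ∀ (j : ℤ) (m : CanonicalSurface.RDeg α β j),
        e m = GradedTilde.GammaStar.of CanonicalSurface.grading (CanonicalSurface.RDeg α β) j
          (GradedTilde.toGlobalSections CanonicalSurface.grading (CanonicalSurface.RDeg α β) j m)) ∧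
    -- `R~` is reflexive if the points defined by `I_n(A')` are improper double points of `Y`
    ((∀ q : Fin 5 → ℂ, q ≠ 0 →
        (∀ f ∈ CanonicalSurface.minorsIdeal (CanonicalSurface.lowerMatrix α β),
          MvPolynomial.eval q f = 0) →
        CanonicalSurface.IsImproperDoublePoint (CanonicalSurface.idealY α β) q) →
      CategoryTheory.IsIso
        (AlgebraicGeometry.Scheme.Modules.toDoubleHom (CanonicalSurface.RSheaf α β)
            (CanonicalSurface.OY α β) :
          CanonicalSurface.RSheaf α β ⟶
            (CanonicalSurface.conductorSheaf α β).sheafHom (CanonicalSurface.OY α β))) := by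
  refine ⟨CanonicalSurface.exists_linearEquiv_gammaStar
    (CanonicalSurface.R.gradedProj hα₀ hβ₀ hα hβ) (fun m hm => ?_) (fun g m hg hgm => ?_),
    fun _ => ?_⟩
  · refine CanonicalSurface.R.eq_zero_of_X_mem_radical hsymm hminors
      (g := fun a : Ideal.torsionOf CanonicalSurface.Coord (CanonicalSurface.R α β) m =>
        (a : CanonicalSurface.Coord)) (fun i => ?_) fun a => a.2
    have hrange : Set.range (fun a : Ideal.torsionOf CanonicalSurface.Coord
        (CanonicalSurface.R α β) m => (a : CanonicalSurface.Coord)) =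
        (Ideal.torsionOf CanonicalSurface.Coord (CanonicalSurface.R α β) m :
          Set CanonicalSurface.Coord) := Subtype.range_coe
    rw [hrange, Ideal.span_eq]
    exact hm i
  -- Depth at the irrelevant ideal is local depth at the origin, where the coordinates have
  -- independent gradients.
  · exact CanonicalSurface.R.exists_smul_eq hsymm hminors
      (Or.inr ⟨fun k => MvPolynomial.X k.castSucc, fun k => hg _,
        CanonicalSurface.linearIndependent_gradient_X 0⟩) hgm
  · exact (CanonicalSurface.conductorData hα₀ hβ₀ hα hβ hsymm htrans hminors).isIso_toDoubleHom
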